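/- \textbf{Proposition (Certificate).} Let $X$ be a $K(\pi,1)$, i.e. a path-connected space with $\pi_n(X)=0$ for all $n\ge 2$. Closed oriented surfaces are not assumed to be connected; each is equipped with a finite oriented triangulation (which always exists), $\chi$ denotes the Euler characteristic, and $[S]\in H_2(S;\mathbb Z)$ denotes the fundamental class of $S$. A continuous map $f:S\to X$ of a closed oriented surface \emph{represents} $\alpha\in H_2(X;\mathbb Z)$ if $f_*[S]=\alpha$. A component of such a surface is a sphere if it has genus $0$ (Euler characteristic $2$) and a torus if it has genus $1$ (Euler characteristic $0$). The \emph{Gromov--Thurston norm} of $\alpha\in H_2(X;\mathbb Z)$ is $$\|\alpha\| = \inf_{(T,g,n)} \frac{-\chi(T)}{n},$$ where the infimum is over all integers $n\ge 1$, all closed oriented surfaces $T$ without spherical components, and all continuous maps $g:T\to X$ representing $n\alpha$. Let $\alpha\in H_2(X;\mathbb Z)$ be represented by a map $f:S\to X$, where $S$ is a closed oriented surface with no torus or spherical components. If $$\|\alpha\| > -\chi(S)-2,$$ then $f$ is geometrically incompressible: for every base point $x\in S$ and every simple closed loop $\gamma$ in $S$ based at $x$ (that is, a continuous loop that is injective except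 that its two endpoints coincide), if $\gamma$ is nontrivial in $\pi_1(S,x)$, then $f_*[\gamma]\neq 1$ in $\pi_1(X,f(x))$. -/

import Mathlib

open CategoryTheory Simplicial Topology

universe u

/-- A closed oriented surface, not necessarily connected, given by an oriented triangulation:
a finite simplicial complex of pure dimension two in which every edge lies in exactly two
triangles and the link of every vertex is connected (hence a single cycle), together with a
coherent orientation of the triangles. The vertices are totally ordered, and the orientation of
a triangle is recorded as a sign relative to the increasing order of its vertices. -/
structure ClosedOrientedSurface where
  /-- The vertices of the triangulation. -/
  V : Type
  [fintypeV : Fintype V]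
  [linearOrderV : LinearOrder V]
  /-- The triangles, as sets of three vertices. -/
  triangles : Finset (Finset V)
  card_triangle : ∀ t ∈ triangles, t.card = 3
  exists_triangle : ∀ v : V, ∃ t ∈ triangles, v ∈ t
  /-- Every edge of a triangle is an edge of exactly one other triangle. -/
  existsUnique_neighbour : ∀ t ∈ triangles, ∀ v ∈ t,
    ∃! t' : Finset V, t' ∈ triangles ∧ t' ≠ t ∧ t.erase v ⊆ t'
  /-- The link of a vertex is connected: any two triangles at `v` are joined by a chain of
  triangles at `v`, consecutive ones sharing an edge that contains `v`. -/
  link_connected : ∀ v a b : V, (∃ t ∈ triangles, v ∈ t ∧ a ∈ t ∧ a ≠ v) →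
    (∃ t ∈ triangles, v ∈ t ∧ b ∈ t ∧ b ≠ v) →
    (SimpleGraph.fromRel fun x y : V => ({v, x, y} : Finset V) ∈ triangles).Reachable a b
  /-- The orientation of a triangle: `1` if it is the one given by the increasing order of the
  vertices, and `-1` otherwise. -/
  sign : Finset V → ℤˣ
  /-- Two triangles with a common edge induce opposite orientations on it. The face of `t`
  opposite to its vertex `v` has incidence number `(-1) ^ i`, where `i` is the number of vertices
  of `t` smaller than `v`. -/
  sign_coherent : ∀ t ∈ triangles, ∀ t' ∈ triangles, t ≠ t' → ∀ v ∈ t, ∀ v' ∈ t',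
    t.erase v = t'.erase v' →
      sign t * (-1) ^ (t.filter (· < v)).card = -(sign t' * (-1) ^ (t'.filter (· < v')).card)

namespace ClosedOrientedSurface

attribute [instance] fintypeV linearOrderV

variable (S : ClosedOrientedSurface)

/-- The underlying topological space of the surface: the geometric realization of the
triangulation, in barycentric coordinates. -/
def Carrier : Type :=
  {x : stdSimplex ℝ S.V // ∃ t ∈ S.triangles, ∀ v, v ∉ t → x v = 0}

instance : TopologicalSpace S.Carrier :=
  instTopologicalSpaceSubtype

/-- The edges of the triangulation, as sets of two vertices. -/
def edges : Finset (Finset S.V) :=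
  S.triangles.biUnion fun t => t.powersetCard 2

/-- The Euler characteristic of the surface. -/
def eulerChar : ℤ :=
  Fintype.card S.V - S.edges.card + S.triangles.card

/-- The 1-skeleton; its connected components correspond to those of the surface. -/
def skeleton : SimpleGraph S.V :=
  SimpleGraph.fromRel fun v w => ({v, w} : Finset S.V) ∈ S.edges

/-- The Euler characteristic of a connected component of the surface. -/
noncomputable def componentEulerChar (c : S.skeleton.ConnectedComponent) : ℤ :=
  c.supp.ncard - {e | e ∈ S.edges ∧ (e : Set S.V) ⊆ c.supp}.ncard
    + {t | t ∈ S.triangles ∧ (t : Set S.V) ⊆ c.supp}.ncard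

/-- The connected component `c` has genus `g`. -/
def HasGenus (c : S.skeleton.ConnectedComponent) (g : ℕ) : Prop :=
  S.componentEulerChar c = 2 - 2 * g

/-- A spherical component is a component of genus zero. -/
def IsSphere (c : S.skeleton.ConnectedComponent) : Prop := S.HasGenus c 0

/-- A torus component is a component of genus one. -/
def IsTorus (c : S.skeleton.ConnectedComponent) : Prop := S.HasGenus c 1

variable {S}

lemma extend_mem {t : Finset S.V} (ht : t ∈ S.triangles) (x : stdSimplex ℝ (Fin 3)) :
    ∃ t' ∈ S.triangles, ∀ v, v ∉ t' →
      stdSimplex.map (t.orderEmbOfFin (S.card_triangle t ht)) x v = 0 := by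
  refine ⟨t, ht, fun v hv => ?_⟩
  rw [stdSimplex.map_coe, FunOnFinite.linearMap_apply_apply]
  refine Finset.sum_eq_zero fun i hi => ?_
  simp only [Finset.mem_filter, Finset.mem_univ, true_and] at hi
  exact absurd (hi ▸ Finset.orderEmbOfFin_mem t _ i) hv

/-- The parametrization of a closed triangle by the standard 2-simplex which is affine and
increasing on vertices. -/
noncomputable def param {t : Finset S.V} (ht : t ∈ S.triangles) :
    C(stdSimplex ℝ (Fin 3), S.Carrier) where
  toFun x := ⟨stdSimplex.map (t.orderEmbOfFin (S.card_triangle t ht)) x, extend_mem ht x⟩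
  continuous_toFun := (stdSimplex.continuous_map _).subtype_mk _

end ClosedOrientedSurface

/-- The singular chain complex of `X` with integer coefficients. -/
noncomputable abbrev singularChains (X : Type u) [TopologicalSpace X] :
    ChainComplex (ModuleCat.{u} ℤ) ℕ :=
  (TopCat.toSSet.obj (TopCat.of X)).chainComplex (ModuleCat.of ℤ (ULift.{u} ℤ))

/-- The second singular homology group of `X` with integer coefficients. -/
noncomputable abbrev H2 (X : Type u) [TopologicalSpace X] : ModuleCat.{u} ℤ :=
  (singularChains X).homology 2

lemma H2_eq_singularHomology (X : Type u) [TopologicalSpace X] :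
    H2 X = ((AlgebraicTopology.singularHomologyFunctor (ModuleCat.{u} ℤ) 2).obj
      (ModuleCat.of ℤ (ULift.{u} ℤ))).obj (TopCat.of X) :=
  rfl

/-- The singular 2-chain with value one on the singular simplex `σ`. -/
noncomputable def singularSimplex {X : Type u} [TopologicalSpace X]
    (σ : C(stdSimplex ℝ (Fin 3), X)) : (singularChains X).X 2 :=
  ((TopCat.toSSet.obj (TopCat.of X)).ιChainComplex (R := ModuleCat.of ℤ (ULift.{u} ℤ))
    ((TopCat.toSSetObjEquiv (TopCat.of X) (.op ⦋2⦌)).symm σ)).hom (ULift.up 1)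

namespace ClosedOrientedSurface

variable {S : ClosedOrientedSurface} {X : Type u} [TopologicalSpace X]

/-- The image under `f` of the fundamental cycle of `S`, i.e. of the sum of its oriented
triangles. -/
noncomputable def fundamentalChain (f : C(S.Carrier, X)) : (singularChains X).X 2 :=
  ∑ t : {t // t ∈ S.triangles}, (S.sign t : ℤ) • singularSimplex (f.comp (param t.2))

/-- The map `f : S → X` represents `α`, i.e. `f_*[S] = α`. -/
def Represents (f : C(S.Carrier, X)) (α : H2 X) : Prop :=
  ∃ z : (singularChains X).cycles 2,
    ((singularChains X).iCycles 2).hom z = fundamentalChain f ∧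
      ((singularChains X).homologyπ 2).hom z = α

/-- The map `f : S → X` is geometrically incompressible: the kernel of `π₁(S) → π₁(X)` contains
no homotopically nontrivial simple loop. -/
def IsIncompressible (f : C(S.Carrier, X)) : Prop :=
  ∀ (x : S.Carrier) (p : Path x x), Set.InjOn p (Set.Ico 0 1) →
    FundamentalGroup.map f x (FundamentalGroup.fromPath (.mk p)) = 1 →
      FundamentalGroup.fromPath (Path.Homotopic.Quotient.mk p) = 1

end ClosedOrientedSurface

/-- The Gromov–Thurston norm of `α`: the infimum of `-χ(T) / n` over all closed oriented surfaces
`T` without spherical components and all maps `T → X` representing `n • α`, where `n ≥ 1`. -/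
noncomputable def gromovThurstonNorm {X : Type u} [TopologicalSpace X] (α : H2 X) : EReal :=
  ⨅ (T : ClosedOrientedSurface) (f : C(T.Carrier, X)) (n : ℕ) (_ : 1 ≤ n)
    (_ : ∀ c, ¬ T.IsSphere c) (_ : ClosedOrientedSurface.Represents f (n • α)),
    ((-(T.eulerChar : ℝ) / n : ℝ) : EReal)

/-- `X` is a `K(π, 1)`: it is path connected and its higher homotopy groups vanish. -/
def IsEilenbergMacLaneOne (X : Type u) [TopologicalSpace X] : Prop :=
  PathConnectedSpace X ∧ ∀ n : ℕ, 2 ≤ n → ∀ x : X, Subsingleton (π_ n X x)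

/-! Suppose a simple loop γ is essential in S but dies in X. Compressing S along such a curve, that
is, cutting along it and closing the two boundary circles by discs, gives a surface T with χ(T) =
χ(S) + 2 and a map to X in the same class. If T has no spherical component, then taking n = 1 in the
infimum yields ‖α‖ ≤ -χ(S) - 2, against the hypothesis. A component of T that contains both discs or
neither has the Euler characteristic of a component of S, or that plus two; it is not a sphere
because S has neither spheres nor tori. A spherical component with exactly one disc would make the
curve bound a disc in S, against essentiality.

The loop is only continuous, so it is first replaced by a simple edge cycle. Repeated bisection of
longest edges gives refinements of any mesh, with the same χ and fundamental class
(`Refinement.exists_meshLE`, `represents_bisect`). In a refinement, γ is freely homotopic to a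
closed edge walk in `traceGraph`, the graph of vertices whose open stars meet at a point of γ. If
the mesh is small, the path along γ followed by a segment to a vertex v (an `arm`) has a class in X
that depends only on v (`map_arm_eq`): injectivity of γ forces points that are close in S to be
close on the circle (`exists_tolerance`), and running once around γ is invisible in X. So every
cycle of the trace graph dies in X, while some closed walk has nontrivial holonomy in the
fundamental groupoid of the surface. A shortest such walk is a simple cycle ν
(`exists_cycle_of_holonomy`). It need not be homotopic to γ, but it is simple, essential, and
trivial in X, which is all that is needed.

The surgery is combinatorial. Triangulations are encoded as relations `OrTri`; `OrTri.cut` doubles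
the vertices of ν according to the side of the cycle and adds two cones. In `exists_map_cutSurface`
both cones receive the same filling of the null-homotopic loop, with opposite orientations, so they
cancel and the fundamental chain is literally unchanged. In `chi2_cut_ne` the fundamental groupoid
enters as a nonabelian cocycle on edges. On a sphere punctured at a vertex such a cocycle is a
coboundary, by a tree-cotree argument (`exists_potential`), and this would make the labels along ν a
coboundary. -/

open unitInterval

/-! ### Oriented triangulations as ternary relations -/

/-- An oriented triangulation of a closed surface with vertex set `V`: `R a b c` says that
`a, b, c` span a triangle and that this cyclic order is the positive one. -/
structure OrTri (V : Type) where
  /-- The positively oriented triangles. -/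
  R : V → V → V → Prop
  cyc : ∀ {a b c}, R a b c → R b c a
  ne : ∀ {a b c}, R a b c → a ≠ b
  uniq : ∀ {a b c d}, R a b c → R a b d → c = d
  opp : ∀ {a b c}, R a b c → ∃ d, R b a d
  not_swap : ∀ {a b c}, R a b c → ¬ R b a c
  cover : ∀ a, ∃ b c, R a b c
  /-- The link of a vertex is connected. -/
  link : ∀ v (A : V → Prop), (∀ x y, R v x y → (A x ↔ A y)) →
    ∀ x y x' y', R v x x' → R v y y' → A x → A y

/-- The sign of the pair `(x, y)`: `1` if it is increasing. -/
def pairSign {V : Type} [LinearOrder V] (x y : V) : ℤˣ := if x < y then 1 else -1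

/-- The sign of the permutation that sorts the triple `(a, b, c)`. -/
def triSign {V : Type} [LinearOrder V] (a b c : V) : ℤˣ :=
  pairSign a b * pairSign b c * pairSign a c

lemma pairSign_swap {V : Type} [LinearOrder V] {x y : V} (h : x ≠ y) :
    pairSign y x = - pairSign x y := by
  unfold pairSign
  rcases lt_or_gt_of_ne h with h | h
  · simp [h, h.not_gt]
  · simp [h, h.not_gt]

lemma triSign_cyc {V : Type} [LinearOrder V] {a b c : V} (h : a ≠ b) (h' : a ≠ c) :
    triSign b c a = triSign a b c := by
  unfold triSign
  rw [pairSign_swap h, pairSign_swap h']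
  simp only [mul_neg, neg_mul, neg_neg]
  rw [mul_comm, ← mul_assoc]

lemma triSign_swap {V : Type} [LinearOrder V] {a b c : V} (h : a ≠ b) :
    triSign b a c = - triSign a b c := by
  unfold triSign
  rw [pairSign_swap h]
  simp only [neg_mul]
  rw [mul_right_comm]

lemma triSign_of_lt {V : Type} [LinearOrder V] {a b c : V} (h : a < b) (h' : b < c) :
    triSign a b c = 1 := by
  simp [triSign, pairSign, h, h', h.trans h']

/-- The incidence number of the face opposite to `v` in terms of signs. -/
lemma neg_one_pow_card_filter_lt {V : Type} [LinearOrder V] {v a b : V} (ha : v ≠ a)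
    (hb : v ≠ b) (hab : a ≠ b) :
    (-1 : ℤˣ) ^ ((({v, a, b} : Finset V)).filter (· < v)).card = pairSign v a * pairSign v b := by
  unfold pairSign
  rcases lt_or_gt_of_ne ha with h | h <;> rcases lt_or_gt_of_ne hb with h' | h' <;>
    simp [Finset.filter_insert, Finset.filter_singleton, h, h', h.not_gt, h'.not_gt, hab]

namespace OrTri

variable {V : Type} (O : OrTri V)

lemma ne' {a b c : V} (h : O.R a b c) : a ≠ b ∧ b ≠ c ∧ a ≠ c :=
  ⟨O.ne h, O.ne (O.cyc h), (O.ne (O.cyc (O.cyc h))).symm⟩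

lemma exists_of_mem [DecidableEq V] {x y z a b : V} (h : O.R x y z)
    (ha : a ∈ ({x, y, z} : Finset V)) (hb : b ∈ ({x, y, z} : Finset V)) (hab : a ≠ b) :
    ∃ e, ({x, y, z} : Finset V) = {a, b, e} ∧ (O.R a b e ∨ O.R b a e) := by
  have h1 := O.cyc h
  have h2 := O.cyc h1
  simp only [Finset.mem_insert, Finset.mem_singleton] at ha hb
  rcases ha with rfl | rfl | rfl <;> rcases hb with rfl | rfl | rfl <;>
    first
    | exact absurd rfl hab
    | exact ⟨_, rfl, .inl h⟩
    | exact ⟨z, by ext; simp; tauto, .inr h⟩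
    | exact ⟨x, by ext; simp; tauto, .inl h1⟩
    | exact ⟨x, by ext; simp; tauto, .inr h1⟩
    | exact ⟨y, by ext; simp; tauto, .inl h2⟩
    | exact ⟨y, by ext; simp; tauto, .inr h2⟩

lemma exists_of_mem' [DecidableEq V] {x y z a : V} (h : O.R x y z)
    (ha : a ∈ ({x, y, z} : Finset V)) :
    ∃ b c, ({x, y, z} : Finset V) = {a, b, c} ∧ O.R a b c := by
  have h1 := O.cyc h
  have h2 := O.cyc h1
  simp only [Finset.mem_insert, Finset.mem_singleton] at ha
  rcases ha with rfl | rfl | rfl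
  · exact ⟨_, _, rfl, h⟩
  · exact ⟨_, _, by ext; simp; tauto, h1⟩
  · exact ⟨_, _, by ext; simp; tauto, h2⟩

lemma R_of_eq [DecidableEq V] {x y z a b c : V} (h : O.R x y z)
    (he : ({x, y, z} : Finset V) = {a, b, c}) (hab : a ≠ b) (hac : a ≠ c) (hbc : b ≠ c) :
    O.R a b c ∨ O.R b a c := by
  obtain ⟨e, h1, h2⟩ := O.exists_of_mem h (a := a) (b := b) (by simp [he]) (by simp [he]) hab
  have : c ∈ ({a, b, e} : Finset V) := by rw [← h1, he]; simp
  simp only [Finset.mem_insert, Finset.mem_singleton] at this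
  obtain rfl : c = e := by tauto
  exact h2

open Classical in
/-- The triangles as sets of vertices. -/
noncomputable def tris [Fintype V] : Finset (Finset V) :=
  Finset.univ.filter fun t => ∃ a b c, O.R a b c ∧ t = {a, b, c}

lemma mem_tris [Fintype V] [DecidableEq V] {t : Finset V} :
    t ∈ O.tris ↔ ∃ a b c, O.R a b c ∧ t = {a, b, c} := by
  simp only [tris, Finset.mem_filter, Finset.mem_univ, true_and]
  constructor <;> rintro ⟨a, b, c, h, rfl⟩ <;> refine ⟨a, b, c, h, ?_⟩ <;> congr!

open Classical in
/-- The orientation signs. -/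
noncomputable def sgn [LinearOrder V] (t : Finset V) : ℤˣ :=
  if ∃ a b c, a < b ∧ b < c ∧ O.R a b c ∧ t = {a, b, c} then 1 else -1

lemma sgn_eq_of_lt [LinearOrder V] {a b c : V} (hab : a < b) (hbc : b < c) (h : O.R a b c) :
    O.sgn {a, b, c} = 1 := by
  rw [sgn, if_pos ⟨a, b, c, hab, hbc, h, rfl⟩]

lemma sgn_eq_of_lt' [LinearOrder V] {a b c : V} (hab : a < b) (hbc : b < c) (h : O.R b a c) :
    O.sgn {a, b, c} = -1 := by
  rw [sgn, if_neg]
  rintro ⟨x, y, z, hxy, hyz, hR, he⟩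
  have key : a = x ∧ b = y ∧ c = z := by
    simp only [Finset.ext_iff, Finset.mem_insert, Finset.mem_singleton] at he
    have h1 := (he a).1 (.inl rfl)
    have h2 := (he b).1 (.inr (.inl rfl))
    have h3 := (he c).1 (.inr (.inr rfl))
    have h4 := (he x).2 (.inl rfl)
    have h5 := (he y).2 (.inr (.inl rfl))
    have h6 := (he z).2 (.inr (.inr rfl))
    grind
  obtain ⟨rfl, rfl, rfl⟩ := key
  exact O.not_swap hR h

/-- `sgn` looks only at the sorted triple, whereas `R` comes in any rotation. Rotating leaves
`triSign` unchanged and swapping two entries negates it, so every ordering of the vertices reduces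
to a sorted one. -/
lemma sgn_eq [LinearOrder V] {a b c : V} (h : O.R a b c) : O.sgn {a, b, c} = triSign a b c := by
  obtain ⟨hab, hbc, hac⟩ := O.ne' h
  have h1 := O.cyc h
  have h2 := O.cyc h1
  have e1 : ({a, b, c} : Finset V) = {b, c, a} := by ext; simp; tauto
  have e2 : ({a, b, c} : Finset V) = {c, a, b} := by ext; simp; tauto
  have e3 : ({a, b, c} : Finset V) = {b, a, c} := by ext; simp; tauto
  have e4 : ({a, b, c} : Finset V) = {c, b, a} := by ext; simp; tauto
  have e5 : ({a, b, c} : Finset V) = {a, c, b} := by ext; simp; tauto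
  have t1 : triSign b c a = triSign a b c := triSign_cyc hab hac
  have t2 : triSign c a b = triSign a b c := by rw [← t1, triSign_cyc hbc hab.symm]
  have t3 : triSign b a c = - triSign a b c := triSign_swap hab
  have t4 : triSign c b a = - triSign a b c := by rw [triSign_swap hbc, t1]
  have t5 : triSign a c b = - triSign a b c := by rw [triSign_swap hac.symm, t2]
  rcases lt_or_gt_of_ne hab with x | x <;> rcases lt_or_gt_of_ne hbc with y | y <;>
    rcases lt_or_gt_of_ne hac with z | z
  · rw [O.sgn_eq_of_lt x y h, triSign_of_lt x y]
  · exact absurd (x.trans y) z.not_gt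
  · rw [e5, O.sgn_eq_of_lt' z y h2, ← neg_neg (triSign a b c), ← t5, triSign_of_lt z y]
  · rw [e2, O.sgn_eq_of_lt z x h2, ← t2, triSign_of_lt z x]
  · rw [e3, O.sgn_eq_of_lt' x z h, ← neg_neg (triSign a b c), ← t3, triSign_of_lt x z]
  · rw [e1, O.sgn_eq_of_lt y z h1, ← t1, triSign_of_lt y z]
  · exact absurd (y.trans x) z.not_gt
  · rw [e4, O.sgn_eq_of_lt' y x h1, ← neg_neg (triSign a b c), ← t4, triSign_of_lt y x]

/-- The closed oriented surface with the given oriented triangles. -/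
noncomputable def toSurface [Fintype V] [LinearOrder V] : ClosedOrientedSurface where
  V := V
  triangles := O.tris
  card_triangle t ht := by
    obtain ⟨a, b, c, h, rfl⟩ := O.mem_tris.1 ht
    obtain ⟨hab, hbc, hac⟩ := O.ne' h
    rw [Finset.card_eq_three]
    exact ⟨a, b, c, hab, hac, hbc, rfl⟩
  exists_triangle v := by
    obtain ⟨b, c, h⟩ := O.cover v
    exact ⟨{v, b, c}, O.mem_tris.2 ⟨v, b, c, h, rfl⟩, by simp⟩
  existsUnique_neighbour t ht v hv := by
    obtain ⟨x, y, z, h, rfl⟩ := O.mem_tris.1 ht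
    obtain ⟨a, b, he, h⟩ := O.exists_of_mem' h hv
    rw [he] at ht hv ⊢
    obtain ⟨hva, hab, hvb⟩ := O.ne' h
    have her : ({v, a, b} : Finset V).erase v = {a, b} := by
      ext; simp; grind
    rw [her]
    obtain ⟨d, hd⟩ := O.opp (O.cyc h)
    refine ⟨{b, a, d}, ⟨O.mem_tris.2 ⟨b, a, d, hd, rfl⟩, fun heq => ?_, ?_⟩, ?_⟩
    · have : v ∈ ({b, a, d} : Finset V) := by rw [heq]; simp
      simp only [Finset.mem_insert, Finset.mem_singleton] at this
      obtain rfl : v = d := by tauto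
      exact O.not_swap (O.cyc h) hd
    · intro; simp; tauto
    · rintro t' ⟨ht', hne, hsub⟩
      obtain ⟨x', y', z', h', rfl⟩ := O.mem_tris.1 ht'
      obtain ⟨e, h1, h2⟩ := O.exists_of_mem h' (hsub (by simp : a ∈ _)) (hsub (by simp : b ∈ _)) hab
      rcases h2 with h2 | h2
      · obtain rfl := O.uniq h2 (O.cyc h)
        exact absurd (h1.trans (by ext; simp; tauto)) hne
      · obtain rfl := O.uniq h2 hd
        rw [h1]; ext; simp; tauto
  link_connected v a b := by
    have key : ∀ a, (∃ t ∈ O.tris, v ∈ t ∧ a ∈ t ∧ a ≠ v) → ∃ c, O.R v a c := by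
      rintro a ⟨t, ht, hv, ha, hne⟩
      obtain ⟨x, y, z, h, rfl⟩ := O.mem_tris.1 ht
      obtain ⟨e, -, h2 | h2⟩ := O.exists_of_mem h hv ha hne.symm
      · exact ⟨_, h2⟩
      · exact O.opp h2
    intro ha hb
    obtain ⟨c, hc⟩ := key a ha
    obtain ⟨d, hd⟩ := key b hb
    refine O.link v (fun x => SimpleGraph.Reachable _ a x) (fun x y hxy => ?_) a b c d hc hd
      (SimpleGraph.Reachable.refl _)
    have : (SimpleGraph.fromRel fun x y : V => ({v, x, y} : Finset V) ∈ O.tris).Adj x y := by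
      rw [SimpleGraph.fromRel_adj]
      exact ⟨(O.ne' hxy).2.1, .inl (O.mem_tris.2 ⟨_, _, _, hxy, rfl⟩)⟩
    exact ⟨fun h => h.trans this.reachable, fun h => h.trans this.symm.reachable⟩
  sign := O.sgn
  sign_coherent := by
    intro t ht t' ht' hne v hv v' hv' her
    obtain ⟨x, y, z, h, rfl⟩ := O.mem_tris.1 ht
    obtain ⟨a, b, he, h⟩ := O.exists_of_mem' h hv
    obtain ⟨x', y', z', h', rfl⟩ := O.mem_tris.1 ht'
    obtain ⟨a', b', he', h'⟩ := O.exists_of_mem' h' hv'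
    rw [he, he'] at her hne ⊢
    obtain ⟨hva, hab, hvb⟩ := O.ne' h
    obtain ⟨hva', hab', hvb'⟩ := O.ne' h'
    have e1 : ({v, a, b} : Finset V).erase v = {a, b} := by ext; simp; grind
    have e2 : ({v', a', b'} : Finset V).erase v' = {a', b'} := by ext; simp; grind
    rw [e1, e2] at her
    have : (a = a' ∧ b = b') ∨ (a = b' ∧ b = a') := by
      simp only [Finset.ext_iff, Finset.mem_insert, Finset.mem_singleton] at her
      have i1 := (her a).1 (.inl rfl)
      have i2 := (her b).1 (.inr rfl)
      grind
    rw [neg_one_pow_card_filter_lt hva hvb hab, neg_one_pow_card_filter_lt hva' hvb' hab',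
      O.sgn_eq h, O.sgn_eq h']
    rcases this with ⟨rfl, rfl⟩ | ⟨rfl, rfl⟩
    · obtain rfl := O.uniq (O.cyc h) (O.cyc h')
      exact absurd rfl hne
    -- The orientation sign times the incidence number of the face opposite `p` is the sign of the
    -- pair `(q, r)`, and the two triangles traverse their common edge in opposite directions.
    · have k : ∀ p q r : V, triSign p q r * (pairSign p q * pairSign p r) = pairSign q r := by
        intro p q r
        unfold triSign
        calc _ = (pairSign p q * pairSign p q) * (pairSign p r * pairSign p r) * pairSign q r := by
              ac_rfl
          _ = _ := by simp
      rw [k, k, pairSign_swap hab, neg_neg]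

end OrTri

/-! ### Passage between `ClosedOrientedSurface` and `OrTri` -/

namespace ClosedOrientedSurface

variable (S : ClosedOrientedSurface)

lemma exists_R_aux {a b c : S.V} (hab : a ≠ b) (ε : ℤˣ) :
    ε = triSign a b c ∨ ε = triSign b a c := by
  rw [triSign_swap hab]
  rcases Int.units_eq_one_or ε with h | h <;>
    rcases Int.units_eq_one_or (triSign a b c) with h' | h' <;> simp [h, h']

/-- Coherence, rewritten along a common edge: `sign * triSign` tells whether a triangle induces the
direction from `a` to `b`, and the two triangles at the edge disagree. This yields both uniqueness
and existence of the triangle on a directed edge in `orient`. -/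
lemma sign_face {t t' : Finset S.V} (ht : t ∈ S.triangles) (ht' : t' ∈ S.triangles)
    {a b c d : S.V} (hab : a ≠ b) (hac : a ≠ c) (hbc : b ≠ c) (had : a ≠ d) (hbd : b ≠ d)
    (hcd : c ≠ d) (h : t = {a, b, c}) (h' : t' = {a, b, d}) :
    S.sign t * triSign a b c = - (S.sign t' * triSign a b d) := by
  have k : ∀ p : S.V, a ≠ p → b ≠ p →
      (-1 : ℤˣ) ^ ((({a, b, p} : Finset S.V)).filter (· < p)).card
        = pairSign a p * pairSign b p := by
    intro p h1 h2
    have : ({a, b, p} : Finset S.V) = {p, a, b} := by ext; simp; tauto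
    rw [this, neg_one_pow_card_filter_lt h1.symm h2.symm hab, pairSign_swap h1, pairSign_swap h2]
    simp
  have hne : t ≠ t' := by
    rintro rfl
    have : c ∈ ({a, b, d} : Finset S.V) := by rw [← h', h]; simp
    simp at this; tauto
  have e1 : t.erase c = {a, b} := by rw [h]; ext; simp; grind
  have e2 : t'.erase d = {a, b} := by rw [h']; ext; simp; grind
  have := S.sign_coherent t ht t' ht' hne c (by simp [h]) d (by simp [h']) (e1.trans e2.symm)
  rw [h, h', k c hac hbc, k d had hbd, ← h, ← h'] at this
  unfold triSign
  calc _ = S.sign t * (pairSign a c * pairSign b c) * pairSign a b := by ac_rfl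
    _ = _ := by rw [this]; simp only [neg_mul, neg_inj]; ac_rfl

/-- The oriented triangles of a closed oriented surface. -/
def orient : OrTri S.V where
  R a b c := a ≠ b ∧ b ≠ c ∧ a ≠ c ∧ ({a, b, c} : Finset S.V) ∈ S.triangles ∧
    S.sign {a, b, c} = triSign a b c
  cyc := by
    rintro a b c ⟨h1, h2, h3, h4, h5⟩
    have e : ({b, c, a} : Finset S.V) = {a, b, c} := by ext; simp; tauto
    rw [e, triSign_cyc h1 h3]
    exact ⟨h2, h3.symm, h1.symm, h4, h5⟩
  ne h := h.1
  uniq := by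
    rintro a b c d ⟨h1, h2, h3, h4, h5⟩ ⟨-, k2, k3, k4, k5⟩
    by_contra hcd
    have := S.sign_face h4 k4 h1 h3 h2 k3 k2 hcd rfl rfl
    rw [h5, k5] at this
    simp at this
  opp := by
    rintro a b c ⟨h1, h2, h3, h4, h5⟩
    obtain ⟨t', ⟨ht', hne, hsub⟩, -⟩ := S.existsUnique_neighbour _ h4 c (by simp)
    have ha : a ∈ t' := hsub (by simp [h1, h3])
    have hb : b ∈ t' := hsub (by simp [h2])
    obtain ⟨d, hd⟩ : ∃ d, t' = {a, b, d} ∧ a ≠ d ∧ b ≠ d := by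
      have hc := S.card_triangle _ ht'
      have hc' : ((t'.erase a).erase b).card = 1 := by
        rw [Finset.card_erase_of_mem (by simp [hb, h1.symm]), Finset.card_erase_of_mem ha, hc]
      obtain ⟨d, hd⟩ := Finset.card_eq_one.1 hc'
      have hd' : d ∈ (t'.erase a).erase b := by rw [hd]; simp
      simp only [Finset.mem_erase] at hd'
      refine ⟨d, ?_, hd'.2.1.symm, hd'.1.symm⟩
      rw [← Finset.insert_erase ha, ← Finset.insert_erase (a := b) (s := t'.erase a) (by simp [hb, h1.symm]), hd]
    obtain ⟨rfl, had, hbd⟩ := hd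
    have hcd : c ≠ d := by rintro rfl; exact hne rfl
    have := S.sign_face h4 ht' h1 h3 h2 had hbd hcd rfl rfl
    have e : ({b, a, d} : Finset S.V) = {a, b, d} := by ext; simp; tauto
    refine ⟨d, h1.symm, had, hbd, e ▸ ht', ?_⟩
    rw [e]
    rcases S.exists_R_aux (c := d) h1 (S.sign {a, b, d}) with h | h
    · rw [h5, h] at this
      simp at this
    · exact h
  not_swap := by
    rintro a b c ⟨h1, h2, h3, h4, h5⟩ ⟨-, -, -, -, k5⟩
    have e : ({b, a, c} : Finset S.V) = {a, b, c} := by ext; simp; tauto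
    rw [e, h5, triSign_swap h1] at k5
    rcases Int.units_eq_one_or (triSign a b c) with h' | h' <;> rw [h'] at k5 <;> revert k5 <;> decide
  cover := by
    intro a
    obtain ⟨t, ht, ha⟩ := S.exists_triangle a
    obtain ⟨x, y, z, hxy, hxz, hyz, rfl⟩ := Finset.card_eq_three.1 (S.card_triangle t ht)
    obtain ⟨b, c, hab, hac, hbc, he⟩ : ∃ b c, a ≠ b ∧ a ≠ c ∧ b ≠ c ∧ ({x, y, z} : Finset S.V) = {a, b, c} := by
      simp only [Finset.mem_insert, Finset.mem_singleton] at ha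
      rcases ha with rfl | rfl | rfl
      · exact ⟨_, _, hxy, hxz, hyz, rfl⟩
      · exact ⟨x, z, hxy.symm, hyz, hxz, by ext; simp; tauto⟩
      · exact ⟨x, y, hxz.symm, hyz.symm, hxy, by ext; simp; tauto⟩
    rw [he] at ht
    have e : ({a, c, b} : Finset S.V) = {a, b, c} := by ext; simp; tauto
    have e' : triSign b a c = triSign a c b := (triSign_cyc hab.symm hbc).symm
    rcases S.exists_R_aux (c := c) hab (S.sign {a, b, c}) with h | h
    · exact ⟨b, c, hab, hbc, hac, ht, h⟩
    · exact ⟨c, b, hac, hbc.symm, hab, e ▸ ht, by rw [e, h, e']⟩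
  link := by
    intro v A hA x y x' y' hx hy hAx
    have hr := S.link_connected v x y ⟨_, hx.2.2.2.1, by simp, by simp, hx.1.symm⟩
      ⟨_, hy.2.2.2.1, by simp, by simp, hy.1.symm⟩
    -- The link in the surface is an undirected graph; each of its edges is an arc of the directed
    -- link in one of the two directions.
    have key : ∀ p q, ({v, p, q} : Finset S.V) ∈ S.triangles → (A p ↔ A q) := by
      intro p q h
      have hc := S.card_triangle _ h
      have h1 : v ≠ p := by
        rintro rfl; rw [Finset.insert_eq_of_mem (by simp)] at hc
        have := Finset.card_le_two (a := v) (b := q); omega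
      have h2 : v ≠ q := by
        rintro rfl; rw [Finset.insert_eq_of_mem (by simp)] at hc
        have := Finset.card_le_two (a := p) (b := v); omega
      have h3 : p ≠ q := by
        rintro rfl
        have : ({v, p, p} : Finset S.V) = {v, p} := by simp
        rw [this] at hc
        have := Finset.card_le_two (a := v) (b := p); omega
      have e : ({v, q, p} : Finset S.V) = {v, p, q} := by ext; simp; tauto
      have e' : triSign p v q = triSign v q p := (triSign_cyc h1.symm h3).symm
      rcases S.exists_R_aux (c := q) h1 (S.sign {v, p, q}) with h' | h'
      · exact hA _ _ ⟨h1, h3, h2, h, h'⟩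
      · exact (hA _ _ ⟨h2, h3.symm, h1, e ▸ h, by rw [e, h', e']⟩).symm
    obtain ⟨w⟩ := hr
    clear hx hy
    induction w with
    | nil => exact hAx
    | cons hadj _ ih =>
      apply ih
      rw [SimpleGraph.fromRel_adj] at hadj
      rcases hadj.2 with h | h
      · exact (key _ _ h).1 hAx
      · exact (key _ _ h).2 hAx

variable {S}

lemma exists_R {a b c : S.V} (hab : a ≠ b) (hbc : b ≠ c) (hac : a ≠ c)
    (h : ({a, b, c} : Finset S.V) ∈ S.triangles) : S.orient.R a b c ∨ S.orient.R b a c := by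
  have e : ({b, a, c} : Finset S.V) = {a, b, c} := by ext; simp; tauto
  rcases S.exists_R_aux (c := c) hab (S.sign {a, b, c}) with h' | h'
  · exact .inl ⟨hab, hbc, hac, h, h'⟩
  · exact .inr ⟨hab.symm, hac, hbc, e ▸ h, by rw [e, h']⟩

lemma mem_triangles {t : Finset S.V} :
    t ∈ S.triangles ↔ ∃ a b c, S.orient.R a b c ∧ t = {a, b, c} := by
  constructor
  · intro h
    obtain ⟨x, y, z, hxy, hxz, hyz, rfl⟩ := Finset.card_eq_three.1 (S.card_triangle t h)
    rcases exists_R hxy hyz hxz h with h | h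
    · exact ⟨_, _, _, h, rfl⟩
    · exact ⟨_, _, _, h, by ext; simp; tauto⟩
  · rintro ⟨a, b, c, h, rfl⟩
    exact h.2.2.2.1

lemma sign_eq {a b c : S.V} (h : S.orient.R a b c) : S.sign {a, b, c} = triSign a b c :=
  h.2.2.2.2

end ClosedOrientedSurface

/-- Thanks to this round trip, a surface built by `toSurface` can be studied through its relation
`R` alone. -/
lemma OrTri.orient_toSurface {V : Type} [Fintype V] [LinearOrder V] (O : OrTri V) (a b c : V) :
    O.toSurface.orient.R a b c ↔ O.R a b c := by
  constructor
  · rintro ⟨h1, h2, h3, h4, h5⟩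
    obtain ⟨x, y, z, h, he⟩ := O.mem_tris.1 h4
    rcases O.R_of_eq h he.symm h1 h3 h2 with h | h
    · exact h
    · have e : ({b, a, c} : Finset V) = {a, b, c} := by ext; simp; tauto
      have := O.sgn_eq h
      rw [e, triSign_swap (V := V) h1] at this
      have h5' : O.sgn {a, b, c} = triSign a b c := h5
      rw [h5'] at this
      rcases Int.units_eq_one_or (triSign a b c) with h' | h' <;> rw [h'] at this <;>
        exact absurd this (by decide)
  · intro h
    obtain ⟨hab, hbc, hac⟩ := O.ne' h
    exact ⟨hab, hbc, hac, O.mem_tris.2 ⟨a, b, c, h, rfl⟩, O.sgn_eq h⟩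

/-! ### Components and Euler characteristic in terms of vertices and triangles -/

namespace OrTri

variable {V : Type} (O : OrTri V)

/-- A set of vertices which is a union of components. -/
def Closed (A : Set V) : Prop := ∀ a b c, O.R a b c → (a ∈ A ↔ b ∈ A)

/-- The vertex set of a component. -/
def IsComp (A : Set V) : Prop :=
  A.Nonempty ∧ O.Closed A ∧ ∀ B, O.Closed B → (A ∩ B).Nonempty → A ⊆ B

variable {O}

lemma Closed.mem_all {A : Set V} (hA : O.Closed A) {a b c : V} (h : O.R a b c) (ha : a ∈ A) :
    b ∈ A ∧ c ∈ A := by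
  have h1 := (hA _ _ _ h).1 ha
  exact ⟨h1, (hA _ _ _ (O.cyc h)).1 h1⟩

/-- The closed sets are detected by invariance in one direction. -/
lemma closed_of_imp {A : Set V} (hA : ∀ a b c, O.R a b c → a ∈ A → b ∈ A) : O.Closed A := by
  intro a b c h
  obtain ⟨d, hd⟩ := O.opp h
  exact ⟨hA _ _ _ h, hA _ _ _ hd⟩

end OrTri

namespace ClosedOrientedSurface

variable {S : ClosedOrientedSurface}

lemma R_of_edge {t : Finset S.V} (ht : t ∈ S.triangles) {a b : S.V} (ha : a ∈ t) (hb : b ∈ t)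
    (hab : a ≠ b) : ∃ c, S.orient.R a b c := by
  obtain ⟨x, y, z, h, rfl⟩ := mem_triangles.1 ht
  obtain ⟨e, -, h | h⟩ := S.orient.exists_of_mem h ha hb hab
  · exact ⟨_, h⟩
  · exact S.orient.opp h

lemma mem_edges {e : Finset S.V} : e ∈ S.edges ↔ ∃ a b c, S.orient.R a b c ∧ e = {a, b} := by
  simp only [edges, Finset.mem_biUnion, Finset.mem_powersetCard]
  constructor
  · rintro ⟨t, ht, hsub, hc⟩
    obtain ⟨a, b, hab, rfl⟩ := Finset.card_eq_two.1 hc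
    obtain ⟨c, h⟩ := R_of_edge ht (hsub (by simp)) (hsub (by simp)) hab
    exact ⟨a, b, c, h, rfl⟩
  · rintro ⟨a, b, c, h, rfl⟩
    exact ⟨_, h.2.2.2.1, by intro; simp; tauto, Finset.card_pair h.1⟩

lemma skeleton_adj {a b : S.V} : S.skeleton.Adj a b ↔ ∃ c, S.orient.R a b c := by
  rw [skeleton, SimpleGraph.fromRel_adj, Finset.pair_comm b a, or_self]
  constructor
  · rintro ⟨hab, h⟩
    simp only [edges, Finset.mem_biUnion, Finset.mem_powersetCard] at h
    obtain ⟨t, ht, hsub, -⟩ := h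
    exact R_of_edge ht (hsub (by simp)) (hsub (by simp)) hab
  · rintro ⟨c, h⟩
    exact ⟨h.1, mem_edges.2 ⟨a, b, c, h, rfl⟩⟩

lemma closed_iff {A : Set S.V} :
    S.orient.Closed A ↔ ∀ a b, S.skeleton.Adj a b → (a ∈ A ↔ b ∈ A) := by
  simp only [skeleton_adj]
  exact ⟨fun h a b ⟨c, hc⟩ => h a b c hc, fun h a b c hc => h a b ⟨c, hc⟩⟩

lemma mem_of_reachable {A : Set S.V} (hA : S.orient.Closed A) {a b : S.V}
    (h : S.skeleton.Reachable a b) (ha : a ∈ A) : b ∈ A := by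
  obtain ⟨w⟩ := h
  induction w with
  | nil => exact ha
  | cons hadj _ ih => exact ih ((closed_iff.1 hA _ _ hadj).1 ha)

lemma isComp_supp (c : S.skeleton.ConnectedComponent) : S.orient.IsComp c.supp := by
  refine ⟨c.nonempty_supp, closed_iff.2 fun a b h => ?_, ?_⟩
  · simp only [SimpleGraph.ConnectedComponent.mem_supp_iff]
    rw [SimpleGraph.ConnectedComponent.sound h.reachable]
  · rintro B hB ⟨x, hx, hxB⟩ y hy
    rw [SimpleGraph.ConnectedComponent.mem_supp_iff] at hx hy
    exact mem_of_reachable hB (SimpleGraph.ConnectedComponent.exact (hx.trans hy.symm)) hxB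

lemma exists_supp_eq {A : Set S.V} (hA : S.orient.IsComp A) :
    ∃ c : S.skeleton.ConnectedComponent, c.supp = A := by
  obtain ⟨⟨x, hx⟩, hcl, hmin⟩ := hA
  refine ⟨S.skeleton.connectedComponentMk x, Set.Subset.antisymm ?_ ?_⟩
  · exact (isComp_supp _).2.2 A hcl ⟨x, rfl, hx⟩
  · exact hmin _ (isComp_supp _).2.1 ⟨x, hx, rfl⟩

open Classical in
/-- The triangles with vertices in `A`. -/
noncomputable def trisIn (S : ClosedOrientedSurface) (A : Set S.V) : Finset (Finset S.V) :=
  S.triangles.filter fun t => (t : Set S.V) ⊆ A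

open Classical in
/-- The edges with vertices in `A`. -/
noncomputable def edgesIn (S : ClosedOrientedSurface) (A : Set S.V) : Finset (Finset S.V) :=
  S.edges.filter fun t => (t : Set S.V) ⊆ A

lemma mem_trisIn {A : Set S.V} {t : Finset S.V} :
    t ∈ S.trisIn A ↔ t ∈ S.triangles ∧ (t : Set S.V) ⊆ A := by simp [trisIn]

lemma mem_edgesIn {A : Set S.V} {t : Finset S.V} :
    t ∈ S.edgesIn A ↔ t ∈ S.edges ∧ (t : Set S.V) ⊆ A := by simp [edgesIn]

/-- Twice the Euler characteristic of the union `A` of components. -/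
noncomputable def chi2 (S : ClosedOrientedSurface) (A : Set S.V) : ℤ :=
  2 * A.ncard - (S.trisIn A).card

lemma triangles_above_edge {a b c d : S.V} (h : S.orient.R a b c) (h' : S.orient.R b a d)
    {t : Finset S.V} : t ∈ S.triangles ∧ ({a, b} : Finset S.V) ⊆ t ↔
      t ∈ ({{a, b, c}, {b, a, d}} : Finset (Finset S.V)) := by
  simp only [Finset.mem_insert, Finset.mem_singleton]
  constructor
  · rintro ⟨ht, hsub⟩
    obtain ⟨x, y, z, hR, rfl⟩ := mem_triangles.1 ht
    obtain ⟨e, he, h1 | h1⟩ := S.orient.exists_of_mem hR (hsub (by simp : a ∈ _))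
      (hsub (by simp : b ∈ _)) h.1
    · obtain rfl := S.orient.uniq h h1
      exact .inl he
    · obtain rfl := S.orient.uniq h' h1
      refine .inr (he.trans ?_)
      ext; simp; tauto
  · rintro (rfl | rfl)
    · exact ⟨h.2.2.2.1, by intro; simp; tauto⟩
    · exact ⟨h'.2.2.2.1, by intro; simp; tauto⟩

lemma above_edge_ne {a b c d : S.V} (h : S.orient.R a b c) (h' : S.orient.R b a d) :
    ({a, b, c} : Finset S.V) ≠ {b, a, d} := by
  intro he
  have : c ∈ ({b, a, d} : Finset S.V) := by rw [← he]; simp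
  obtain ⟨h1, h2, h3⟩ := S.orient.ne' h
  simp only [Finset.mem_insert, Finset.mem_singleton] at this
  obtain rfl : c = d := by tauto
  exact S.orient.not_swap h h'

/-- Double counting of incidences: a triangle has three edges, and an edge lies in exactly the two
triangles on its two directions. Eliminating the edges turns 2(V - E + F) into 2V - F, which
explains `chi2`. -/
lemma two_mul_card_edgesIn {A : Set S.V} (hA : S.orient.Closed A) :
    2 * (S.edgesIn A).card = 3 * (S.trisIn A).card := by
  classical
  have := Finset.sum_card_bipartiteAbove_eq_sum_card_bipartiteBelow (s := S.edgesIn A)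
    (t := S.trisIn A) (fun e t => e ⊆ t)
  rw [Finset.sum_const_nat (m := 2), Finset.sum_const_nat (m := 3)] at this
  · rw [mul_comm, this, mul_comm]
  · intro t ht
    rw [mem_trisIn] at ht
    have : (S.edgesIn A).bipartiteBelow (fun e t => e ⊆ t) t = t.powersetCard 2 := by
      ext e
      simp only [Finset.mem_bipartiteBelow, mem_edgesIn, Finset.mem_powersetCard]
      constructor
      · rintro ⟨⟨h1, -⟩, h2⟩
        obtain ⟨a, b, c, h, rfl⟩ := mem_edges.1 h1
        exact ⟨h2, Finset.card_pair h.1⟩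
      · rintro ⟨h1, h2⟩
        refine ⟨⟨?_, subset_trans (by exact_mod_cast h1) ht.2⟩, h1⟩
        simp only [edges, Finset.mem_biUnion, Finset.mem_powersetCard]
        exact ⟨t, ht.1, h1, h2⟩
    rw [this, Finset.card_powersetCard, S.card_triangle t ht.1]
    rfl
  · intro e he
    rw [mem_edgesIn] at he
    obtain ⟨a, b, c, h, rfl⟩ := mem_edges.1 he.1
    obtain ⟨d, h'⟩ := S.orient.opp h
    have ha : a ∈ A := he.2 (by simp)
    have hb : b ∈ A := he.2 (by simp)
    have : (S.trisIn A).bipartiteAbove (fun e t => e ⊆ t) {a, b} = {{a, b, c}, {b, a, d}} := by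
      ext t
      rw [← triangles_above_edge h h']
      simp only [Finset.mem_bipartiteAbove, mem_trisIn]
      constructor
      · tauto
      · rintro ⟨h1, h2⟩
        refine ⟨⟨h1, ?_⟩, h2⟩
        have h3 := (triangles_above_edge h h').1 ⟨h1, h2⟩
        simp only [Finset.mem_insert, Finset.mem_singleton] at h3
        have hc := (hA.mem_all h ha).2
        have hd := (hA.mem_all h' hb).2
        rcases h3 with rfl | rfl <;> intro x <;> simp <;> rintro (rfl | rfl | rfl) <;> assumption
    rw [this, Finset.card_pair (above_edge_ne h h')]

lemma two_mul_componentEulerChar (c : S.skeleton.ConnectedComponent) :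
    2 * S.componentEulerChar c = S.chi2 c.supp := by
  classical
  have h := two_mul_card_edgesIn (isComp_supp c).2.1
  have h1 : {e | e ∈ S.edges ∧ (e : Set S.V) ⊆ c.supp}.ncard = (S.edgesIn c.supp).card := by
    rw [← Set.ncard_coe_finset]; congr 1; ext; simp [mem_edgesIn]
  have h2 : {e | e ∈ S.triangles ∧ (e : Set S.V) ⊆ c.supp}.ncard = (S.trisIn c.supp).card := by
    rw [← Set.ncard_coe_finset]; congr 1; ext; simp [mem_trisIn]
  rw [componentEulerChar, chi2, h1, h2]
  have : (2 : ℤ) * (S.edgesIn c.supp).card = 3 * (S.trisIn c.supp).card := by exact_mod_cast h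
  linarith

lemma two_mul_eulerChar : 2 * S.eulerChar = 2 * Fintype.card S.V - S.triangles.card := by
  classical
  have h := two_mul_card_edgesIn (S := S) (A := Set.univ) (fun _ _ _ _ => by simp)
  have h1 : S.edgesIn Set.univ = S.edges := by ext; simp [mem_edgesIn]
  have h2 : S.trisIn Set.univ = S.triangles := by ext; simp [mem_trisIn]
  rw [h1, h2] at h
  have : (2 : ℤ) * S.edges.card = 3 * S.triangles.card := by exact_mod_cast h
  rw [eulerChar]
  linarith

/-- No component is a sphere or a torus. -/
def NoSphereTorus (S : ClosedOrientedSurface) : Prop :=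
  ∀ A, S.orient.IsComp A → S.chi2 A ≠ 4 ∧ S.chi2 A ≠ 0

lemma noSphereTorus (h : ∀ c, ¬ S.IsTorus c ∧ ¬ S.IsSphere c) : S.NoSphereTorus := by
  intro A hA
  obtain ⟨c, rfl⟩ := exists_supp_eq hA
  have h1 := h c
  rw [IsTorus, IsSphere, HasGenus, HasGenus] at h1
  rw [← two_mul_componentEulerChar]
  push_cast at h1
  omega

lemma not_isSphere (h : ∀ A, S.orient.IsComp A → S.chi2 A ≠ 4) (c) : ¬ S.IsSphere c := by
  have h1 := h _ (isComp_supp c)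
  rw [← two_mul_componentEulerChar] at h1
  rw [IsSphere, HasGenus]
  push_cast
  omega

end ClosedOrientedSurface

/-! ### Tree-cotree argument: cocycles on a punctured sphere are coboundaries -/

/-- In a connected graph every vertex that is not a root has a parent of smaller rank. -/
lemma exists_rank_parent {α : Type*} (r : α → α → Prop) (root : α → Prop)
    (hconn : ∀ B : α → Prop, (∀ x, root x → B x) → (∀ x y, B x → r x y → B y) → ∀ x, B x) :
    ∃ (rk : α → ℕ) (p : α → α), ∀ x, ¬ root x → r (p x) x ∧ rk (p x) < rk x := by
  classical
  -- `reach n` holds at the ends of walks of length `n` from a root. The rank is the least such `n`,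
  -- and a parent is the last but one vertex of a shortest walk.
  let reach : ℕ → α → Prop := fun n =>
    Nat.rec (motive := fun _ => α → Prop) root (fun _ Q x => ∃ y, Q y ∧ r y x) n
  have hall : ∀ x, ∃ n, reach n x := by
    apply hconn
    · exact fun x hx => ⟨0, hx⟩
    · rintro x y ⟨n, hn⟩ hxy
      exact ⟨n + 1, x, hn, hxy⟩
  have hp : ∀ x : α, ∃ y : α, ¬ root x → r y x ∧ Nat.find (hall y) < Nat.find (hall x) := by
    intro x
    by_cases hx : root x
    · exact ⟨x, fun h => absurd hx h⟩
    obtain ⟨n, hn⟩ : ∃ n, Nat.find (hall x) = n + 1 := by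
      refine Nat.exists_eq_succ_of_ne_zero fun h0 => hx ?_
      have := Nat.find_spec (hall x)
      rwa [h0] at this
    have hs := Nat.find_spec (hall x)
    rw [hn] at hs
    obtain ⟨y, hy, hyx⟩ := hs
    exact ⟨y, fun _ => ⟨hyx, by rw [hn]; exact Nat.lt_succ_of_le (Nat.find_min' _ hy)⟩⟩
  choose p hp using hp
  exact ⟨fun x => Nat.find (hall x), p, hp⟩

namespace ClosedOrientedSurface

variable {S : ClosedOrientedSurface}

/-- The dual graph is connected, starting from the star of `c`. A property spreads around a vertex
because links are connected, and to the next vertex through a triangle containing both; so the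
vertices all of whose triangles satisfy `B` form a closed set. -/
lemma faces_connected (hconn : S.orient.IsComp Set.univ) (c : S.V)
    (B : Finset S.V → Prop) (h0 : ∀ t ∈ S.triangles, c ∈ t → B t)
    (h1 : ∀ a b x y, S.orient.R a b x → S.orient.R b a y → B {a, b, x} → B {b, a, y}) :
    ∀ t ∈ S.triangles, B t := by
  let A : Set S.V := {v | ∀ x y, S.orient.R v x y → B {v, x, y}}
  have hrot : ∀ a b x : S.V, ({b, x, a} : Finset S.V) = {a, b, x} := by
    intro a b x; ext; simp; tauto
  have hA : S.orient.Closed A := by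
    refine OrTri.closed_of_imp fun v w z h hv => ?_
    have hz : B {w, z, v} := by rw [hrot]; exact hv _ _ h
    have hR := S.orient.cyc h
    intro x y hxy
    refine S.orient.link w (fun x => ∀ y, S.orient.R w x y → B {w, x, y}) ?_ z x v y hR hxy ?_ y hxy
    · intro p q hpq
      obtain ⟨s, hs⟩ := S.orient.opp (S.orient.cyc (S.orient.cyc hpq))
      constructor
      · intro hp y hy
        have := hp q hpq
        rw [← hrot, ← hrot] at this
        exact h1 q w p y (S.orient.cyc (S.orient.cyc hpq)) hy this
      · intro hq y hy
        obtain rfl := S.orient.uniq hpq hy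
        have := h1 w q s p hs (S.orient.cyc (S.orient.cyc hpq)) (hq s hs)
        rwa [hrot, hrot] at this
    · intro y hy
      obtain rfl := S.orient.uniq hR hy
      exact hz
  have hc : c ∈ A := fun x y h => h0 _ (mem_triangles.2 ⟨_, _, _, h, rfl⟩) (by simp)
  have hall := hconn.2.2 A hA ⟨c, trivial, hc⟩
  intro t ht
  obtain ⟨a, b, x, h, rfl⟩ := mem_triangles.1 ht
  exact hall (Set.mem_univ a) _ _ h

/-- The link of `c` is a cycle, so it has as many vertices as edges. Both counts are indexed by the
neighbours of `c`, a triangle at `c` by the first of its two other vertices in the positive order.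
-/
lemma card_edges_at (c : S.V) :
    (S.edges.filter (c ∈ ·)).card = (S.triangles.filter (c ∈ ·)).card := by
  classical
  let L : Finset S.V := Finset.univ.filter fun x => ∃ y, S.orient.R c x y
  have hL : ∀ x, ∃ y, x ∈ L → S.orient.R c x y := fun x => by
    by_cases h : ∃ y, S.orient.R c x y
    · exact ⟨h.choose, fun _ => h.choose_spec⟩
    · exact ⟨x, fun h' => absurd (by simpa [L] using h') h⟩
  choose nx hnx using hL
  have e1 : L.card = (S.edges.filter (c ∈ ·)).card := by
    refine Finset.card_bij (fun x _ => {c, x}) ?_ ?_ ?_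
    · intro x hx
      simp only [Finset.mem_filter]
      exact ⟨mem_edges.2 ⟨_, _, _, hnx x hx, rfl⟩, by simp⟩
    · intro x hx y hy h
      have : x ∈ ({c, y} : Finset S.V) := by rw [← h]; simp
      have hne := (hnx x hx).1
      simp at this
      tauto
    · intro e he
      simp only [Finset.mem_filter] at he
      obtain ⟨a, b, d, h, rfl⟩ := mem_edges.1 he.1
      have := he.2
      simp only [Finset.mem_insert, Finset.mem_singleton] at this
      rcases this with rfl | rfl
      · exact ⟨b, by simp [L]; exact ⟨_, h⟩, rfl⟩
      · exact ⟨a, by simp [L]; exact S.orient.opp h, Finset.pair_comm _ _⟩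
  have e2 : L.card = (S.triangles.filter (c ∈ ·)).card := by
    refine Finset.card_bij (fun x _ => {c, x, nx x}) ?_ ?_ ?_
    · intro x hx
      simp only [Finset.mem_filter]
      exact ⟨mem_triangles.2 ⟨_, _, _, hnx x hx, rfl⟩, by simp⟩
    · intro x hx y hy h
      have h1 := hnx x hx
      have h2 := hnx y hy
      have k1 := S.orient.ne' h1
      have k2 := S.orient.ne' h2
      by_contra hxy
      simp only [Finset.ext_iff, Finset.mem_insert, Finset.mem_singleton] at h
      have i1 := (h x).1 (by simp)
      have i2 := (h y).2 (by simp)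
      have i3 : x = nx y := by have := k1.1; grind
      have i4 : y = nx x := by have := k2.1; grind
      rw [← i4] at h1
      rw [← i3] at h2
      exact S.orient.not_swap (S.orient.cyc h1) (S.orient.cyc (S.orient.cyc (S.orient.cyc (S.orient.cyc h2))))
    · intro t ht
      simp only [Finset.mem_filter] at ht
      obtain ⟨x, y, z, h, rfl⟩ := mem_triangles.1 ht.1
      obtain ⟨a, b, he, h'⟩ := S.orient.exists_of_mem' h ht.2
      refine ⟨a, by simp [L]; exact ⟨_, h'⟩, ?_⟩
      rw [he, S.orient.uniq h' (hnx a (by simp [L]; exact ⟨_, h'⟩))]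
  rw [← e1, e2]

/-- The primal graph complementary to a dual tree rooted at the star of `c`. -/
lemma exists_cotree (hconn : S.orient.IsComp Set.univ) (c : S.V) :
    ∃ G : Finset (Finset S.V), (∀ e ∈ G, e ∈ S.edges ∧ c ∉ e) ∧
      G.card + S.triangles.card = S.edges.card ∧
      ∀ P : Finset S.V → Prop, (∀ e ∈ G, P e) →
        (∀ x y z, S.orient.R x y z → x ≠ c → y ≠ c → z ≠ c → P {x, y} → P {y, z} → P {z, x}) →
        ∀ x y z, S.orient.R x y z → x ≠ c → y ≠ c → P {x, y} := by
  classical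
  let r : {t // t ∈ S.triangles} → {t // t ∈ S.triangles} → Prop := fun t t' =>
    ∃ a b x y, S.orient.R a b x ∧ S.orient.R b a y ∧ t.1 = {a, b, x} ∧ t'.1 = {b, a, y}
  obtain ⟨rk, p, hp⟩ := exists_rank_parent r (fun t => c ∈ t.1) (by
    intro B h0 h1 t
    have := faces_connected hconn c (fun t => ∀ ht : t ∈ S.triangles, B ⟨t, ht⟩)
      (fun t ht hc _ => h0 _ hc) (fun a b x y hx hy hB ht =>
        h1 _ _ (hB (mem_triangles.2 ⟨_, _, _, hx, rfl⟩)) ⟨a, b, x, y, hx, hy, rfl, rfl⟩)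
    exact this t.1 t.2 t.2)
  -- A triangle off the star of `c` is assigned the edge it shares with its parent; `∅` is a dummy
  -- value at the roots.
  have he : ∀ t : {t // t ∈ S.triangles}, ∃ e : Finset S.V, c ∉ t.1 →
      e ∈ S.edges ∧ ∀ t' : {t // t ∈ S.triangles}, e ⊆ t'.1 ↔ t' = t ∨ t' = p t := by
    intro t
    by_cases hc : c ∈ t.1
    · exact ⟨∅, fun h => absurd hc h⟩
    obtain ⟨a, b, x, y, hx, hy, h1, h2⟩ := (hp t hc).1
    refine ⟨{a, b}, fun _ => ⟨mem_edges.2 ⟨_, _, _, hx, rfl⟩, fun t' => ?_⟩⟩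
    have := triangles_above_edge hx hy (t := t'.1)
    simp only [t'.2, true_and, Finset.mem_insert, Finset.mem_singleton] at this
    rw [this, ← h1, ← h2, Subtype.ext_iff, Subtype.ext_iff, or_comm]
  choose ed hed using he
  have hlt : ∀ t, c ∉ t.1 → rk (p t) < rk t := fun t ht => (hp t ht).2
  have hinj : ∀ t t', c ∉ t.1 → c ∉ t'.1 → ed t = ed t' → t = t' := by
    intro t t' ht ht' h
    have h1 := ((hed t ht).2 t').1 (h ▸ ((hed t' ht').2 t').2 (.inl rfl))
    have h2 := ((hed t' ht').2 t).1 (h ▸ ((hed t ht).2 t).2 (.inl rfl))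
    rcases h1 with h1 | h1
    · exact h1.symm
    rcases h2 with h2 | h2
    · exact h2
    have l1 := hlt t ht
    have l2 := hlt t' ht'
    rw [← h1] at l1
    rw [← h2] at l2
    omega
  let F0 : Finset {t // t ∈ S.triangles} := Finset.univ.filter fun t => c ∉ t.1
  let D : Finset (Finset S.V) := F0.image ed
  have hD : D.card = F0.card := Finset.card_image_of_injOn (by
    intro t ht t' ht' h
    simp only [F0, Finset.coe_filter, Finset.mem_univ, true_and, Set.mem_ofPred_eq] at ht ht'
    exact hinj t t' ht ht' h)
  let E0 : Finset (Finset S.V) := S.edges.filter (c ∉ ·)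
  have hDE : D ⊆ E0 := by
    intro e h
    simp only [D, F0, Finset.mem_image, Finset.mem_filter, Finset.mem_univ, true_and] at h
    obtain ⟨t, ht, rfl⟩ := h
    simp only [E0, Finset.mem_filter]
    exact ⟨(hed t ht).1, fun hc => ht (((hed t ht).2 t).2 (.inl rfl) hc)⟩
  refine ⟨E0 \ D, ?_, ?_, ?_⟩
  · intro e h
    simp only [E0, Finset.mem_sdiff, Finset.mem_filter] at h
    exact h.1
  -- Deleting the star of `c` removes equally many edges and triangles, and each remaining triangle
  -- uses up one dual edge, so E - F edges are left.
  · have h1 := Finset.card_sdiff_add_card_eq_card hDE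
    have h2 := Finset.card_filter_add_card_filter_not (s := S.edges) (c ∈ ·)
    have h3 := Finset.card_filter_add_card_filter_not (s := S.triangles) (c ∈ ·)
    have h4 := card_edges_at c
    have h5 : F0.card = (S.triangles.filter (c ∉ ·)).card := by
      refine Finset.card_bij (fun t _ => t.1) ?_ ?_ ?_
      · intro t ht; simp [F0] at ht ⊢; exact ht
      · intro t _ t' _ h; exact Subtype.ext h
      · intro t ht; simp at ht; exact ⟨⟨t, ht.1⟩, by simp [F0, ht.2], rfl⟩
    have h6 : E0.card = (S.edges.filter (c ∉ ·)).card := rfl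
    omega
  · intro P hP hT
    have hmax : ∃ M, ∀ t, rk t ≤ M :=
      ⟨Finset.univ.sup rk, fun t => Finset.le_sup (Finset.mem_univ t)⟩
    obtain ⟨M, hM⟩ := hmax
    -- Induction from the leaves of the dual forest to its roots: an edge of `t` other than `ed t`
    -- either lies in the complement or is shared with a child of `t`, whose rank is larger.
    have main : ∀ k, ∀ t, c ∉ t.1 → M - rk t = k → P (ed t) := by
      intro k
      induction k using Nat.strong_induction_on with
      | _ k ih =>
      intro t ht hk
      have hoth : ∀ a b x, S.orient.R a b x → t.1 = {a, b, x} → ({a, b} : Finset S.V) ≠ ed t →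
          P {a, b} := by
        intro a b x h h1 hne
        by_cases hmem : ({a, b} : Finset S.V) ∈ D
        · simp only [D, F0, Finset.mem_image, Finset.mem_filter, Finset.mem_univ, true_and] at hmem
          obtain ⟨t', ht', he'⟩ := hmem
          rw [← he'] at hne ⊢
          have hsub : ed t' ⊆ t.1 := by rw [he', h1]; intro; simp; tauto
          rcases ((hed t' ht').2 t).1 hsub with h2 | h2
          · exact absurd (by rw [h2]) hne
          · have l := hlt t' ht'
            rw [← h2] at l
            have := hM t'
            exact ih (M - rk t') (by omega) t' ht' rfl
        · apply hP
          simp only [E0, Finset.mem_sdiff, Finset.mem_filter]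
          refine ⟨⟨mem_edges.2 ⟨_, _, _, h, rfl⟩, fun hc => ht ?_⟩, hmem⟩
          rw [h1]
          simp only [Finset.mem_insert, Finset.mem_singleton] at hc ⊢
          tauto
      obtain ⟨a, b, x, hR, hab⟩ : ∃ a b x, S.orient.R a b x ∧ t.1 = {a, b, x} ∧ ed t = {a, b} := by
        obtain ⟨a, b, x, h, hE⟩ := mem_edges.1 (hed t ht).1
        obtain ⟨y, h'⟩ := S.orient.opp h
        have hsub := ((hed t ht).2 t).2 (.inl rfl)
        rw [hE] at hsub
        have := (triangles_above_edge h h').1 ⟨t.2, hsub⟩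
        simp only [Finset.mem_insert, Finset.mem_singleton] at this
        rcases this with h1 | h1
        · exact ⟨a, b, x, h, h1, hE⟩
        · exact ⟨b, a, y, h', h1, hE.trans (Finset.pair_comm _ _)⟩
      have hne := S.orient.ne' hR
      have hR1 := S.orient.cyc hR
      have hR2 := S.orient.cyc hR1
      have r1 : t.1 = {b, x, a} := by rw [hab.1]; ext; simp; tauto
      have r2 : t.1 = {x, a, b} := by rw [hab.1]; ext; simp; tauto
      have hc : a ≠ c ∧ b ≠ c ∧ x ≠ c := by
        rw [hab.1] at ht
        simp only [Finset.mem_insert, Finset.mem_singleton] at ht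
        grind
      rw [hab.2]
      refine hT b x a hR1 hc.2.1 hc.2.2 hc.1 (hoth _ _ _ hR1 r1 ?_) (hoth _ _ _ hR2 r2 ?_)
      · rw [hab.2]
        intro h
        have : x ∈ ({a, b} : Finset S.V) := by rw [← h]; simp
        simp at this; grind
      · rw [hab.2]
        intro h
        have : x ∈ ({a, b} : Finset S.V) := by rw [← h]; simp
        simp at this; grind
    intro x y z h hx hy
    by_cases hmem : ({x, y} : Finset S.V) ∈ D
    · simp only [D, F0, Finset.mem_image, Finset.mem_filter, Finset.mem_univ, true_and] at hmem
      obtain ⟨t', ht', he'⟩ := hmem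
      rw [← he']
      exact main _ t' ht' rfl
    · apply hP
      simp only [E0, Finset.mem_sdiff, Finset.mem_filter]
      refine ⟨⟨mem_edges.2 ⟨_, _, _, h, rfl⟩, ?_⟩, hmem⟩
      simp
      exact ⟨hx.symm, hy.symm⟩

/-- On a sphere, a cocycle defined outside a vertex `c` is a coboundary. -/
theorem exists_potential {G : Type*} [Group G] (hconn : S.orient.IsComp Set.univ)
    (hchi : S.chi2 Set.univ = 4) (c : S.V) (l : S.V → S.V → G)
    (hsymm : ∀ a b x, S.orient.R a b x → l b a = (l a b)⁻¹)
    (hcoc : ∀ a b x, S.orient.R a b x → a ≠ c → b ≠ c → x ≠ c → l a b * l b x * l x a = 1) :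
    ∃ h : S.V → G, ∀ a b x, S.orient.R a b x → a ≠ c → b ≠ c → h a * l a b = h b := by
  classical
  obtain ⟨E, hE, hcard, hsat⟩ := exists_cotree hconn c
  obtain ⟨v₀, w₀, hv₀⟩ := S.orient.cover c
  let r : {v // v ≠ c} → {v // v ≠ c} → Prop := fun u v => ({u.1, v.1} : Finset S.V) ∈ E
  -- The complementary graph connects all vertices off `c`: lying in `A` at both ends or at neither
  -- passes from two sides of a triangle to the third, hence to every edge off `c`. The link of `c`
  -- bridges the puncture.
  have hconn' : ∀ B : {v // v ≠ c} → Prop, (∀ x : {v // v ≠ c}, x.1 = v₀ → B x) →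
      (∀ x y, B x → r x y → B y) → ∀ x, B x := by
    intro B h0 h1
    let A : Set S.V := {v | ∀ hv : v ≠ c, B ⟨v, hv⟩}
    have key := hsat (fun e => ∀ a b, e = {a, b} → (a ∈ A → b ∈ A)) (by
      intro e he a b hab ha hb
      have hac : a ≠ c := by
        rintro rfl
        apply (hE e he).2
        rw [hab]; simp
      exact h1 _ _ (ha hac) (by simp only [r]; rw [← hab]; exact he)) (by
      intro x y z hR hx hy hz h1 h2 a b hab
      have e1 := h1 x y rfl
      have e2 := h2 y z rfl
      have e3 := h1 y x (Finset.pair_comm _ _)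
      have e4 := h2 z y (Finset.pair_comm _ _)
      have hne := S.orient.ne' hR
      simp only [Finset.ext_iff, Finset.mem_insert, Finset.mem_singleton] at hab
      have i1 := (hab a).2 (.inl rfl)
      have i2 := (hab b).2 (.inr rfl)
      have i3 := (hab z).1 (.inl rfl)
      have i4 := (hab x).1 (.inr rfl)
      grind)
    -- propagate around the link of `c`, then everywhere
    let A' : Set S.V := {v | v ≠ c → v ∈ A}
    have hcl : ∀ a b x, S.orient.R a b x → a ≠ c → b ≠ c → (a ∈ A ↔ b ∈ A) := by
      intro a b x h ha hb
      exact ⟨key a b x h ha hb a b rfl, key a b x h ha hb b a (Finset.pair_comm _ _)⟩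
    have hlink : ∀ x y, S.orient.R c x y → x ∈ A := by
      intro x y hxy
      refine S.orient.link c (· ∈ A) (fun p q hpq => ?_) v₀ x w₀ y hv₀ hxy (fun h => h0 _ rfl)
      have hne := S.orient.ne' hpq
      exact hcl p q c (S.orient.cyc hpq) hne.1.symm hne.2.2.symm
    have hA' : S.orient.Closed A := by
      apply OrTri.closed_of_imp
      intro a b x h ha
      by_cases hac : a = c
      · subst hac; exact hlink b x h
      by_cases hbc : b = c
      · subst hbc; exact fun h => absurd rfl h
      · exact (hcl a b x h hac hbc).1 ha
    have hu := hconn.2.2 A hA' ⟨v₀, trivial, hlink _ _ hv₀⟩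
    exact fun x => hu (Set.mem_univ x.1) x.2
  obtain ⟨rk, p, hp⟩ := exists_rank_parent r (fun x => x.1 = v₀) hconn'
  have hcv : v₀ ≠ c := (S.orient.ne hv₀).symm
  -- the parent edges exhaust `E`
  let N : Finset {v // v ≠ c} := Finset.univ.filter fun x => x.1 ≠ v₀
  have hinj : Set.InjOn (fun x : {v // v ≠ c} => ({(p x).1, x.1} : Finset S.V)) N := by
    intro x hx y hy h
    simp only [N, Finset.coe_filter, Finset.mem_univ, true_and, Set.mem_ofPred_eq] at hx hy
    have h1 := (hp x hx).2
    have h2 := (hp y hy).2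
    by_contra hxy
    have hxy' : x.1 ≠ y.1 := fun h => hxy (Subtype.ext h)
    have h' : ({(p x).1, x.1} : Finset S.V) = {(p y).1, y.1} := h
    simp only [Finset.ext_iff, Finset.mem_insert, Finset.mem_singleton] at h'
    have i1 : x.1 = (p y).1 := by have := (h' x.1).1 (.inr rfl); tauto
    have i2 : y.1 = (p x).1 := by have := (h' y.1).2 (.inr rfl); grind
    rw [← Subtype.ext i1] at h2
    rw [← Subtype.ext i2] at h1
    omega
  -- Here χ = 2 enters: 2V - F = 4 and 2E = 3F give E - F = V - 2, the number of vertices other than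
  -- `c` and the root. So the parent edges are all the edges, and the graph is a tree.
  have hNcard : N.card = E.card := by
    have h1 : N.card + 2 = Fintype.card S.V := by
      have e1 : (Finset.univ : Finset {v // v ≠ c}).card + 1 = Fintype.card S.V := by
        rw [Finset.card_univ, Fintype.card_subtype_compl, Fintype.card_subtype_eq]
        have := Fintype.card_pos_iff.2 ⟨c⟩
        omega
      have e2 : N = (Finset.univ : Finset {v // v ≠ c}).erase ⟨v₀, hcv⟩ := by
        ext x; simp [N, Subtype.ext_iff]
      rw [e2, Finset.card_erase_of_mem (Finset.mem_univ _)]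
      have : 0 < (Finset.univ : Finset {v // v ≠ c}).card :=
        Finset.card_pos.2 ⟨⟨v₀, hcv⟩, Finset.mem_univ _⟩
      omega
    have h2 := two_mul_card_edgesIn (S := S) (A := Set.univ) (fun _ _ _ _ => by simp)
    have k1 : S.edgesIn Set.univ = S.edges := by ext; simp [mem_edgesIn]
    have k2 : S.trisIn Set.univ = S.triangles := by ext; simp [mem_trisIn]
    rw [k1, k2] at h2
    rw [chi2, k2, Set.ncard_univ, Nat.card_eq_fintype_card] at hchi
    omega
  have hsurj : ∀ e ∈ E, ∃ x : {v // v ≠ c}, x.1 ≠ v₀ ∧ e = {(p x).1, x.1} := by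
    have : N.image (fun x => ({(p x).1, x.1} : Finset S.V)) = E := by
      apply Finset.eq_of_subset_of_card_le
      · intro e he
        simp only [N, Finset.mem_image, Finset.mem_filter, Finset.mem_univ, true_and] at he
        obtain ⟨x, hx, rfl⟩ := he
        exact (hp x hx).1
      · rw [Finset.card_image_of_injOn hinj, hNcard]
    intro e he
    rw [← this] at he
    simp only [N, Finset.mem_image, Finset.mem_filter, Finset.mem_univ, true_and] at he
    obtain ⟨x, hx, rfl⟩ := he
    exact ⟨x, hx, rfl⟩
  -- the potential
  obtain ⟨h, hh⟩ : ∃ h : {v // v ≠ c} → G, ∀ x, x.1 ≠ v₀ → h x = h (p x) * l (p x).1 x.1 := by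
    have hwf : WellFounded fun x y : {v // v ≠ c} => rk x < rk y := (measure rk).wf
    let h : {v // v ≠ c} → G := hwf.fix fun x rec =>
      if hx : x.1 = v₀ then 1 else rec (p x) (hp x hx).2 * l (p x).1 x.1
    refine ⟨h, fun x hx => ?_⟩
    simp only [h]
    rw [hwf.fix_eq, dif_neg hx]
  refine ⟨fun v => if hv : v = c then 1 else h ⟨v, hv⟩, ?_⟩
  have key := hsat (fun e => ∀ a b x, ∀ ha : a ≠ c, ∀ hb : b ≠ c, e = {a, b} → S.orient.R a b x →
    h ⟨a, ha⟩ * l a b = h ⟨b, hb⟩) (by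
      intro e he a b x ha hb hab hR
      obtain ⟨y, hy, hey⟩ := hsurj e he
      have hpy := hh y hy
      have hne := S.orient.ne hR
      rw [hab] at hey
      have : (a = (p y).1 ∧ b = y.1) ∨ (a = y.1 ∧ b = (p y).1) := by
        simp only [Finset.ext_iff, Finset.mem_insert, Finset.mem_singleton] at hey
        have i1 := (hey a).1 (.inl rfl)
        have i2 := (hey b).1 (.inr rfl)
        grind
      rcases this with ⟨rfl, rfl⟩ | ⟨rfl, rfl⟩
      · exact hpy.symm
      · rw [hsymm _ _ _ hR] at hpy
        simp only [Subtype.coe_eta]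
        rw [hpy, inv_mul_cancel_right]) (by
      intro x y z hR hx hy hz h1 h2 a b w ha hb hab hRw
      have hR1 := S.orient.cyc hR
      have hR2 := S.orient.cyc hR1
      have e1 := h1 x y z hx hy rfl hR
      have e2 := h2 y z x hy hz rfl hR1
      have e3 : h ⟨z, hz⟩ * l z x = h ⟨x, hx⟩ := by
        have := hcoc x y z hR hx hy hz
        rw [← e2, ← e1, mul_assoc, mul_assoc, ← mul_assoc (l x y), this, mul_one]
      have hne := S.orient.ne hRw
      have : (a = z ∧ b = x) ∨ (a = x ∧ b = z) := by
        simp only [Finset.ext_iff, Finset.mem_insert, Finset.mem_singleton] at hab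
        have i1 := (hab a).2 (.inl rfl)
        have i2 := (hab b).2 (.inr rfl)
        grind
      rcases this with ⟨rfl, rfl⟩ | ⟨rfl, rfl⟩
      · exact e3
      · rw [hsymm _ _ _ hR2, ← e3, mul_inv_cancel_right])
  intro a b x hR ha hb
  simp only [dif_neg ha, dif_neg hb]
  exact key a b x hR ha hb a b x ha hb rfl hR

end ClosedOrientedSurface

/-! ### The fundamental groupoid, segments and open stars -/

/-- The homotopy class of a path as a morphism of the fundamental groupoid. -/
abbrev cls {X : Type u} [TopologicalSpace X] {x y : X} (p : Path x y) :
    FundamentalGroupoid.mk x ⟶ FundamentalGroupoid.mk y :=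
  Path.Homotopic.Quotient.mk p

section Groupoid

variable {X : Type u} [TopologicalSpace X] {x y z x' y' : X}

lemma cls_trans (p : Path x y) (q : Path y z) : cls (p.trans q) = cls p ≫ cls q := rfl

lemma cls_refl (x : X) : cls (Path.refl x) = 𝟙 _ := rfl

lemma cls_symm (p : Path x y) : cls p.symm = inv (cls p) := by
  rw [← Groupoid.inv_eq_inv]; rfl

lemma cls_surj (f : FundamentalGroupoid.mk x ⟶ FundamentalGroupoid.mk y) :
    ∃ p : Path x y, cls p = f := Path.Homotopic.Quotient.mk_surjective f

lemma cls_subpath (γ : Path x y) (a b c : I) :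
    cls (γ.subpath a b) ≫ cls (γ.subpath b c) = cls (γ.subpath a c) :=
  Path.Homotopic.Quotient.eq.2 ⟨Path.Homotopy.subpathTransSubpath γ a b c⟩

/-- A free homotopy of paths gives a commutative square. -/
lemma cls_square {p : Path x y} {q : Path x' y'} {l : Path x x'} {r : Path y y'}
    (H : C(I × I, X)) (h0 : ∀ t, H (0, t) = p t) (h1 : ∀ t, H (1, t) = q t)
    (hl : ∀ s, H (s, 0) = l s) (hr : ∀ s, H (s, 1) = r s) :
    cls p ≫ cls r = cls l ≫ cls q := by
  obtain rfl : H (0, 0) = x := by rw [h0, p.source]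
  obtain rfl : H (0, 1) = y := by rw [h0, p.target]
  obtain rfl : H (1, 0) = x' := by rw [h1, q.source]
  obtain rfl : H (1, 1) = y' := by rw [h1, q.target]
  let P : Path ((0, 0) : I × I) (0, 1) := ⟨⟨fun t => (0, t), by fun_prop⟩, rfl, rfl⟩
  let Q : Path ((1, 0) : I × I) (1, 1) := ⟨⟨fun t => (1, t), by fun_prop⟩, rfl, rfl⟩
  let L : Path ((0, 0) : I × I) (1, 0) := ⟨⟨fun t => (t, 0), by fun_prop⟩, rfl, rfl⟩
  let R : Path ((0, 1) : I × I) (1, 1) := ⟨⟨fun t => (t, 1), by fun_prop⟩, rfl, rfl⟩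
  -- The two ways around the square are homotopic inside the square, and `H` pushes this homotopy to
  -- `X`.
  have : ContractibleSpace I := (convex_Icc (0 : ℝ) 1).contractibleSpace ⟨0, by simp⟩
  have e := SimplyConnectedSpace.paths_homotopic (P.trans R) (L.trans Q)
  have e' := Path.Homotopic.Quotient.eq.2 (e.map H)
  rw [Path.map_trans, Path.map_trans] at e'
  have i1 : P.map H.continuous = p := by ext t; exact h0 t
  have i2 : Q.map H.continuous = q := by ext t; exact h1 t
  have i3 : L.map H.continuous = l := by ext t; exact hl t
  have i4 : R.map H.continuous = r := by ext t; exact hr t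
  rw [i1, i2, i3, i4] at e'
  exact e'

end Groupoid

namespace ClosedOrientedSurface

variable {S : ClosedOrientedSurface}

/-- Two points lie in a common closed triangle. -/
def SameFace (x y : S.Carrier) : Prop :=
  ∃ t ∈ S.triangles, ∀ v, v ∉ t → x.1 v = 0 ∧ y.1 v = 0

lemma Carrier.nonneg (x : S.Carrier) (v : S.V) : 0 ≤ x.1 v := x.1.2.1 v

lemma Carrier.sum_eq (x : S.Carrier) : ∑ v, x.1 v = 1 := x.1.2.2

lemma Carrier.le_one (x : S.Carrier) (v : S.V) : x.1 v ≤ 1 :=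
  (mem_Icc_of_mem_stdSimplex x.1.2 v).2

lemma Carrier.ext {x y : S.Carrier} (h : ∀ v, x.1 v = y.1 v) : x = y :=
  Subtype.ext (Subtype.ext (funext h))

/-- A point given by barycentric coordinates. -/
def mkPt (w : S.V → ℝ) (h0 : ∀ v, 0 ≤ w v) (h1 : ∑ v, w v = 1)
    (h2 : ∃ t ∈ S.triangles, ∀ v, v ∉ t → w v = 0) : S.Carrier :=
  ⟨⟨w, h0, h1⟩, h2⟩

@[simp] lemma mkPt_apply (w : S.V → ℝ) (h0 h1 h2) (v : S.V) :
    (mkPt (S := S) w h0 h1 h2).1 v = w v := rfl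

lemma continuous_coord (v : S.V) : Continuous fun x : S.Carrier => x.1 v :=
  (continuous_apply v).comp (continuous_subtype_val.comp continuous_subtype_val)

lemma continuous_carrier {A : Type*} [TopologicalSpace A] {g : A → S.Carrier}
    (h : ∀ v, Continuous fun a => (g a).1 v) : Continuous g :=
  Continuous.subtype_mk (Continuous.subtype_mk (continuous_pi h) _) _

lemma SameFace.symm {x y : S.Carrier} (h : SameFace x y) : SameFace y x := by
  obtain ⟨t, ht, h⟩ := h
  exact ⟨t, ht, fun v hv => (h v hv).symm⟩

/-- The point at parameter `s` of the segment from `x` to `y`. -/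
def lerp (x y : S.Carrier) (h : SameFace x y) (s : I) : S.Carrier :=
  mkPt (fun v => (1 - s) * x.1 v + s * y.1 v)
    (fun v => add_nonneg (mul_nonneg (by linarith [s.2.2]) (x.nonneg v))
      (mul_nonneg s.2.1 (y.nonneg v)))
    (by rw [Finset.sum_add_distrib, ← Finset.mul_sum, ← Finset.mul_sum, x.sum_eq, y.sum_eq]; ring)
    (by
      obtain ⟨t, ht, h⟩ := h
      exact ⟨t, ht, fun v hv => by rw [(h v hv).1, (h v hv).2]; ring⟩)

@[simp] lemma lerp_apply (x y : S.Carrier) (h : SameFace x y) (s : I) (v : S.V) :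
    (lerp x y h s).1 v = (1 - s) * x.1 v + s * y.1 v := rfl

/-- The straight segment between two points of a closed triangle. -/
def seg (x y : S.Carrier) (h : SameFace x y) : Path x y where
  toFun := lerp x y h
  continuous_toFun := continuous_carrier fun v => by
    simp only [lerp_apply]; fun_prop
  source' := Carrier.ext fun v => by simp
  target' := Carrier.ext fun v => by simp

@[simp] lemma seg_apply (x y : S.Carrier) (h : SameFace x y) (s : I) (v : S.V) :
    (seg x y h s).1 v = (1 - s) * x.1 v + s * y.1 v := rfl

/-- Straight line homotopies. -/
lemma cls_straight {x y x' y' : S.Carrier} (p : Path x y) (q : Path x' y')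
    (h : ∀ t, SameFace (p t) (q t)) (hx : SameFace x x') (hy : SameFace y y') :
    cls p ≫ cls (seg y y' hy) = cls (seg x x' hx) ≫ cls q := by
  let H : C(I × I, S.Carrier) := ⟨fun z => lerp (p z.2) (q z.2) (h z.2) z.1,
    continuous_carrier fun v => by
      simp only [lerp_apply]
      have h1 := (continuous_coord v).comp (p.continuous.comp (continuous_snd : Continuous (Prod.snd : I × I → I)))
      have h2 := (continuous_coord v).comp (q.continuous.comp (continuous_snd : Continuous (Prod.snd : I × I → I)))
      exact ((continuous_const.sub (continuous_subtype_val.comp continuous_fst)).mul h1).add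
        ((continuous_subtype_val.comp continuous_fst).mul h2)⟩
  refine cls_square H ?_ ?_ ?_ ?_ <;> intro t <;> refine Carrier.ext fun v => ?_ <;> simp [H]

lemma cls_seg_trans {x y z : S.Carrier} (h : ∃ t ∈ S.triangles, ∀ v, v ∉ t →
    x.1 v = 0 ∧ y.1 v = 0 ∧ z.1 v = 0) (hxy : SameFace x y) (hyz : SameFace y z)
    (hxz : SameFace x z) : cls (seg x y hxy) ≫ cls (seg y z hyz) = cls (seg x z hxz) := by
  rw [cls_straight (seg x y hxy) (Path.refl z) ?_ hxz hyz, cls_refl, Category.comp_id]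
  intro s
  obtain ⟨t, ht, h⟩ := h
  refine ⟨t, ht, fun v hv => ?_⟩
  obtain ⟨h1, h2, h3⟩ := h v hv
  simp [h1, h2, h3]

lemma cls_seg_symm {x y : S.Carrier} (hxy : SameFace x y) :
    cls (seg y x hxy.symm) = inv (cls (seg x y hxy)) := by
  rw [← cls_symm]
  congr 1
  ext t
  refine Carrier.ext fun v => ?_
  simp [Path.symm]; ring

/-- The vertex `v` as a point of the surface. -/
def pt (v : S.V) : S.Carrier :=
  mkPt (fun u => if u = v then 1 else 0) (fun u => by split_ifs <;> norm_num) (by simp)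
    (by
      obtain ⟨t, ht, hv⟩ := S.exists_triangle v
      exact ⟨t, ht, fun u hu => if_neg (by rintro rfl; exact hu hv)⟩)

@[simp] lemma pt_apply (u v : S.V) : (pt v : S.Carrier).1 u = if u = v then 1 else 0 := rfl

lemma sameFace_pt {x : S.Carrier} {v : S.V} (h : 0 < x.1 v) : SameFace x (pt v) := by
  obtain ⟨t, ht, hx⟩ := x.2
  refine ⟨t, ht, fun u hu => ⟨hx u hu, ?_⟩⟩
  rw [pt_apply, if_neg]
  rintro rfl
  exact h.ne' (hx u hu)

lemma sameFace_pt_pt {t : Finset S.V} (ht : t ∈ S.triangles) {u v : S.V} (hu : u ∈ t)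
    (hv : v ∈ t) : SameFace (pt u : S.Carrier) (pt v) := by
  refine ⟨t, ht, fun w hw => ?_⟩
  simp only [pt_apply]
  rw [if_neg (by rintro rfl; exact hw hu), if_neg (by rintro rfl; exact hw hv)]
  exact ⟨rfl, rfl⟩

/-- Paths in an open star are homotopic to the path through the centre. -/
lemma cls_star {x y : S.Carrier} (p : Path x y) (v : S.V) (h : ∀ t, 0 < (p t).1 v)
    (hx : 0 < x.1 v) (hy : 0 < y.1 v) :
    cls p ≫ cls (seg y (pt v) (sameFace_pt hy)) = cls (seg x (pt v) (sameFace_pt hx)) := by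
  rw [cls_straight p (Path.refl (pt v)) (fun t => sameFace_pt (h t)) (sameFace_pt hx), cls_refl,
    Category.comp_id]

/-- A loop in an open star is trivial. -/
lemma cls_star_eq {x y : S.Carrier} (p q : Path x y) (v : S.V) (hp : ∀ t, 0 < (p t).1 v)
    (hq : ∀ t, 0 < (q t).1 v) : cls p = cls q := by
  have hx : 0 < x.1 v := by simpa using hp 0
  have hy : 0 < y.1 v := by simpa using hp 1
  have := (cls_star p v hp hx hy).trans (cls_star q v hq hx hy).symm
  exact (cancel_mono _).1 this

/-- Continuity can be checked on closed triangles. -/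
lemma continuous_of_faces {Y : Type*} [TopologicalSpace Y] {g : S.Carrier → Y}
    (h : ∀ t ∈ S.triangles, ContinuousOn g {x | ∀ v, v ∉ t → x.1 v = 0}) : Continuous g := by
  refine (locallyFinite_of_finite fun t : {t // t ∈ S.triangles} =>
    {x | ∀ v, v ∉ t.1 → (x : S.Carrier).1 v = 0}).continuous ?_ ?_ fun t => h t.1 t.2
  · rw [Set.eq_univ_iff_forall]
    intro x
    obtain ⟨t, ht, hx⟩ := x.2
    exact Set.mem_iUnion.2 ⟨⟨t, ht⟩, hx⟩
  · intro t
    simp only [Set.ofPred_forall]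
    exact isClosed_iInter fun v => isClosed_iInter fun _ =>
      isClosed_eq (continuous_coord v) continuous_const

end ClosedOrientedSurface

/-! ### Singular chains and homologous cycles -/

section Chains

variable {X : Type u} [TopologicalSpace X]

/-- The singular 3-chain with value one on the singular simplex `τ`. -/
noncomputable def singularSimplex₃ (τ : C(stdSimplex ℝ (Fin 4), X)) : (singularChains X).X 3 :=
  ((TopCat.toSSet.obj (TopCat.of X)).ιChainComplex (R := ModuleCat.of ℤ (ULift.{u} ℤ))
    ((TopCat.toSSetObjEquiv (TopCat.of X) (.op ⦋3⦌)).symm τ)).hom (ULift.up 1)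

/-- The inclusion of the `i`-th face of the standard 3-simplex. -/
noncomputable def face₃ (i : Fin 4) : C(stdSimplex ℝ (Fin 3), stdSimplex ℝ (Fin 4)) :=
  ⟨stdSimplex.map i.succAbove, stdSimplex.continuous_map _⟩

lemma d_singularSimplex₃ (τ : C(stdSimplex ℝ (Fin 4), X)) :
    ((singularChains X).d 3 2).hom (singularSimplex₃ τ) =
      ∑ i : Fin 4, (-1 : ℤ) ^ i.val • singularSimplex (τ.comp (face₃ i)) := by
  have h := (TopCat.toSSet.obj (TopCat.of X)).ιChainComplex_d
    (R := ModuleCat.of ℤ (ULift.{u} ℤ)) (n := 2)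
    ((TopCat.toSSetObjEquiv (TopCat.of X) (.op ⦋3⦌)).symm τ)
  have h2 := congrArg (fun f => f.hom (ULift.up 1)) h
  simp only [ModuleCat.hom_comp, LinearMap.comp_apply] at h2
  refine h2.trans ?_
  rw [ModuleCat.hom_sum, LinearMap.sum_apply]
  rfl

/-- The chain `c` is a cycle in the homology class `α`. -/
def ChainRep (c : (singularChains X).X 2) (α : H2 X) : Prop :=
  ∃ z : (singularChains X).cycles 2,
    ((singularChains X).iCycles 2).hom z = c ∧ ((singularChains X).homologyπ 2).hom z = α

lemma ChainRep.add_boundary {c : (singularChains X).X 2} {α : H2 X} (h : ChainRep c α)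
    (e : (singularChains X).X 3) : ChainRep (c + ((singularChains X).d 3 2).hom e) α := by
  obtain ⟨z, h1, h2⟩ := h
  refine ⟨z + ((singularChains X).toCycles 3 2).hom e, ?_, ?_⟩
  · rw [map_add, h1]
    congr 1
    rw [← LinearMap.comp_apply, ← ModuleCat.hom_comp, HomologicalComplex.toCycles_i]
  · rw [map_add, h2]
    have := (singularChains X).toCycles_comp_homologyπ 3 2
    have h3 := congrArg (fun f => f.hom e) this
    simp only [ModuleCat.hom_comp, LinearMap.comp_apply] at h3
    rw [h3]
    simp

end Chains

/-! ### Bisection of an edge: combinatorics -/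

namespace OrTri

variable {V : Type} (O : OrTri V) (a b c d : V)

/-- The edges opposite to the midpoint of the edge `ab`, where `abc` and `bad` are the two
triangles at this edge. -/
def half (y z : V) : Prop :=
  (y = b ∧ z = c) ∨ (y = d ∧ z = b) ∨ (y = a ∧ z = d) ∨ (y = c ∧ z = a)

/-- The triangles after bisection of the edge `ab`; the midpoint is `⊥`. -/
def bisectR : WithBot V → WithBot V → WithBot V → Prop
| some x, some y, some z => O.R x y z ∧ ¬ ((a = x ∨ a = y ∨ a = z) ∧ (b = x ∨ b = y ∨ b = z))
| none, some y, some z => half a b c d y z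
| some x, none, some z => half a b c d z x
| some x, some y, none => half a b c d x y
| _, _, _ => False

variable {O a b c d}

lemma half_swap_ne (hc : O.R a b c) (hd : O.R b a d) {y z : V} (h : half a b c d y z) :
    ¬ half a b c d z y := by
  have h1 := O.ne' hc
  have h2 := O.ne' hd
  have h3 : c ≠ d := by rintro rfl; exact O.not_swap hc hd
  unfold half at *
  grind

lemma half_uniq (hc : O.R a b c) (hd : O.R b a d) {y z w : V} (h : half a b c d y z)
    (h' : half a b c d y w) : z = w := by
  have h1 := O.ne' hc
  have h2 := O.ne' hd
  have h3 : c ≠ d := by rintro rfl; exact O.not_swap hc hd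
  unfold half at *
  grind

lemma half_uniq' (hc : O.R a b c) (hd : O.R b a d) {y z w : V} (h : half a b c d z y)
    (h' : half a b c d w y) : z = w := by
  have h1 := O.ne' hc
  have h2 := O.ne' hd
  have h3 : c ≠ d := by rintro rfl; exact O.not_swap hc hd
  unfold half at *
  grind

lemma half_R (hc : O.R a b c) (hd : O.R b a d) {y z : V} (h : half a b c d y z) :
    ∃ w, O.R y z w ∧ (a = y ∨ a = z ∨ a = w) ∧ (b = y ∨ b = z ∨ b = w) := by
  have c1 := O.cyc hc
  have c2 := O.cyc c1
  have d1 := O.cyc hd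
  have d2 := O.cyc d1
  rcases h with ⟨rfl, rfl⟩ | ⟨rfl, rfl⟩ | ⟨rfl, rfl⟩ | ⟨rfl, rfl⟩
  · exact ⟨_, c1, by tauto⟩
  · exact ⟨_, d2, by tauto⟩
  · exact ⟨_, d1, by tauto⟩
  · exact ⟨_, c2, by tauto⟩

/-- A triangle with the edge `ab` gives two halves. -/
lemma half_of_R (hc : O.R a b c) (hd : O.R b a d) {x y z : V} (h : O.R x y z)
    (hab : (a = x ∨ a = y ∨ a = z) ∧ (b = x ∨ b = y ∨ b = z)) :
    (x = a ∧ y = b ∧ z = c) ∨ (x = b ∧ y = c ∧ z = a) ∨ (x = c ∧ y = a ∧ z = b) ∨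
    (x = b ∧ y = a ∧ z = d) ∨ (x = a ∧ y = d ∧ z = b) ∨ (x = d ∧ y = b ∧ z = a) := by
  have hne := O.ne' h
  have h1 := O.cyc h
  have h2 := O.cyc h1
  obtain ⟨rfl | rfl | rfl, rfl | rfl | rfl⟩ := hab
  · exact absurd rfl (O.ne hc)
  · exact .inl ⟨rfl, rfl, O.uniq h hc⟩
  · exact .inr (.inr (.inr (.inr (.inl ⟨rfl, O.uniq h2 hd, rfl⟩))))
  · exact .inr (.inr (.inr (.inl ⟨rfl, rfl, O.uniq h hd⟩)))
  · exact absurd rfl (O.ne hc)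
  · exact .inr (.inr (.inl ⟨O.uniq h1 hc, rfl, rfl⟩))
  · exact .inr (.inl ⟨rfl, O.uniq h2 hc, rfl⟩)
  · exact .inr (.inr (.inr (.inr (.inr ⟨O.uniq h1 hd, rfl, rfl⟩))))
  · exact absurd rfl (O.ne hc)

/-- The link of `v` changes only a little: for `v = a` or `v = b` the midpoint replaces the other
end of the bisected edge, and for `v = c` or `v = d` it is inserted between `a` and `b`. So an
invariant predicate on the new link gives one on the old link, with the value at the replaced vertex
taken from the midpoint. -/
lemma bisect_link (hc : O.R a b c) (hd : O.R b a d) (v : V) (A : WithBot V → Prop)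
    (hA : ∀ x y, bisectR O a b c d (some v) x y → (A x ↔ A y)) :
    ∃ A0 : V → Prop, (∀ x y, O.R v x y → (A0 x ↔ A0 y)) ∧
      ∀ x x', bisectR O a b c d (some v) x x' → ∃ x0 z, O.R v x0 z ∧ (A0 x0 ↔ A x) := by
  classical
  have c1 := O.cyc hc
  have c2 := O.cyc c1
  have d1 := O.cyc hd
  have d2 := O.cyc d1
  have n1 := O.ne' hc
  have n2 := O.ne' hd
  have n3 : c ≠ d := by rintro rfl; exact O.not_swap hc hd
  have e1 : ∀ x, half a b c d v x → (A x ↔ A ⊥) := fun x hx => hA (some x) none hx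
  have e2 : ∀ x, half a b c d x v → (A ⊥ ↔ A x) := fun x hx => hA none (some x) hx
  obtain ⟨A0, p1, p2⟩ : ∃ A0 : V → Prop,
      (∀ x, (v = a ∧ x = b) ∨ (v = b ∧ x = a) → (A0 x ↔ A ⊥)) ∧
      (∀ x, ¬ ((v = a ∧ x = b) ∨ (v = b ∧ x = a)) → (A0 x ↔ A x)) :=
    ⟨fun x => if (v = a ∧ x = b) ∨ (v = b ∧ x = a) then A ⊥ else A x,
      fun x h => by simp only [if_pos h], fun x h => by simp only [if_neg h]⟩
  refine ⟨A0, ?_, ?_⟩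
  · intro x y hxy
    have hne := O.ne' hxy
    by_cases hab : (a = v ∨ a = x ∨ a = y) ∧ (b = v ∨ b = x ∨ b = y)
    · rcases half_of_R hc hd hxy hab with ⟨rfl, rfl, rfl⟩ | ⟨rfl, rfl, rfl⟩ | ⟨rfl, rfl, rfl⟩ |
        ⟨rfl, rfl, rfl⟩ | ⟨rfl, rfl, rfl⟩ | ⟨rfl, rfl, rfl⟩
      · have := e2 y (by simp [half]); grind
      · have := e1 x (by simp [half]); grind
      · have i := e1 x (by simp [half]); have j := e2 y (by simp [half]); grind
      · have := e2 y (by simp [half]); grind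
      · have := e1 x (by simp [half]); grind
      · have i := e1 x (by simp [half]); have j := e2 y (by simp [half]); grind
    · have := hA (some x) (some y) ⟨hxy, hab⟩
      exact (p2 x (by grind)).trans (this.trans (p2 y (by grind)).symm)
  · intro x x' h
    rcases x with _ | x
    · rcases x' with _ | x'
      · exact h.elim
      · have h' : half a b c d x' v := h
        have k := e2 _ h'
        unfold half at h'
        rcases h' with ⟨rfl, rfl⟩ | ⟨rfl, rfl⟩ | ⟨rfl, rfl⟩ | ⟨rfl, rfl⟩
        · exact ⟨_, _, c2, (p2 _ (by grind)).trans (e1 _ (by simp [half]))⟩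
        · exact ⟨_, _, hd, p1 _ (by grind)⟩
        · exact ⟨_, _, d2, (p2 _ (by grind)).trans (e1 _ (by simp [half]))⟩
        · exact ⟨_, _, hc, p1 _ (by grind)⟩
    · rcases x' with _ | x'
      · have h' : half a b c d v x := h
        obtain ⟨w, hw, -⟩ := half_R hc hd h'
        refine ⟨x, w, hw, p2 x ?_⟩
        unfold half at h'
        grind
      · have h' : O.R v x x' ∧ _ := h
        exact ⟨x, x', h'.1, p2 x (by grind)⟩

variable (O a b c d)

/-- Bisection of the edge `ab`, where `abc` and `bad` are the triangles at this edge. -/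
def bisect (hc : O.R a b c) (hd : O.R b a d) : OrTri (WithBot V) where
  R := bisectR O a b c d
  cyc := by
    rintro (_ | x) (_ | y) (_ | z) h <;>
      first
      | exact h.elim
      | skip
    · exact h
    · exact h
    · exact h
    · exact ⟨O.cyc h.1, by have := h.2; tauto⟩
  ne := by
    have key : ∀ x, ¬ half a b c d x x := fun x hx => half_swap_ne hc hd hx hx
    rintro (_ | x) (_ | y) (_ | z) h heq <;>
      first
      | exact h.elim
      | exact absurd heq (by simp)
      | skip
    · obtain rfl : x = y := WithBot.coe_injective heq
      exact key _ h
    · obtain rfl : x = y := WithBot.coe_injective heq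
      exact O.ne h.1 rfl
  uniq := by
    -- An outer edge of the four halves lies, in its direction, in one of the two destroyed
    -- triangles, so it is in no surviving one.
    have key : ∀ x y z, half a b c d x y → O.R x y z →
        ¬ ((a = x ∨ a = y ∨ a = z) ∧ (b = x ∨ b = y ∨ b = z)) → False := by
      intro x y z h h1 h2
      obtain ⟨w, hw, h3⟩ := half_R hc hd h
      obtain rfl := O.uniq hw h1
      unfold half at h
      have n1 := O.ne' hc
      grind
    rintro (_ | x) (_ | y) (_ | z) (_ | w) h h' <;>
      first
      | exact h.elim
      | exact h'.elim
      | rfl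
      | skip
    · exact congrArg _ (half_uniq hc hd h h')
    · exact congrArg _ (half_uniq' hc hd h h')
    · exact (key _ _ _ h h'.1 h'.2).elim
    · exact (key _ _ _ h' h.1 h.2).elim
    · exact congrArg _ (O.uniq h.1 h'.1)
  opp := by
    have n1 := O.ne' hc
    have n2 := O.ne' hd
    have n3 : c ≠ d := by rintro rfl; exact O.not_swap hc hd
    rintro (_ | x) (_ | y) (_ | z) h <;>
      first
      | exact h.elim
      | skip
    · have h' : half a b c d y z := h
      have : ∃ w, half a b c d w y := by
        unfold half at h' ⊢
        grind
      obtain ⟨w, hw⟩ := this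
      exact ⟨some w, hw⟩
    · have h' : half a b c d z x := h
      have : ∃ w, half a b c d x w := by
        unfold half at h' ⊢
        grind
      obtain ⟨w, hw⟩ := this
      exact ⟨some w, hw⟩
    · have h' : half a b c d x y := h
      obtain ⟨z, hz, hz'⟩ := half_R hc hd h'
      obtain ⟨w, hw⟩ := O.opp hz
      refine ⟨some w, hw, fun hab => ?_⟩
      have := half_of_R hc hd hw hab
      unfold half at h'
      grind
    · obtain ⟨w, hw⟩ := O.opp h.1
      have h2 := h.2
      by_cases hab : (a = y ∨ a = x ∨ a = w) ∧ (b = y ∨ b = x ∨ b = w)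
      · refine ⟨none, ?_⟩
        have := half_of_R hc hd hw hab
        change half a b c d y x
        unfold half
        grind
      · exact ⟨some w, hw, hab⟩
  not_swap := by
    rintro (_ | x) (_ | y) (_ | z) h h' <;>
      first
      | exact h.elim
      | exact h'.elim
      | skip
    · exact half_swap_ne hc hd h h'
    · exact half_swap_ne hc hd h h'
    · exact half_swap_ne hc hd h h'
    · exact O.not_swap h.1 h'.1
  cover := by
    rintro (_ | x)
    · exact ⟨some b, some c, .inl ⟨rfl, rfl⟩⟩
    · obtain ⟨y, z, h⟩ := O.cover x
      by_cases hab : (a = x ∨ a = y ∨ a = z) ∧ (b = x ∨ b = y ∨ b = z)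
      · rcases half_of_R hc hd h hab with ⟨rfl, rfl, rfl⟩ | ⟨rfl, rfl, rfl⟩ | ⟨rfl, rfl, rfl⟩ |
          ⟨rfl, rfl, rfl⟩ | ⟨rfl, rfl, rfl⟩ | ⟨rfl, rfl, rfl⟩
        · exact ⟨none, some z, .inr (.inr (.inr ⟨rfl, rfl⟩))⟩
        · exact ⟨some y, none, .inl ⟨rfl, rfl⟩⟩
        · exact ⟨some y, none, .inr (.inr (.inr ⟨rfl, rfl⟩))⟩
        · exact ⟨none, some z, .inr (.inl ⟨rfl, rfl⟩)⟩
        · exact ⟨some y, none, .inr (.inr (.inl ⟨rfl, rfl⟩))⟩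
        · exact ⟨some y, none, .inr (.inl ⟨rfl, rfl⟩)⟩
      · exact ⟨some y, some z, h, hab⟩
  link := by
    rintro (_ | v) A hA x y x' y' hx hy hAx
    · have i1 : A b ↔ A c := hA (some b) (some c) (.inl ⟨rfl, rfl⟩)
      have i2 : A d ↔ A b := hA (some d) (some b) (.inr (.inl ⟨rfl, rfl⟩))
      have i3 : A a ↔ A d := hA (some a) (some d) (.inr (.inr (.inl ⟨rfl, rfl⟩)))
      have key : ∀ x x', bisectR O a b c d ⊥ x x' → (A x ↔ A b) := by
        rintro (_ | x) (_ | x') h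
        · exact h.elim
        · exact h.elim
        · exact h.elim
        · rcases h with ⟨rfl, rfl⟩ | ⟨rfl, rfl⟩ | ⟨rfl, rfl⟩ | ⟨rfl, rfl⟩
          · exact Iff.rfl
          · exact i2
          · exact i3.trans i2
          · exact i1.symm
      exact (key y y' hy).2 ((key x x' hx).1 hAx)
    · obtain ⟨A0, h0, h1⟩ := bisect_link hc hd v A hA
      obtain ⟨x0, z, hz, e1⟩ := h1 x x' hx
      obtain ⟨y0, w, hw, e2⟩ := h1 y y' hy
      exact e2.1 (O.link v A0 h0 x0 y0 z w hz hw (e1.2 hAx))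

end OrTri

lemma sum_withBot {V : Type} [Fintype V] {M : Type*} [AddCommMonoid M] (f : WithBot V → M) :
    ∑ x, f x = f ⊥ + ∑ v : V, f v :=
  Fintype.sum_option f

namespace OrTri

variable {V : Type} {O : OrTri V} {a b c d : V} [LinearOrder V]

/-- The image of a set of vertices in the bisected triangulation. -/
def up (s : Finset V) : Finset (WithBot V) := s.image (WithBot.some : V → WithBot V)

lemma up_inj {s t : Finset V} (h : up s = up t) : s = t :=
  Finset.image_injective WithBot.coe_injective h

lemma mem_up {s : Finset V} {v : V} : (v : WithBot V) ∈ up s ↔ v ∈ s := by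
  simp [up]

lemma bot_notMem_up {s : Finset V} : (⊥ : WithBot V) ∉ up s := by
  simp [up]

variable [Fintype V]

lemma mem_tris_bisect (hc : O.R a b c) (hd : O.R b a d) {t : Finset (WithBot V)} :
    t ∈ (O.bisect a b c d hc hd).tris ↔
      (∃ s ∈ O.tris, s ≠ {a, b, c} ∧ s ≠ {b, a, d} ∧ t = up s) ∨
      ∃ y z, half a b c d y z ∧ t = {⊥, (y : WithBot V), (z : WithBot V)} := by
  rw [mem_tris]
  constructor
  · rintro ⟨x, y, z, h, rfl⟩
    rcases x with _ | x <;> rcases y with _ | y <;> rcases z with _ | z <;>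
      first
      | exact h.elim
      | skip
    · exact .inr ⟨y, z, h, rfl⟩
    · exact .inr ⟨z, x, h, by ext; simp [WithBot.none_eq_bot, WithBot.some_eq_coe]; tauto⟩
    · exact .inr ⟨x, y, h, by ext; simp [WithBot.none_eq_bot, WithBot.some_eq_coe]; tauto⟩
    · obtain ⟨h1, h2⟩ := h
      refine .inl ⟨{x, y, z}, O.mem_tris.2 ⟨x, y, z, h1, rfl⟩, ?_, ?_, ?_⟩
      · intro he
        apply h2
        have k1 : a ∈ ({x, y, z} : Finset V) := by rw [he]; simp
        have k2 : b ∈ ({x, y, z} : Finset V) := by rw [he]; simp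
        simpa using And.intro k1 k2
      · intro he
        apply h2
        have k1 : a ∈ ({x, y, z} : Finset V) := by rw [he]; simp
        have k2 : b ∈ ({x, y, z} : Finset V) := by rw [he]; simp
        simpa using And.intro k1 k2
      · simp [up, WithBot.some_eq_coe]
  · rintro (⟨s, hs, h1, h2, rfl⟩ | ⟨y, z, h, rfl⟩)
    · obtain ⟨x, y, z, h, rfl⟩ := O.mem_tris.1 hs
      refine ⟨x, y, z, ⟨h, fun hab => ?_⟩, by simp [up]⟩
      rcases half_of_R hc hd h hab with ⟨rfl, rfl, rfl⟩ | ⟨rfl, rfl, rfl⟩ | ⟨rfl, rfl, rfl⟩ |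
        ⟨rfl, rfl, rfl⟩ | ⟨rfl, rfl, rfl⟩ | ⟨rfl, rfl, rfl⟩
      · exact h1 rfl
      · exact h1 (by ext; simp; tauto)
      · exact h1 (by ext; simp; tauto)
      · exact h2 rfl
      · exact h2 (by ext; simp; tauto)
      · exact h2 (by ext; simp; tauto)
    · exact ⟨none, some y, some z, h, rfl⟩

/-- All comparisons across a bisection come from this identity: a constant `F` counts triangles, an
indicator counts those of a component, and `signedSimplex` compares fundamental chains. The two
destroyed triangles sit on the left so that the sum over all old triangles can appear on the right.
-/
lemma sum_tris_bisect (hc : O.R a b c) (hd : O.R b a d) {M : Type*} [AddCommGroup M]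
    (F : Finset (WithBot V) → M) :
    ∑ t ∈ (O.bisect a b c d hc hd).tris, F t + F (up {a, b, c}) + F (up {b, a, d}) =
      ∑ s ∈ O.tris, F (up s) + (F {⊥, (b : WithBot V), (c : WithBot V)} +
        F {⊥, (d : WithBot V), (b : WithBot V)} + F {⊥, (a : WithBot V), (d : WithBot V)} +
        F {⊥, (c : WithBot V), (a : WithBot V)}) := by
  classical
  obtain ⟨hab, hbc, hac⟩ := O.ne' hc
  obtain ⟨-, had, hbd⟩ := O.ne' hd
  have hcd : c ≠ d := by rintro rfl; exact O.not_swap hc hd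
  have hne : ({b, a, d} : Finset V) ≠ {a, b, c} := by
    intro h
    have : c ∈ ({b, a, d} : Finset V) := by rw [h]; simp
    simp at this
    grind
  have m1 : ({a, b, c} : Finset V) ∈ O.tris := O.mem_tris.2 ⟨_, _, _, hc, rfl⟩
  have m2 : ({b, a, d} : Finset V) ∈ O.tris.erase {a, b, c} :=
    Finset.mem_erase.2 ⟨hne, O.mem_tris.2 ⟨_, _, _, hd, rfl⟩⟩
  have e : (O.bisect a b c d hc hd).tris =
      (((O.tris.erase {a, b, c}).erase {b, a, d}).image up) ∪
      {{⊥, (b : WithBot V), (c : WithBot V)}, {⊥, (d : WithBot V), (b : WithBot V)},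
        {⊥, (a : WithBot V), (d : WithBot V)}, {⊥, (c : WithBot V), (a : WithBot V)}} := by
    ext t
    rw [mem_tris_bisect]
    simp only [Finset.mem_union, Finset.mem_image, Finset.mem_erase, Finset.mem_insert,
      Finset.mem_singleton]
    refine or_congr ⟨?_, ?_⟩ ⟨?_, ?_⟩
    · rintro ⟨s, h1, h2, h3, rfl⟩; exact ⟨s, ⟨h3, h2, h1⟩, rfl⟩
    · rintro ⟨s, ⟨h3, h2, h1⟩, rfl⟩; exact ⟨s, h1, h2, h3, rfl⟩
    · rintro ⟨y, z, ⟨rfl, rfl⟩ | ⟨rfl, rfl⟩ | ⟨rfl, rfl⟩ | ⟨rfl, rfl⟩, rfl⟩ <;> tauto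
    · rintro (rfl | rfl | rfl | rfl)
      · exact ⟨_, _, .inl ⟨rfl, rfl⟩, rfl⟩
      · exact ⟨_, _, .inr (.inl ⟨rfl, rfl⟩), rfl⟩
      · exact ⟨_, _, .inr (.inr (.inl ⟨rfl, rfl⟩)), rfl⟩
      · exact ⟨_, _, .inr (.inr (.inr ⟨rfl, rfl⟩)), rfl⟩
  rw [e, Finset.sum_union, Finset.sum_image (fun _ _ _ _ h => up_inj h)]
  · have n1 : ∀ {x y z w : V}, x ≠ z → x ≠ w →
        ({⊥, (x : WithBot V), (y : WithBot V)} : Finset (WithBot V)) ≠ {⊥, ↑z, ↑w} := by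
      intro x y z w h1 h2 h
      have : (x : WithBot V) ∈ ({⊥, ↑z, ↑w} : Finset (WithBot V)) := by rw [← h]; simp
      simp at this
      tauto
    have n2 : ∀ {x y z w : V}, y ≠ z → y ≠ w →
        ({⊥, (x : WithBot V), (y : WithBot V)} : Finset (WithBot V)) ≠ {⊥, ↑z, ↑w} := by
      intro x y z w h1 h2 h
      have : (y : WithBot V) ∈ ({⊥, ↑z, ↑w} : Finset (WithBot V)) := by rw [← h]; simp
      simp at this
      tauto
    rw [Finset.sum_insert, Finset.sum_insert, Finset.sum_pair, ← Finset.add_sum_erase _ _ m1,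
      ← Finset.add_sum_erase _ _ m2]
    · abel
    · exact n2 hcd.symm had.symm
    · simp only [Finset.mem_insert, Finset.mem_singleton, not_or]
      exact ⟨n2 hab.symm hbd, n1 hcd.symm had.symm⟩
    · simp only [Finset.mem_insert, Finset.mem_singleton, not_or]
      exact ⟨n2 hcd hbc.symm, n1 hab.symm hbd, n1 hbc hab.symm⟩
  · rw [Finset.disjoint_left]
    intro t h1 h2
    rw [Finset.mem_image] at h1
    obtain ⟨s, -, rfl⟩ := h1
    apply bot_notMem_up (s := s)
    simp only [Finset.mem_insert, Finset.mem_singleton] at h2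
    rcases h2 with h2 | h2 | h2 | h2 <;> rw [h2] <;> simp

open Classical in
/-- Twice the Euler characteristic of the union `A` of components. -/
noncomputable def chi2 {V : Type} [Fintype V] (O : OrTri V) (A : Set V) : ℤ :=
  2 * A.ncard - (O.tris.filter fun t : Finset V => (t : Set V) ⊆ A).card

end OrTri

namespace ClosedOrientedSurface

variable {S : ClosedOrientedSurface} {a b c d : S.V}

/-- The surface with the edge `ab` bisected. -/
noncomputable abbrev bisectSurface (hc : S.orient.R a b c) (hd : S.orient.R b a d) :
    ClosedOrientedSurface :=
  (S.orient.bisect a b c d hc hd).toSurface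

lemma tris_orient : S.orient.tris = S.triangles := by
  ext t
  rw [OrTri.mem_tris, mem_triangles]

section

variable {V : Type} [Fintype V] [LinearOrder V] (O : OrTri V)

lemma chi2_toSurface (A : Set V) : O.toSurface.chi2 A = O.chi2 A := rfl

lemma chi2_eq (A : Set S.V) : S.chi2 A = S.orient.chi2 A := by
  rw [chi2, trisIn, OrTri.chi2, tris_orient]

lemma closed_orient_toSurface {A : Set V} : O.toSurface.orient.Closed A ↔ O.Closed A :=
  ⟨fun h x y z hR => h x y z ((O.orient_toSurface x y z).2 hR),
    fun h x y z hR => h x y z ((O.orient_toSurface x y z).1 hR)⟩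

lemma isComp_orient_toSurface {A : Set V} : O.toSurface.orient.IsComp A ↔ O.IsComp A := by
  unfold OrTri.IsComp
  rw [closed_orient_toSurface]
  constructor
  · rintro ⟨h1, h2, h3⟩
    exact ⟨h1, h2, fun B hB => h3 B ((closed_orient_toSurface O).2 hB)⟩
  · rintro ⟨h1, h2, h3⟩
    exact ⟨h1, h2, fun B hB => h3 B ((closed_orient_toSurface O).1 hB)⟩

end

/-- One new vertex and two more triangles leave 2V - F unchanged. -/
lemma eulerChar_bisect (hc : S.orient.R a b c) (hd : S.orient.R b a d) :
    (bisectSurface hc hd).eulerChar = S.eulerChar := by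
  have h1 := two_mul_eulerChar (S := S)
  have h2 := two_mul_eulerChar (S := bisectSurface hc hd)
  have h3 : Fintype.card (bisectSurface hc hd).V = Fintype.card S.V + 1 :=
    Fintype.card_option
  have h4 := OrTri.sum_tris_bisect hc hd (fun _ => (1 : ℤ))
  simp only [Finset.sum_const, mul_one, nsmul_eq_mul, tris_orient] at h4
  have h5 : (bisectSurface hc hd).triangles.card = (S.orient.bisect a b c d hc hd).tris.card := rfl
  rw [h3, h5] at h2
  push_cast at h2
  linarith

/-- Dropping the midpoint from a component gives an old component, since the midpoint goes with `a`
and `b`. In the component of `a` there are one more vertex and two more triangles, elsewhere nothing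
changes. -/
lemma exists_isComp_bisect (hc : S.orient.R a b c) (hd : S.orient.R b a d)
    (A' : Set (WithBot S.V)) (hA : (S.orient.bisect a b c d hc hd).IsComp A') :
    ∃ A, S.orient.IsComp A ∧ (S.orient.bisect a b c d hc hd).chi2 A' = S.orient.chi2 A := by
  classical
  have n1 := S.orient.ne' hc
  have n2 := S.orient.ne' hd
  obtain ⟨A, hAA⟩ : ∃ A : Set S.V, ∀ v, v ∈ A ↔ (v : WithBot S.V) ∈ A' :=
    ⟨{v | (v : WithBot S.V) ∈ A'}, fun v => Iff.rfl⟩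
  have hh : ∀ y z, OrTri.half a b c d y z →
      (((y : WithBot S.V) ∈ A' ↔ (⊥ : WithBot S.V) ∈ A')) ∧
      ((z : WithBot S.V) ∈ A' ↔ (⊥ : WithBot S.V) ∈ A') := by
    intro y z h
    have i1 := hA.2.1 none (some y) (some z) h
    have i2 := hA.2.1 (some z) none (some y) h
    exact ⟨i1.symm, i2⟩
  have hb := hh b c (.inl ⟨rfl, rfl⟩)
  have ha := hh a d (.inr (.inr (.inl ⟨rfl, rfl⟩)))
  have hcl : S.orient.Closed A := by
    intro x y z h
    by_cases hab : (a = x ∨ a = y ∨ a = z) ∧ (b = x ∨ b = y ∨ b = z)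
    · have := OrTri.half_of_R hc hd h hab
      rw [hAA, hAA]
      grind
    · rw [hAA, hAA]
      exact hA.2.1 (some x) (some y) (some z) ⟨h, hab⟩
  have hcomp : S.orient.IsComp A := by
    refine ⟨?_, hcl, ?_⟩
    · obtain ⟨x, hx⟩ := hA.1
      rcases x with _ | x
      · exact ⟨a, (hAA a).2 (ha.1.2 hx)⟩
      · exact ⟨x, (hAA x).2 hx⟩
    · intro B hB hne x hx
      obtain ⟨B', k1, k2⟩ : ∃ B' : Set (WithBot S.V),
          (∀ v : S.V, (v : WithBot S.V) ∈ B' ↔ v ∈ B) ∧ ((⊥ : WithBot S.V) ∈ B' ↔ a ∈ B) := by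
        -- The image of `B`, with the midpoint added exactly when `a` is in `B`.
        refine ⟨{p | ∀ v, (p = ⊥ → a ∈ B) ∧ (p = ((v : S.V) : WithBot S.V) → v ∈ B)}, ?_, ?_⟩
        · intro v
          simp only [Set.mem_ofPred_eq]
          constructor
          · intro h; exact (h v).2 rfl
          · intro h w; exact ⟨fun h' => absurd h' (by simp), fun h' => WithBot.coe_injective h' ▸ h⟩
        · simp only [Set.mem_ofPred_eq]
          constructor
          · intro h; exact (h a).1 trivial
          · intro h w; exact ⟨fun _ => h, fun h' => absurd h' (by simp)⟩
      have hab := hB _ _ _ hc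
      have hbc := hB _ _ _ (S.orient.cyc hc)
      have had := hB _ _ _ (S.orient.cyc hd)
      have k3 : ∀ y z, OrTri.half a b c d y z → ((y ∈ B ↔ a ∈ B) ∧ (z ∈ B ↔ a ∈ B)) := by
        rintro y z (⟨rfl, rfl⟩ | ⟨rfl, rfl⟩ | ⟨rfl, rfl⟩ | ⟨rfl, rfl⟩)
        · exact ⟨hab.symm, (hab.trans hbc).symm⟩
        · exact ⟨had.symm, hab.symm⟩
        · exact ⟨Iff.rfl, had.symm⟩
        · exact ⟨(hab.trans hbc).symm, Iff.rfl⟩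
      have hB' : (S.orient.bisect a b c d hc hd).Closed B' := by
        rintro (_ | x) (_ | y) (_ | z) h
        · exact h.elim
        · exact h.elim
        · exact h.elim
        · exact k2.trans ((k3 y z h).1.symm.trans (k1 y).symm)
        · exact h.elim
        · exact (k1 x).trans ((k3 z x h).2.trans k2.symm)
        · exact (k1 x).trans ((k3 x y h).1.trans ((k3 x y h).2.symm.trans (k1 y).symm))
        · exact (k1 x).trans ((hB x y z h.1).trans (k1 y).symm)
      obtain ⟨y, hyA, hyB⟩ := hne
      exact (k1 x).1 (hA.2.2 B' hB' ⟨y, (hAA y).1 hyA, (k1 y).2 hyB⟩ ((hAA x).1 hx))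
  refine ⟨A, hcomp, ?_⟩
  have hcard : (A'.ncard : ℤ) = A.ncard + if a ∈ A then 1 else 0 := by
    have e : A' = (fun v : S.V => (v : WithBot S.V)) '' A ∪ {x | x = ⊥ ∧ a ∈ A} := by
      ext x
      simp only [Set.mem_union, Set.mem_image, Set.mem_ofPred_eq]
      induction x using WithBot.recBotCoe with
      | bot =>
        constructor
        · intro h; exact .inr ⟨rfl, (hAA a).2 (ha.1.2 h)⟩
        · rintro (⟨v, -, h⟩ | ⟨-, h⟩)
          · exact absurd h (by simp)
          · exact ha.1.1 ((hAA a).1 h)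
      | coe x =>
        constructor
        · intro h; exact .inl ⟨x, (hAA x).2 h, rfl⟩
        · rintro (⟨v, h, h'⟩ | ⟨h, -⟩)
          · obtain rfl : v = x := WithBot.coe_injective h'
            exact (hAA _).1 h
          · exact absurd h (by simp)
    rw [e, Set.ncard_union_eq, Set.ncard_image_of_injective _ WithBot.coe_injective]
    · by_cases haA : a ∈ A
      · simp [haA]
      · simp [haA]
    · rw [Set.disjoint_left]
      rintro _ ⟨v, -, rfl⟩ ⟨h, -⟩
      exact absurd h (by simp)
  have htri : (((S.orient.bisect a b c d hc hd).tris.filter fun t : Finset (WithBot S.V) => (t : Set (WithBot S.V)) ⊆ A').card : ℤ) =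
      (S.orient.tris.filter fun t : Finset S.V => (t : Set S.V) ⊆ A).card + if a ∈ A then 2 else 0 := by
    have h4 := OrTri.sum_tris_bisect hc hd
      (fun t => if (t : Set (WithBot S.V)) ⊆ A' then (1 : ℤ) else 0)
    have e1 : ∀ s : Finset S.V, ((OrTri.up s : Set (WithBot S.V)) ⊆ A') ↔ (s : Set S.V) ⊆ A := by
      intro s
      simp only [OrTri.up, Finset.coe_image, Set.image_subset_iff]
      exact ⟨fun h x hx => (hAA x).2 (h hx), fun h x hx => (hAA x).1 (h hx)⟩
    rw [Finset.card_filter, Finset.card_filter]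
    push_cast
    simp only [e1] at h4
    have f1 := hcl _ _ _ hc
    have f2 := hcl _ _ _ (S.orient.cyc hc)
    have f3 := hcl _ _ _ (S.orient.cyc hd)
    have g0 : (⊥ : WithBot S.V) ∈ A' ↔ a ∈ A := ha.1.symm.trans (hAA a).symm
    have g1 : ((b : WithBot S.V)) ∈ A' ↔ b ∈ A := (hAA b).symm
    have g2 : ((c : WithBot S.V)) ∈ A' ↔ c ∈ A := (hAA c).symm
    have g3 : ((d : WithBot S.V)) ∈ A' ↔ d ∈ A := (hAA d).symm
    have g4 : ((a : WithBot S.V)) ∈ A' ↔ a ∈ A := (hAA a).symm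
    by_cases haA : a ∈ A
    · have hbA := f1.1 haA
      have hcA := f2.1 hbA
      have hdA := f3.1 haA
      simp only [Finset.coe_insert, Finset.coe_singleton, Set.insert_subset_iff,
        Set.singleton_subset_iff, g0, g1, g2, g3, g4, haA, hbA, hcA, hdA, and_self, if_true] at h4 ⊢
      linarith
    · simp only [Finset.coe_insert, Finset.coe_singleton, Set.insert_subset_iff,
        Set.singleton_subset_iff, g0, haA, false_and, and_false, if_false] at h4 ⊢
      linarith
  rw [OrTri.chi2, OrTri.chi2, hcard]
  rw [htri]
  split_ifs <;> ring

lemma noSphereTorus_bisect (hc : S.orient.R a b c) (hd : S.orient.R b a d)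
    (hS : S.NoSphereTorus) : (bisectSurface hc hd).NoSphereTorus := by
  intro A' hA'
  obtain ⟨A, hA, h⟩ := exists_isComp_bisect hc hd A' ((isComp_orient_toSurface _).1 hA')
  have e : (bisectSurface hc hd).chi2 A' = S.chi2 A := h.trans (chi2_eq A).symm
  rw [e]
  exact hS A hA

end ClosedOrientedSurface

/-! ### Affine simplices and maps; coning a triangle from an interior or boundary point -/

namespace ClosedOrientedSurface

variable {S T : ClosedOrientedSurface}

/-- The points `ν i` lie in a common closed triangle. -/
def CommonFace {n : ℕ} (ν : Fin n → S.Carrier) : Prop :=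
  ∃ t ∈ S.triangles, ∀ i v, v ∉ t → (ν i).1 v = 0

/-- The affine singular simplex with the given vertices. -/
noncomputable def affMap {n : ℕ} (ν : Fin n → S.Carrier) (h : CommonFace ν) :
    C(stdSimplex ℝ (Fin n), S.Carrier) where
  toFun w := mkPt (fun v => ∑ i, w i * (ν i).1 v)
    (fun v => Finset.sum_nonneg fun i _ => mul_nonneg (w.2.1 i) ((ν i).nonneg v))
    (by
      rw [Finset.sum_comm]
      simp only [← Finset.mul_sum, Carrier.sum_eq, mul_one]
      exact w.2.2)
    (by
      obtain ⟨t, ht, h⟩ := h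
      exact ⟨t, ht, fun v hv => Finset.sum_eq_zero fun i _ => by rw [h i v hv, mul_zero]⟩)
  continuous_toFun := continuous_carrier fun v => by
    simp only [mkPt_apply]
    exact continuous_finsetSum _ fun i _ =>
      ((continuous_apply i).comp continuous_subtype_val).mul continuous_const

@[simp] lemma affMap_apply {n : ℕ} (ν : Fin n → S.Carrier) (h : CommonFace ν)
    (w : stdSimplex ℝ (Fin n)) (v : S.V) : (affMap ν h w).1 v = ∑ i, w i * (ν i).1 v := rfl

lemma affMap_map {n m : ℕ} (ν : Fin n → S.Carrier) (h : CommonFace ν) (g : Fin m → Fin n)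
    (h' : CommonFace (ν ∘ g)) (w : stdSimplex ℝ (Fin m)) :
    affMap ν h (stdSimplex.map g w) = affMap (ν ∘ g) h' w := by
  refine Carrier.ext fun v => ?_
  simp only [affMap_apply, stdSimplex.map_coe, FunOnFinite.linearMap_apply_apply, Finset.sum_mul,
    Function.comp_apply]
  rw [Finset.sum_comm' (t' := Finset.univ) (s' := fun j => {g j})]
  · simp
  · intro x y; simp [eq_comm]

/-- A map is affine on every triangle. -/
def IsAffine (h : T.Carrier → S.Carrier) : Prop :=
  ∀ y u, (h y).1 u = ∑ v, y.1 v * (h (pt v)).1 u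

lemma IsAffine.map_sum {h : T.Carrier → S.Carrier} (hh : IsAffine h) {n : ℕ}
    (ν : Fin n → T.Carrier) (hν : CommonFace ν) (w : stdSimplex ℝ (Fin n)) (u : S.V) :
    (h (affMap ν hν w)).1 u = ∑ i, w i * (h (ν i)).1 u := by
  rw [hh]
  simp only [affMap_apply, Finset.sum_mul]
  rw [Finset.sum_comm]
  refine Finset.sum_congr rfl fun i _ => ?_
  rw [hh (ν i), Finset.mul_sum]
  exact Finset.sum_congr rfl fun v _ => by ring

/-- The barycentre of the simplex goes into some triangle `t`. A coordinate outside `t` vanishes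
there, yet it is a combination with positive weights of nonnegative coordinates of the `h (ν i)`;
hence it vanishes at each of them. -/
lemma IsAffine.commonFace {h : T.Carrier → S.Carrier} (hh : IsAffine h) {n : ℕ}
    {ν : Fin (n + 1) → T.Carrier} (hν : CommonFace ν) : CommonFace (h ∘ ν) := by
  have hn : (0 : ℝ) < n + 1 := by positivity
  let w : stdSimplex ℝ (Fin (n + 1)) := ⟨fun _ => 1 / (n + 1), fun _ => by positivity, by
    simp; field_simp⟩
  obtain ⟨t, ht, hz⟩ := (h (affMap ν hν w)).2
  refine ⟨t, ht, fun i v hv => ?_⟩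
  have := hz v hv
  rw [hh.map_sum, Finset.sum_eq_zero_iff_of_nonneg] at this
  · have h1 := this i (Finset.mem_univ i)
    rcases mul_eq_zero.1 h1 with h2 | h2
    · have : (1 : ℝ) / (n + 1) = 0 := h2
      have : (0 : ℝ) < 1 / (n + 1) := by positivity
      linarith
    · exact h2
  · intro i _
    exact mul_nonneg (w.2.1 i) (Carrier.nonneg _ _)

lemma IsAffine.comp_affMap {h : C(T.Carrier, S.Carrier)} (hh : IsAffine h) {n : ℕ}
    {ν : Fin (n + 1) → T.Carrier} (hν : CommonFace ν) :
    h.comp (affMap ν hν) = affMap (h ∘ ν) (hh.commonFace hν) := by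
  ext w
  exact Carrier.ext fun u => hh.map_sum ν hν w u

lemma IsAffine.comp {U : ClosedOrientedSurface} {h : T.Carrier → S.Carrier}
    {k : U.Carrier → T.Carrier} (hh : IsAffine h) (hk : IsAffine k) : IsAffine (h ∘ k) := by
  intro y u
  simp only [Function.comp_apply]
  rw [hh]
  simp only [hk y, Finset.sum_mul]
  rw [Finset.sum_comm]
  refine Finset.sum_congr rfl fun v _ => ?_
  rw [hh (k (pt v)), Finset.mul_sum]
  exact Finset.sum_congr rfl fun w _ => by ring

section Chains

variable {X : Type u} [TopologicalSpace X]

open Classical in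
/-- The affine singular simplex with vertices `p, q, r`, mapped to `X`. -/
noncomputable def simp₃ (f : C(S.Carrier, X)) (p q r : S.Carrier) : (singularChains X).X 2 :=
  if h : CommonFace ![p, q, r] then singularSimplex (f.comp (affMap _ h)) else 0

open Classical in
/-- The summand of the fundamental chain for the triangle `t`. -/
noncomputable def signedSimplex (f : C(S.Carrier, X)) (t : Finset S.V) : (singularChains X).X 2 :=
  if h : t ∈ S.triangles then (S.sign t : ℤ) • singularSimplex (f.comp (param h)) else 0

lemma fundamentalChain_eq (f : C(S.Carrier, X)) :
    fundamentalChain f = ∑ t ∈ S.triangles, signedSimplex f t := by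
  rw [fundamentalChain, ← Finset.sum_coe_sort S.triangles]
  refine Finset.sum_congr rfl fun t _ => ?_
  rw [signedSimplex, dif_pos t.2]

lemma commonFace_pt {x y z : S.V} (ht : ({x, y, z} : Finset S.V) ∈ S.triangles) :
    CommonFace ![(pt x : S.Carrier), pt y, pt z] := by
  refine ⟨_, ht, fun i v hv => ?_⟩
  simp only [Finset.mem_insert, Finset.mem_singleton, not_or] at hv
  fin_cases i <;> simp [hv.1, hv.2.1, hv.2.2]

lemma orderEmbOfFin_eq {V : Type} [LinearOrder V] {x y z : V} (hxy : x < y) (hyz : y < z)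
    (h : ({x, y, z} : Finset V).card = 3) :
    ⇑(({x, y, z} : Finset V).orderEmbOfFin h) = ![x, y, z] := by
  symm
  apply Finset.orderEmbOfFin_unique
  · intro i; fin_cases i <;> simp
  · intro i j hij
    have := hxy.trans hyz
    fin_cases i <;> fin_cases j <;> first
      | exact absurd hij (by decide)
      | assumption

lemma param_eq {x y z : S.V} (hxy : x < y) (hyz : y < z)
    (ht : ({x, y, z} : Finset S.V) ∈ S.triangles) :
    param ht = affMap ![pt x, pt y, pt z] (commonFace_pt ht) := by
  ext w
  refine Carrier.ext fun v => ?_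
  have e : (param ht w).1 v = stdSimplex.map ![x, y, z] w v := by
    rw [← orderEmbOfFin_eq hxy hyz (S.card_triangle _ ht)]; rfl
  rw [e, stdSimplex.map_coe, FunOnFinite.linearMap_apply_apply, affMap_apply, Finset.sum_filter]
  refine Finset.sum_congr rfl fun i _ => ?_
  fin_cases i <;> simp [eq_comm] <;> congr

lemma signedSimplex_eq (f : C(S.Carrier, X)) {x y z : S.V} (hxy : x < y) (hyz : y < z)
    (ht : ({x, y, z} : Finset S.V) ∈ S.triangles) :
    signedSimplex f {x, y, z} = (S.sign {x, y, z} : ℤ) • simp₃ f (pt x) (pt y) (pt z) := by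
  rw [signedSimplex, dif_pos ht, simp₃, dif_pos (commonFace_pt ht), param_eq hxy hyz ht]

lemma exists_sorted {t : Finset S.V} (ht : t ∈ S.triangles) :
    ∃ x y z, x < y ∧ y < z ∧ t = {x, y, z} := by
  obtain ⟨x, y, z, h1, h2, h3, rfl⟩ := Finset.card_eq_three.1 (S.card_triangle t ht)
  rcases lt_or_gt_of_ne h1 with a | a <;> rcases lt_or_gt_of_ne h2 with b | b <;>
    rcases lt_or_gt_of_ne h3 with c | c
  · exact ⟨x, y, z, a, c, rfl⟩
  · exact ⟨x, z, y, b, c, by ext; simp; tauto⟩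
  · exact absurd (a.trans c) b.not_gt
  · exact ⟨z, x, y, b, a, by ext; simp; tauto⟩
  · exact ⟨y, x, z, a, b, by ext; simp; tauto⟩
  · exact absurd (b.trans c) a.not_gt
  · exact ⟨y, z, x, c, b, by ext; simp; tauto⟩
  · exact ⟨z, y, x, c, a, by ext; simp; tauto⟩

lemma simp₃_comp (f : C(S.Carrier, X)) {h : C(T.Carrier, S.Carrier)} (hh : IsAffine h)
    {p q r : T.Carrier} (hc : CommonFace ![p, q, r]) :
    simp₃ (f.comp h) p q r = simp₃ f (h p) (h q) (h r) := by
  have e : h ∘ ![p, q, r] = ![h p, h q, h r] := by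
    funext i; fin_cases i <;> rfl
  have hc' := hh.commonFace hc
  rw [e] at hc'
  rw [simp₃, dif_pos hc, simp₃, dif_pos hc', ContinuousMap.comp_assoc, hh.comp_affMap hc]
  congr! 3

/-- An affine 3-simplex squeezed into one triangle: its boundary is `pqr` minus the cone with apex
`m` over the boundary of `pqr`. -/
lemma boundary_affine (f : C(S.Carrier, X)) {m p q r : S.Carrier}
    (h : CommonFace ![m, p, q, r]) :
    ∃ e : (singularChains X).X 3, ((singularChains X).d 3 2).hom e =
      simp₃ f p q r - simp₃ f m q r + simp₃ f m p r - simp₃ f m p q := by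
  refine ⟨singularSimplex₃ (f.comp (affMap _ h)), ?_⟩
  have hface : ∀ g : Fin 3 → Fin 4, CommonFace (![m, p, q, r] ∘ g) := by
    obtain ⟨t, ht, hv⟩ := h
    exact fun g => ⟨t, ht, fun i v => hv (g i) v⟩
  have key : ∀ (i : Fin 4) (p' q' r' : S.Carrier),
      ![m, p, q, r] ∘ i.succAbove = ![p', q', r'] →
      singularSimplex ((f.comp (affMap _ h)).comp (face₃ i)) = simp₃ f p' q' r' := by
    intro i p' q' r' he
    have hc := hface i.succAbove
    have e1 : (f.comp (affMap _ h)).comp (face₃ i) = f.comp (affMap _ hc) := by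
      ext w
      exact congrArg f (affMap_map _ h _ hc w)
    rw [e1]
    have hc' := hc
    rw [he] at hc'
    rw [simp₃, dif_pos hc']
    congr! 3
  rw [d_singularSimplex₃, Fin.sum_univ_four,
    key 0 p q r (by funext i; fin_cases i <;> rfl),
    key 1 m q r (by funext i; fin_cases i <;> rfl),
    key 2 m p r (by funext i; fin_cases i <;> rfl),
    key 3 m p q (by funext i; fin_cases i <;> rfl)]
  simp [pow_succ]
  abel

/-- The cone with apex `m` over the oriented edge `(u, v)`. -/
noncomputable def coneSimplex (f : C(S.Carrier, X)) (m : S.Carrier) (u v : S.V) :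
    (singularChains X).X 2 :=
  (pairSign u v : ℤ) • simp₃ f m (pt (min u v)) (pt (max u v))

lemma coneSimplex_swap (f : C(S.Carrier, X)) (m : S.Carrier) {u v : S.V} (h : u ≠ v) :
    coneSimplex f m v u = - coneSimplex f m u v := by
  rw [coneSimplex, coneSimplex, pairSign_swap h, min_comm, max_comm]
  simp

lemma coneSimplex_of_lt (f : C(S.Carrier, X)) (m : S.Carrier) {u v : S.V} (h : u < v) :
    coneSimplex f m u v = simp₃ f m (pt u) (pt v) := by
  rw [coneSimplex, min_eq_left h.le, max_eq_right h.le, pairSign, if_pos h]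
  simp

/-- Simplices of the fundamental chain are parametrized increasingly, so orientation signs must be
matched with the vertex order. With `x` smallest only two orders remain, and for `x < z < y` the
3-simplex is taken with the opposite sign. -/
lemma boundary_cone_aux (f : C(S.Carrier, X)) {m : S.Carrier} {x y z : S.V}
    (hR : S.orient.R x y z) (hm : ∀ v, v ∉ ({x, y, z} : Finset S.V) → m.1 v = 0)
    (hxy : x < y) (hxz : x < z) :
    ∃ e : (singularChains X).X 3, ((singularChains X).d 3 2).hom e = signedSimplex f {x, y, z} -
      (coneSimplex f m x y + coneSimplex f m y z + coneSimplex f m z x) := by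
  obtain ⟨nxy, nyz, nxz⟩ := S.orient.ne' hR
  have ht : ({x, y, z} : Finset S.V) ∈ S.triangles := mem_triangles.2 ⟨_, _, _, hR, rfl⟩
  have hcf : ∀ p q r : S.V, p ∈ ({x, y, z} : Finset S.V) → q ∈ ({x, y, z} : Finset S.V) →
      r ∈ ({x, y, z} : Finset S.V) → CommonFace ![m, pt p, pt q, pt r] := by
    intro p q r hp hq hr
    refine ⟨_, ht, fun i v hv => ?_⟩
    have h1 : ∀ u ∈ ({x, y, z} : Finset S.V), v ≠ u := fun u hu h => hv (h ▸ hu)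
    fin_cases i
    · exact hm v hv
    · simp [h1 p hp]
    · simp [h1 q hq]
    · simp [h1 r hr]
  rcases lt_or_gt_of_ne nyz with h | h
  · obtain ⟨e, he⟩ := boundary_affine f (hcf x y z (by simp) (by simp) (by simp))
    refine ⟨e, ?_⟩
    rw [he, signedSimplex_eq f hxy h ht, sign_eq hR, triSign_of_lt hxy h, coneSimplex_swap f m nxz,
      coneSimplex_of_lt f m hxy, coneSimplex_of_lt f m h, coneSimplex_of_lt f m hxz]
    simp
    abel
  · obtain ⟨e, he⟩ := boundary_affine f (hcf x z y (by simp) (by simp) (by simp))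
    refine ⟨-e, ?_⟩
    have e1 : ({x, y, z} : Finset S.V) = {x, z, y} := by ext; simp; tauto
    have e2 : triSign x y z = -1 := by
      simp [triSign, pairSign, hxy, hxz, h.not_gt]
    have e3 := sign_eq hR
    rw [e2, e1] at e3
    rw [e1] at ht
    rw [map_neg, he, e1, signedSimplex_eq f hxz h ht, e3, coneSimplex_swap f m nxz,
      coneSimplex_swap f m nyz.symm, coneSimplex_of_lt f m hxy, coneSimplex_of_lt f m h,
      coneSimplex_of_lt f m hxz]
    simp
    abel

/-- A rotation of the positive triple puts the smallest vertex first, and the three cone terms are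
permuted cyclically. -/
lemma boundary_cone (f : C(S.Carrier, X)) {m : S.Carrier} {x y z : S.V}
    (hR : S.orient.R x y z) (hm : ∀ v, v ∉ ({x, y, z} : Finset S.V) → m.1 v = 0) :
    ∃ e : (singularChains X).X 3, ((singularChains X).d 3 2).hom e = signedSimplex f {x, y, z} -
      (coneSimplex f m x y + coneSimplex f m y z + coneSimplex f m z x) := by
  obtain ⟨nxy, nyz, nxz⟩ := S.orient.ne' hR
  have e1 : ({x, y, z} : Finset S.V) = {y, z, x} := by ext; simp; tauto
  have e2 : ({x, y, z} : Finset S.V) = {z, x, y} := by ext; simp; tauto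
  by_cases h1 : x < y ∧ x < z
  · exact boundary_cone_aux f hR hm h1.1 h1.2
  by_cases h2 : y < z ∧ y < x
  · obtain ⟨e, he⟩ := boundary_cone_aux f (S.orient.cyc hR) (e1 ▸ hm) h2.1 h2.2
    exact ⟨e, by rw [he, ← e1]; abel⟩
  · have h3 : z < x ∧ z < y := by
      rw [not_and_or, not_lt, not_lt] at h1 h2
      constructor
      · rcases h1 with h1 | h1
        · rcases h2 with h2 | h2
          · exact lt_of_le_of_ne (h2.trans h1) nxz.symm
          · exact absurd (le_antisymm h2 h1) nxy
        · exact lt_of_le_of_ne h1 nxz.symm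
      · rcases h2 with h2 | h2
        · exact lt_of_le_of_ne h2 nyz.symm
        · rcases h1 with h1 | h1
          · exact absurd (le_antisymm h2 h1) nxy
          · exact lt_of_le_of_ne (h1.trans h2) nyz.symm
    obtain ⟨e, he⟩ := boundary_cone_aux f (S.orient.cyc (S.orient.cyc hR)) (e2 ▸ hm) h3.1 h3.2
    exact ⟨e, by rw [he, ← e2]; abel⟩

end Chains

end ClosedOrientedSurface

/-! ### Bisection of an edge: realization and fundamental class -/

namespace ClosedOrientedSurface

variable {S : ClosedOrientedSurface} {a b c d : S.V}

lemma bisect_sum (hc : S.orient.R a b c) (hd : S.orient.R b a d)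
    (y : (bisectSurface hc hd).Carrier) :
    y.1 (⊥ : WithBot S.V) + ∑ v : S.V, y.1 (v : WithBot S.V) = 1 := by
  have h : ∑ x : WithBot S.V, y.1 x = 1 := y.sum_eq
  exact (sum_withBot _).symm.trans h

/-- A point of the bisected surface lies in a triangle of the original one. -/
lemma bisect_face (hc : S.orient.R a b c) (hd : S.orient.R b a d)
    (y : (bisectSurface hc hd).Carrier) :
    (∃ s ∈ S.triangles, (∀ v, v ∉ s → y.1 (v : WithBot S.V) = 0) ∧
      (y.1 (⊥ : WithBot S.V) ≠ 0 → a ∈ s ∧ b ∈ s)) ∧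
    (y.1 (a : WithBot S.V) = 0 ∨ y.1 (b : WithBot S.V) = 0) := by
  obtain ⟨hab, hbc, hac⟩ := S.orient.ne' hc
  obtain ⟨-, had, hbd⟩ := S.orient.ne' hd
  obtain ⟨t, ht, hy⟩ := y.2
  rcases (OrTri.mem_tris_bisect hc hd).1 ht with ⟨s, hs, h1, h2, rfl⟩ | ⟨p, q, h, rfl⟩
  · rw [tris_orient] at hs
    have hy' : ∀ v, v ∉ s → y.1 (v : WithBot S.V) = 0 := fun v hv =>
      hy (v : WithBot S.V) (fun h => hv (OrTri.mem_up.1 h))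
    refine ⟨⟨s, hs, hy', fun h => absurd (hy (⊥ : WithBot S.V) OrTri.bot_notMem_up) h⟩, ?_⟩
    by_contra hcon
    rw [not_or] at hcon
    have ha : a ∈ s := by by_contra h; exact hcon.1 (hy' a h)
    have hb : b ∈ s := by by_contra h; exact hcon.2 (hy' b h)
    have := (triangles_above_edge hc hd).1 ⟨hs, by
      intro x; simp only [Finset.mem_insert, Finset.mem_singleton]; rintro (rfl | rfl) <;> assumption⟩
    simp only [Finset.mem_insert, Finset.mem_singleton] at this
    tauto
  · have hy' : ∀ v, v ≠ p → v ≠ q → y.1 (v : WithBot S.V) = 0 := fun v hp hq =>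
      hy (v : WithBot S.V) (fun h => by
        have h' : (v : WithBot S.V) ∈ ({⊥, (p : WithBot S.V), (q : WithBot S.V)} : Finset (WithBot S.V)) := h
        simp at h'
        tauto)
    rcases h with ⟨rfl, rfl⟩ | ⟨rfl, rfl⟩ | ⟨rfl, rfl⟩ | ⟨rfl, rfl⟩
    · exact ⟨⟨_, mem_triangles.2 ⟨_, _, _, hc, rfl⟩, fun v hv => hy' v (by simp at hv; tauto)
        (by simp at hv; tauto), by simp⟩, .inl (hy' _ hab hac)⟩
    · exact ⟨⟨_, mem_triangles.2 ⟨_, _, _, hd, rfl⟩, fun v hv => hy' v (by simp at hv; tauto)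
        (by simp at hv; tauto), by simp⟩, .inl (hy' _ had hab)⟩
    · exact ⟨⟨_, mem_triangles.2 ⟨_, _, _, hd, rfl⟩, fun v hv => hy' v (by simp at hv; tauto)
        (by simp at hv; tauto), by simp⟩, .inr (hy' _ hab.symm hbd)⟩
    · exact ⟨⟨_, mem_triangles.2 ⟨_, _, _, hc, rfl⟩, fun v hv => hy' v (by simp at hv; tauto)
        (by simp at hv; tauto), by simp⟩, .inr (hy' _ hbc hab.symm)⟩

/-- The affine map from the bisected surface. -/
noncomputable def bisectFwd (hc : S.orient.R a b c) (hd : S.orient.R b a d)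
    (y : (bisectSurface hc hd).Carrier) : S.Carrier :=
  mkPt (fun u => y.1 (u : WithBot S.V) + if u = a ∨ u = b then y.1 (⊥ : WithBot S.V) / 2 else 0)
    (fun u => by
      have h1 := y.nonneg (u : WithBot S.V)
      have h2 := y.nonneg (⊥ : WithBot S.V)
      split_ifs <;> linarith)
    (by
      have e : ∑ u : S.V, (if u = a ∨ u = b then y.1 (⊥ : WithBot S.V) / 2 else 0) =
          y.1 (⊥ : WithBot S.V) := by
        rw [← Finset.sum_filter]
        have : (Finset.univ.filter fun u => u = a ∨ u = b) = {a, b} := by ext; simp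
        rw [this, Finset.sum_pair hc.1]
        ring
      rw [Finset.sum_add_distrib, e, add_comm, bisect_sum])
    (by
      obtain ⟨⟨s, hs, h1, h2⟩, -⟩ := bisect_face hc hd y
      refine ⟨s, hs, fun v hv => ?_⟩
      rw [h1 v hv, zero_add]
      split_ifs with h
      · by_contra h3
        have h4 := h2 (by intro h0; rw [h0] at h3; simp at h3)
        rcases h with rfl | rfl
        · exact hv h4.1
        · exact hv h4.2
      · rfl)

lemma bisectFwd_apply (hc : S.orient.R a b c) (hd : S.orient.R b a d)
    (y : (bisectSurface hc hd).Carrier) (u : S.V) : (bisectFwd hc hd y).1 u =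
      y.1 (u : WithBot S.V) + if u = a ∨ u = b then y.1 (⊥ : WithBot S.V) / 2 else 0 := rfl

/-- Barycentric coordinates with respect to the bisected triangulation. -/
noncomputable def bisectCoord (a b : S.V) (x : S.Carrier) (p : WithBot S.V) : ℝ :=
  -- The midpoint is (a + b)/2, so weight 2 min there takes min away from both `a` and `b` and
  -- leaves weight zero at one of them.
  WithBot.recBotCoe (2 * min (x.1 a) (x.1 b))
    (fun u => x.1 u - if u = a ∨ u = b then min (x.1 a) (x.1 b) else 0) p

/-- The smaller of the coordinates at `a` and `b` becomes zero, and this decides in which half of a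
bisected triangle the point lies. In a triangle without the edge `ab` the minimum is zero already
and nothing changes. -/
lemma bisectCoord_support (hc : S.orient.R a b c) (hd : S.orient.R b a d) (x : S.Carrier) :
    ∃ t ∈ (bisectSurface hc hd).triangles, ∀ p : WithBot S.V, p ∉ t → bisectCoord a b x p = 0 := by
  obtain ⟨hab, hbc, hac⟩ := S.orient.ne' hc
  obtain ⟨-, had, hbd⟩ := S.orient.ne' hd
  have hcd : c ≠ d := by rintro rfl; exact S.orient.not_swap hc hd
  obtain ⟨s, hs, hx⟩ := x.2
  by_cases habs : a ∈ s ∧ b ∈ s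
  · have := (triangles_above_edge hc hd).1 ⟨hs, by
      intro x; simp only [Finset.mem_insert, Finset.mem_singleton]
      rintro (rfl | rfl)
      · exact habs.1
      · exact habs.2⟩
    simp only [Finset.mem_insert, Finset.mem_singleton] at this
    have key : ∀ p q : S.V, OrTri.half a b c d p q →
        (∀ v, v ≠ p → v ≠ q → bisectCoord a b x (v : WithBot S.V) = 0) →
        ∃ t ∈ (bisectSurface hc hd).triangles, ∀ p : WithBot S.V, p ∉ t → bisectCoord a b x p = 0 := by
      intro p q h hz
      refine ⟨({⊥, (p : WithBot S.V), (q : WithBot S.V)} : Finset (WithBot S.V)),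
        (OrTri.mem_tris_bisect hc hd).2 (.inr ⟨p, q, h, rfl⟩), fun r hr => ?_⟩
      replace hr : r ∉ ({⊥, (p : WithBot S.V), (q : WithBot S.V)} : Finset (WithBot S.V)) := hr
      simp only [Finset.mem_insert, Finset.mem_singleton, not_or] at hr
      induction r using WithBot.recBotCoe with
      | bot => exact absurd rfl hr.1
      | coe v => exact hz v (fun h => hr.2.1 (congrArg _ h)) (fun h => hr.2.2 (congrArg _ h))
    have hca : x.1 a ≤ x.1 b → bisectCoord a b x (a : WithBot S.V) = 0 := by
      intro h; simp [bisectCoord, min_eq_left h]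
    have hcb : x.1 b ≤ x.1 a → bisectCoord a b x (b : WithBot S.V) = 0 := by
      intro h; simp [bisectCoord, min_eq_right h]
    have hcv : ∀ v, v ≠ a → v ≠ b → bisectCoord a b x (v : WithBot S.V) = x.1 v := by
      intro v h1 h2
      change x.1 v - (if v = a ∨ v = b then _ else _) = _
      rw [if_neg (by tauto), sub_zero]
    rcases this with rfl | rfl <;> rcases le_total (x.1 a) (x.1 b) with hle | hle
    · refine key b c (.inl ⟨rfl, rfl⟩) fun v h1 h2 => ?_
      by_cases h3 : v = a
      · rw [h3, hca hle]
      · rw [hcv v h3 h1, hx v (by simp; tauto)]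
    · refine key c a (.inr (.inr (.inr ⟨rfl, rfl⟩))) fun v h1 h2 => ?_
      by_cases h3 : v = b
      · rw [h3, hcb hle]
      · rw [hcv v h2 h3, hx v (by simp; tauto)]
    · refine key d b (.inr (.inl ⟨rfl, rfl⟩)) fun v h1 h2 => ?_
      by_cases h3 : v = a
      · rw [h3, hca hle]
      · rw [hcv v h3 h2, hx v (by simp; tauto)]
    · refine key a d (.inr (.inr (.inl ⟨rfl, rfl⟩))) fun v h1 h2 => ?_
      by_cases h3 : v = b
      · rw [h3, hcb hle]
      · rw [hcv v h1 h3, hx v (by simp; tauto)]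
  · have hmin : min (x.1 a) (x.1 b) = 0 := by
      rw [not_and_or] at habs
      rcases habs with h | h
      · rw [hx a h]; exact min_eq_left (x.nonneg b)
      · rw [hx b h]; exact min_eq_right (x.nonneg a)
    refine ⟨OrTri.up s, (OrTri.mem_tris_bisect hc hd).2 (.inl ⟨s, by rwa [tris_orient], ?_, ?_, rfl⟩),
      fun r hr => ?_⟩
    · rintro rfl; exact habs (by simp)
    · rintro rfl; exact habs (by simp)
    · induction r using WithBot.recBotCoe with
      | bot => simp [bisectCoord, hmin]
      | coe v => simp [bisectCoord, hmin, hx v (fun h => hr (OrTri.mem_up.2 h))]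

/-- The inverse of the affine map from the bisected surface. -/
noncomputable def bisectInv (hc : S.orient.R a b c) (hd : S.orient.R b a d)
    (x : S.Carrier) : (bisectSurface hc hd).Carrier :=
  mkPt (S := bisectSurface hc hd) (bisectCoord a b x)
    (fun p => by
      have h1 : 0 ≤ min (x.1 a) (x.1 b) := le_min (x.nonneg a) (x.nonneg b)
      change 0 ≤ bisectCoord a b x (p : WithBot S.V)
      induction p using WithBot.recBotCoe with
      | bot => simp [bisectCoord, x.nonneg]
      | coe v =>
        simp only [bisectCoord, WithBot.recBotCoe_coe]
        split_ifs with h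
        · rcases h with rfl | rfl
          · exact sub_nonneg.2 (min_le_left _ _)
          · exact sub_nonneg.2 (min_le_right _ _)
        · simp [x.nonneg])
    (by
      have e : ∑ u : S.V, (if u = a ∨ u = b then min (x.1 a) (x.1 b) else 0) =
          2 * min (x.1 a) (x.1 b) := by
        rw [← Finset.sum_filter]
        have : (Finset.univ.filter fun u => u = a ∨ u = b) = {a, b} := by ext; simp
        rw [this, Finset.sum_pair hc.1]
        ring
      have h : ∑ p : WithBot S.V, bisectCoord a b x p = 1 := by
        rw [sum_withBot]
        simp only [bisectCoord, WithBot.recBotCoe_coe, WithBot.recBotCoe_bot]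
        rw [Finset.sum_sub_distrib, e, x.sum_eq]
        ring
      exact h)
    (bisectCoord_support hc hd x)

/-- The bisected surface is homeomorphic to the original one. -/
noncomputable def bisectHomeo (hc : S.orient.R a b c) (hd : S.orient.R b a d) :
    (bisectSurface hc hd).Carrier ≃ₜ S.Carrier where
  toFun := bisectFwd hc hd
  invFun := bisectInv hc hd
  left_inv y := by
    have hmin : min ((bisectFwd hc hd y).1 a) ((bisectFwd hc hd y).1 b) =
        y.1 (⊥ : WithBot S.V) / 2 := by
      have ha := y.nonneg (a : WithBot S.V)
      have hb := y.nonneg (b : WithBot S.V)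
      rw [bisectFwd_apply, bisectFwd_apply, if_pos (.inl rfl), if_pos (.inr rfl)]
      rcases (bisect_face hc hd y).2 with h | h
      · rw [h, min_eq_left (by linarith)]; ring
      · rw [h, min_eq_right (by linarith)]; ring
    refine Carrier.ext fun p => ?_
    change bisectCoord a b (bisectFwd hc hd y) (p : WithBot S.V) = y.1 (p : WithBot S.V)
    induction p using WithBot.recBotCoe with
    | bot =>
      simp only [bisectCoord, WithBot.recBotCoe_bot]
      rw [hmin]; ring
    | coe v =>
      simp only [bisectCoord, WithBot.recBotCoe_coe]
      rw [hmin, bisectFwd_apply]; ring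
  right_inv x := by
    refine Carrier.ext fun u => ?_
    rw [bisectFwd_apply]
    change bisectCoord a b x u + (if u = a ∨ u = b then bisectCoord a b x ⊥ / 2 else 0) = x.1 u
    simp only [bisectCoord, WithBot.recBotCoe_coe, WithBot.recBotCoe_bot]
    split_ifs <;> ring
  continuous_toFun := continuous_carrier fun u => by
    simp only [bisectFwd_apply]
    have h1 := continuous_coord (S := bisectSurface hc hd) (u : WithBot S.V)
    have h2 := continuous_coord (S := bisectSurface hc hd) (⊥ : WithBot S.V)
    split_ifs
    · exact h1.add (h2.div_const 2)
    · exact h1.add continuous_const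
  continuous_invFun := continuous_carrier fun p => by
    change Continuous fun x => bisectCoord a b x (p : WithBot S.V)
    have ha := continuous_coord (S := S) a
    have hb := continuous_coord (S := S) b
    induction p using WithBot.recBotCoe with
    | bot =>
      simp only [bisectCoord, WithBot.recBotCoe_bot]
      exact continuous_const.mul (ha.min hb)
    | coe v =>
      simp only [bisectCoord, WithBot.recBotCoe_coe]
      split_ifs
      · exact (continuous_coord v).sub (ha.min hb)
      · exact (continuous_coord v).sub continuous_const

lemma bisectHomeo_apply (hc : S.orient.R a b c) (hd : S.orient.R b a d)
    (y : (bisectSurface hc hd).Carrier) (u : S.V) : (bisectHomeo hc hd y).1 u =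
      y.1 (u : WithBot S.V) + if u = a ∨ u = b then y.1 (⊥ : WithBot S.V) / 2 else 0 := rfl

lemma bisectHomeo_pt (hc : S.orient.R a b c) (hd : S.orient.R b a d) (v : S.V) :
    bisectHomeo hc hd (pt (S := bisectSurface hc hd) (v : WithBot S.V)) = pt v := by
  refine Carrier.ext fun u => ?_
  have h1 := pt_apply (S := bisectSurface hc hd) (⊥ : WithBot S.V) (v : WithBot S.V)
  have h2 := pt_apply (S := bisectSurface hc hd) (u : WithBot S.V) (v : WithBot S.V)
  replace h1 := h1.trans (if_neg WithBot.bot_ne_coe)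
  have h3 : (if (u : WithBot S.V) = (v : WithBot S.V) then (1 : ℝ) else 0) =
      if u = v then 1 else 0 := by simp
  refine (bisectHomeo_apply hc hd _ u).trans ?_
  rw [pt_apply]
  refine (congrArg₂ (fun s t : ℝ => s + if u = a ∨ u = b then t / 2 else 0)
    (h2.trans (Eq.trans (by congr) h3)) h1).trans ?_
  simp

lemma bisectHomeo_mid (hc : S.orient.R a b c) (hd : S.orient.R b a d) (u : S.V) :
    (bisectHomeo hc hd (pt (S := bisectSurface hc hd) (⊥ : WithBot S.V))).1 u =
      if u = a ∨ u = b then 1 / 2 else 0 := by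
  have h1 := pt_apply (S := bisectSurface hc hd) (⊥ : WithBot S.V) (⊥ : WithBot S.V)
  have h2 := pt_apply (S := bisectSurface hc hd) (u : WithBot S.V) (⊥ : WithBot S.V)
  replace h2 := h2.trans (if_neg WithBot.coe_ne_bot)
  replace h1 := h1.trans (if_pos rfl)
  refine (bisectHomeo_apply hc hd _ u).trans ?_
  refine (congrArg₂ (fun s t : ℝ => s + if u = a ∨ u = b then t / 2 else 0) h2 h1).trans ?_
  simp

lemma isAffine_bisectHomeo (hc : S.orient.R a b c) (hd : S.orient.R b a d) :
    IsAffine (bisectHomeo hc hd) := by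
  intro y u
  have e : ∑ p : WithBot S.V, y.1 p * (bisectHomeo hc hd (pt (S := bisectSurface hc hd) p)).1 u =
      (bisectHomeo hc hd y).1 u := by
    rw [sum_withBot, bisectHomeo_mid]
    simp only [bisectHomeo_pt, pt_apply]
    rw [bisectHomeo_apply]
    simp
    split_ifs <;> ring
  exact e.symm

section Chains

variable {X : Type u} [TopologicalSpace X]

lemma signedSimplex_comp {T : ClosedOrientedSurface} (f : C(S.Carrier, X))
    {h : C(T.Carrier, S.Carrier)} (hh : IsAffine h) {x y z : T.V} (hxy : x < y) (hyz : y < z)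
    (ht : ({x, y, z} : Finset T.V) ∈ T.triangles) {p q r : S.Carrier} {ε : ℤˣ}
    (hp : h (pt x) = p) (hq : h (pt y) = q) (hr : h (pt z) = r)
    (hε : T.sign {x, y, z} = ε) :
    signedSimplex (f.comp h) {x, y, z} = (ε : ℤ) • simp₃ f p q r := by
  subst hp hq hr hε
  rw [signedSimplex_eq _ hxy hyz ht, simp₃_comp f hh (commonFace_pt ht)]

/-- The inclusion into `WithBot` preserves the order, and the homeomorphism carries old vertices to
themselves, so an untouched triangle contributes the same simplex with the same sign. -/
lemma bisect_signed_up (hc : S.orient.R a b c) (hd : S.orient.R b a d) (f : C(S.Carrier, X))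
    {s : Finset S.V} (hs : s ∈ S.triangles) (h1 : s ≠ {a, b, c}) (h2 : s ≠ {b, a, d}) :
    signedSimplex (S := bisectSurface hc hd) (f.comp (bisectHomeo hc hd)) (OrTri.up s) =
      signedSimplex f s := by
  have hup : OrTri.up s ∈ (bisectSurface hc hd).triangles :=
    (OrTri.mem_tris_bisect hc hd).2 (.inl ⟨s, by rwa [tris_orient], h1, h2, rfl⟩)
  have hsign : (bisectSurface hc hd).sign (OrTri.up s) = S.sign s := by
    obtain ⟨x, y, z, hR, rfl⟩ := mem_triangles.1 hs
    have hR' : (S.orient.bisect a b c d hc hd).R x y z := by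
      refine ⟨hR, fun hab => ?_⟩
      have := (triangles_above_edge hc hd (t := {x, y, z})).1 ⟨hs, by
        intro w; simp only [Finset.mem_insert, Finset.mem_singleton]
        rintro (rfl | rfl)
        · exact hab.1
        · exact hab.2⟩
      simp only [Finset.mem_insert, Finset.mem_singleton] at this
      tauto
    have e : OrTri.up ({x, y, z} : Finset S.V) = {(x : WithBot S.V), (y : WithBot S.V), (z : WithBot S.V)} := by
      simp [OrTri.up]
    have h3 := OrTri.sgn_eq _ hR'
    rw [← e] at h3
    rw [sign_eq hR]
    refine h3.trans ?_
    simp [triSign, pairSign]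
  obtain ⟨x, y, z, hxy, hyz, rfl⟩ := exists_sorted hs
  have e : OrTri.up ({x, y, z} : Finset S.V) = {(x : WithBot S.V), (y : WithBot S.V), (z : WithBot S.V)} := by
    simp [OrTri.up]
  rw [e] at hup hsign ⊢
  exact (signedSimplex_comp (T := bisectSurface hc hd) f (isAffine_bisectHomeo hc hd)
    (WithBot.coe_lt_coe.2 hxy) (WithBot.coe_lt_coe.2 hyz) hup (bisectHomeo_pt hc hd _)
    (bisectHomeo_pt hc hd _) (bisectHomeo_pt hc hd _) hsign).trans
    (signedSimplex_eq f hxy hyz hs).symm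

/-- The midpoint is `⊥`, the smallest vertex, so the increasing parametrization of a half starts
there. Its summand is therefore exactly a cone term, which has the apex first. -/
lemma bisect_signed_half (hc : S.orient.R a b c) (hd : S.orient.R b a d) (f : C(S.Carrier, X))
    {y z : S.V} (h : OrTri.half a b c d y z) :
    signedSimplex (S := bisectSurface hc hd) (f.comp (bisectHomeo hc hd))
      ({⊥, (y : WithBot S.V), (z : WithBot S.V)} : Finset (WithBot S.V)) =
    coneSimplex f (bisectHomeo hc hd (pt (S := bisectSurface hc hd) (⊥ : WithBot S.V))) y z := by
  have hR : (S.orient.bisect a b c d hc hd).R ⊥ y z := h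
  have hne := (S.orient.bisect a b c d hc hd).ne' hR
  have hyz : y ≠ z := fun h => hne.2.1 (congrArg _ h)
  have hsgn := OrTri.sgn_eq _ hR
  have ht : ({⊥, (y : WithBot S.V), (z : WithBot S.V)} : Finset (WithBot S.V)) ∈
      (bisectSurface hc hd).triangles := (OrTri.mem_tris_bisect hc hd).2 (.inr ⟨y, z, h, rfl⟩)
  rcases lt_or_gt_of_ne hyz with hlt | hlt
  · have e2 : (bisectSurface hc hd).sign ({⊥, (y : WithBot S.V), (z : WithBot S.V)} : Finset (WithBot S.V)) = 1 :=
      hsgn.trans (triSign_of_lt (WithBot.bot_lt_coe y) (WithBot.coe_lt_coe.2 hlt))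
    have e1 := signedSimplex_comp (T := bisectSurface hc hd)
      (h := (bisectHomeo hc hd : C((bisectSurface hc hd).Carrier, S.Carrier))) f
      (isAffine_bisectHomeo hc hd)
      (WithBot.bot_lt_coe y) (WithBot.coe_lt_coe.2 hlt) ht rfl (bisectHomeo_pt hc hd _)
      (bisectHomeo_pt hc hd _) e2
    rw [coneSimplex_of_lt _ _ hlt]
    exact e1.trans (by simp)
  · have e0 : ({⊥, (y : WithBot S.V), (z : WithBot S.V)} : Finset (WithBot S.V)) =
        {⊥, (z : WithBot S.V), (y : WithBot S.V)} := by ext; simp; tauto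
    have e2 : (bisectSurface hc hd).sign ({⊥, (y : WithBot S.V), (z : WithBot S.V)} : Finset (WithBot S.V)) = -1 := by
      refine hsgn.trans ?_
      simp [triSign, pairSign, hlt.not_gt]
    rw [e0] at ht e2 ⊢
    have e1 := signedSimplex_comp (T := bisectSurface hc hd)
      (h := (bisectHomeo hc hd : C((bisectSurface hc hd).Carrier, S.Carrier))) f
      (isAffine_bisectHomeo hc hd)
      (WithBot.bot_lt_coe z) (WithBot.coe_lt_coe.2 hlt) ht rfl (bisectHomeo_pt hc hd _)
      (bisectHomeo_pt hc hd _) e2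
    rw [coneSimplex_swap _ _ hyz.symm, coneSimplex_of_lt _ _ hlt]
    exact e1.trans (by simp)

/-- Up to a boundary, each bisected triangle is the sum of the cones from the midpoint over its
three sides. The two cones over `ab` occur with opposite signs and cancel; the other four are the
halves. -/
lemma represents_bisect (hc : S.orient.R a b c) (hd : S.orient.R b a d) (f : C(S.Carrier, X))
    {α : H2 X} (h : Represents f α) :
    Represents (S := bisectSurface hc hd) (f.comp (bisectHomeo hc hd)) α := by
  obtain ⟨hab, hbc, hac⟩ := S.orient.ne' hc
  obtain ⟨-, had, hbd⟩ := S.orient.ne' hd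
  set m := bisectHomeo hc hd (pt (S := bisectSurface hc hd) (⊥ : WithBot S.V)) with hm
  have hm1 : ∀ v, v ∉ ({a, b, c} : Finset S.V) → m.1 v = 0 := by
    intro v hv
    rw [hm, bisectHomeo_mid, if_neg]
    simp at hv; tauto
  have hm2 : ∀ v, v ∉ ({b, a, d} : Finset S.V) → m.1 v = 0 := by
    intro v hv
    rw [hm, bisectHomeo_mid, if_neg]
    simp at hv; tauto
  obtain ⟨e₁, he₁⟩ := boundary_cone f hc hm1
  obtain ⟨e₂, he₂⟩ := boundary_cone f hd hm2
  have m1 : ({a, b, c} : Finset S.V) ∈ S.triangles := mem_triangles.2 ⟨_, _, _, hc, rfl⟩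
  have m2 : ({b, a, d} : Finset S.V) ∈ S.triangles.erase {a, b, c} :=
    Finset.mem_erase.2 ⟨(above_edge_ne hc hd).symm, mem_triangles.2 ⟨_, _, _, hd, rfl⟩⟩
  have hsum := OrTri.sum_tris_bisect hc hd
    (signedSimplex (S := bisectSurface hc hd) (f.comp (bisectHomeo hc hd)))
  rw [tris_orient, ← Finset.add_sum_erase _ _ m1, ← Finset.add_sum_erase _ _ m2,
    Finset.sum_congr rfl (g := signedSimplex f),
    bisect_signed_half hc hd f (.inl ⟨rfl, rfl⟩),
    bisect_signed_half hc hd f (.inr (.inl ⟨rfl, rfl⟩)),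
    bisect_signed_half hc hd f (.inr (.inr (.inl ⟨rfl, rfl⟩))),
    bisect_signed_half hc hd f (.inr (.inr (.inr ⟨rfl, rfl⟩)))] at hsum
  · have hT : fundamentalChain (S := bisectSurface hc hd) (f.comp (bisectHomeo hc hd)) =
        ∑ t ∈ (S.orient.bisect a b c d hc hd).tris,
          signedSimplex (S := bisectSurface hc hd) (f.comp (bisectHomeo hc hd)) t :=
      fundamentalChain_eq _
    have hS := fundamentalChain_eq f
    rw [← Finset.add_sum_erase _ _ m1, ← Finset.add_sum_erase _ _ m2] at hS
    have key : fundamentalChain (S := bisectSurface hc hd) (f.comp (bisectHomeo hc hd)) =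
        fundamentalChain f + ((singularChains X).d 3 2).hom (- (e₁ + e₂)) := by
      rw [hT, hS, map_neg, map_add, he₁, he₂, coneSimplex_swap f m hab]
      rw [add_assoc, ← eq_sub_iff_add_eq] at hsum
      rw [hsum]
      abel
    have := ChainRep.add_boundary h (- (e₁ + e₂))
    rw [← key] at this
    exact this
  · intro s hs
    rw [Finset.mem_erase, Finset.mem_erase] at hs
    exact bisect_signed_up hc hd f hs.2.2 hs.2.1 hs.1

end Chains

end ClosedOrientedSurface

/-! ### Refinements of arbitrarily small mesh -/

namespace ClosedOrientedSurface

/-- The squared Euclidean distance of barycentric coordinates. -/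
noncomputable def sqDist {S : ClosedOrientedSurface} (p q : S.Carrier) : ℝ :=
  ∑ w, (p.1 w - q.1 w) ^ 2

/-- A surface with an affine homeomorphism to `S`. -/
structure Refinement (S : ClosedOrientedSurface) where
  /-- The refined surface. -/
  T : ClosedOrientedSurface
  /-- The homeomorphism to the original surface. -/
  h : T.Carrier ≃ₜ S.Carrier
  affine : IsAffine h
  euler : T.eulerChar = S.eulerChar
  noSphereTorus : S.NoSphereTorus → T.NoSphereTorus
  represents : ∀ {X : Type u} [TopologicalSpace X] (f : C(S.Carrier, X)) {α : H2 X},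
    Represents f α → Represents (f.comp (h : C(T.Carrier, S.Carrier))) α

namespace Refinement

variable {S : ClosedOrientedSurface}

/-- The trivial refinement. -/
noncomputable def refl (S : ClosedOrientedSurface) : Refinement.{u} S where
  T := S
  h := .refl _
  affine := fun y u => by simp
  euler := rfl
  noSphereTorus := id
  represents := fun f _ h => h

/-- All edges have squared length at most `K`. -/
def MeshLE (Q : Refinement.{u} S) (K : ℝ) : Prop :=
  ∀ a b c, Q.T.orient.R a b c → sqDist (Q.h (pt a)) (Q.h (pt b)) ≤ K

/-- The oriented edges of squared length larger than `K`. -/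
def long (Q : Refinement.{u} S) (K : ℝ) : Set (Q.T.V × Q.T.V) :=
  {e | (∃ c, Q.T.orient.R e.1 e.2 c) ∧ K < sqDist (Q.h (pt e.1)) (Q.h (pt e.2))}

variable (Q : Refinement.{u} S) {a b c d : Q.T.V}

/-- Bisection of a refinement. -/
noncomputable def bisect (hc : Q.T.orient.R a b c) (hd : Q.T.orient.R b a d) :
    Refinement.{u} S where
  T := bisectSurface hc hd
  h := (bisectHomeo hc hd).trans Q.h
  affine := Q.affine.comp (isAffine_bisectHomeo hc hd)
  euler := (eulerChar_bisect hc hd).trans Q.euler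
  noSphereTorus := fun h => noSphereTorus_bisect hc hd (Q.noSphereTorus h)
  represents := fun f α h => by
    have h1 := represents_bisect hc hd _ (Q.represents f h)
    have e : f.comp ((bisectHomeo hc hd).trans Q.h : C((bisectSurface hc hd).Carrier, S.Carrier)) =
        (f.comp (Q.h : C(Q.T.Carrier, S.Carrier))).comp
          (bisectHomeo hc hd : C((bisectSurface hc hd).Carrier, Q.T.Carrier)) := rfl
    rw [e]
    exact h1

lemma bisect_h_coe (hc : Q.T.orient.R a b c) (hd : Q.T.orient.R b a d) (v : Q.T.V) :
    (Q.bisect hc hd).h (pt (S := bisectSurface hc hd) (v : WithBot Q.T.V)) = Q.h (pt v) :=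
  congrArg Q.h (bisectHomeo_pt hc hd v)

lemma bisect_h_bot (hc : Q.T.orient.R a b c) (hd : Q.T.orient.R b a d) (w : S.V) :
    ((Q.bisect hc hd).h (pt (S := bisectSurface hc hd) (⊥ : WithBot Q.T.V))).1 w =
      ((Q.h (pt a)).1 w + (Q.h (pt b)).1 w) / 2 := by
  refine (Q.affine (bisectHomeo hc hd
    (pt (S := bisectSurface hc hd) (⊥ : WithBot Q.T.V))) w).trans ?_
  simp only [bisectHomeo_mid, ite_mul, zero_mul]
  rw [← Finset.sum_filter]
  have : (Finset.univ.filter fun u => u = a ∨ u = b) = {a, b} := by ext; simp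
  rw [this, Finset.sum_pair hc.1]
  ring

lemma sqDist_comm (p q : S.Carrier) : sqDist p q = sqDist q p :=
  Finset.sum_congr rfl fun _ _ => by ring

lemma sqDist_mid {m p q : S.Carrier} (hm : ∀ w, m.1 w = (p.1 w + q.1 w) / 2) (r : S.Carrier) :
    sqDist m r = sqDist p r / 2 + sqDist q r / 2 - sqDist p q / 4 := by
  simp only [sqDist, Finset.sum_div, ← Finset.sum_add_distrib, ← Finset.sum_sub_distrib]
  refine Finset.sum_congr rfl fun w _ => ?_
  rw [hm]; ring

lemma sqDist_self (p : S.Carrier) : sqDist p p = 0 := by simp [sqDist]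

lemma sqDist_nonneg (p q : S.Carrier) : 0 ≤ sqDist p q :=
  Finset.sum_nonneg fun _ _ => sq_nonneg _

/-- The edges of a bisection are halves of old edges, medians, or old edges. -/
lemma bisect_edge (hc : Q.T.orient.R a b c) (hd : Q.T.orient.R b a d)
    (hmax : ∀ x y z, Q.T.orient.R x y z →
      sqDist (Q.h (pt x)) (Q.h (pt y)) ≤ sqDist (Q.h (pt a)) (Q.h (pt b)))
    {p q r : WithBot Q.T.V} (h : (Q.T.orient.bisect a b c d hc hd).R p q r) :
    sqDist ((Q.bisect hc hd).h (pt (S := bisectSurface hc hd) p))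
      ((Q.bisect hc hd).h (pt (S := bisectSurface hc hd) q)) ≤
        3 / 4 * sqDist (Q.h (pt a)) (Q.h (pt b)) ∨
    ∃ x y : Q.T.V, p = x ∧ q = y ∧ (∃ z, Q.T.orient.R x y z) ∧ (x, y) ≠ (a, b) := by
  have c1 := Q.T.orient.cyc hc
  have d1 := Q.T.orient.cyc hd
  obtain ⟨hab, hbc, hac⟩ := Q.T.orient.ne' hc
  obtain ⟨-, had, hbd⟩ := Q.T.orient.ne' hd
  -- Let L be the squared length of `ab`, the largest one. By the median formula `sqDist_mid` a
  -- median has squared length at most L/2 + L/2 - L/4, and half of `ab` has L/4.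
  have key : ∀ v, (v = a ∨ v = b ∨ v = c ∨ v = d) →
      sqDist ((Q.bisect hc hd).h (pt (S := bisectSurface hc hd) (⊥ : WithBot Q.T.V)))
        (Q.h (pt v)) ≤ 3 / 4 * sqDist (Q.h (pt a)) (Q.h (pt b)) := by
    intro v hv
    rw [sqDist_mid (Q.bisect_h_bot hc hd)]
    have h0 := sqDist_nonneg (Q.h (pt a)) (Q.h (pt b))
    rcases hv with rfl | rfl | rfl | rfl
    · rw [sqDist_self, sqDist_comm (Q.h (pt b))]; linarith
    · rw [sqDist_self]; linarith
    · have h1 := hmax _ _ _ c1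
      have h2 := hmax _ _ _ (Q.T.orient.cyc c1)
      rw [sqDist_comm] at h2
      linarith
    · have h1 := hmax _ _ _ d1
      have h2 := hmax _ _ _ (Q.T.orient.cyc d1)
      rw [sqDist_comm] at h2
      linarith
  have hhalf : ∀ {y z}, OrTri.half a b c d y z →
      (y = a ∨ y = b ∨ y = c ∨ y = d) ∧ (z = a ∨ z = b ∨ z = c ∨ z = d) ∧ (y, z) ≠ (a, b) := by
    intro y z h
    rcases h with ⟨rfl, rfl⟩ | ⟨rfl, rfl⟩ | ⟨rfl, rfl⟩ | ⟨rfl, rfl⟩ <;>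
      simp [hab.symm, hbc.symm, hbd.symm, hac.symm, hab, hac, had.symm]
  induction p using WithBot.recBotCoe with
  | bot =>
    induction q using WithBot.recBotCoe with
    | bot => exact absurd rfl ((Q.T.orient.bisect a b c d hc hd).ne h)
    | coe y =>
      induction r using WithBot.recBotCoe with
      | bot => exact absurd rfl ((Q.T.orient.bisect a b c d hc hd).ne' h).2.2
      | coe z =>
        left
        rw [bisect_h_coe]
        exact key _ (hhalf h).1
  | coe x =>
    induction q using WithBot.recBotCoe with
    | bot =>
      induction r using WithBot.recBotCoe with
      | bot => exact absurd rfl ((Q.T.orient.bisect a b c d hc hd).ne' h).2.1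
      | coe z =>
        left
        rw [bisect_h_coe, sqDist_comm]
        exact key _ (hhalf h).2.1
    | coe y =>
      right
      refine ⟨x, y, rfl, rfl, ?_⟩
      induction r using WithBot.recBotCoe with
      | bot =>
        obtain ⟨w, hw, -⟩ := OrTri.half_R hc hd h
        exact ⟨⟨w, hw⟩, (hhalf h).2.2⟩
      | coe z =>
        have h' : Q.T.orient.R x y z ∧ ¬ ((a = x ∨ a = y ∨ a = z) ∧ (b = x ∨ b = y ∨ b = z)) := h
        refine ⟨⟨z, h'.1⟩, ?_⟩
        simp only [ne_eq, Prod.mk.injEq]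
        rintro ⟨rfl, rfl⟩
        exact h'.2 (by simp)

/-- Bisecting a longest edge destroys it and creates only edges of squared length at most 3/4 of the
maximum, none of which is long for the new bound. So the number of long oriented edges drops until
none is left. -/
lemma exists_meshLE_three_fourths {K : ℝ} (n : ℕ) : ∀ Q : Refinement.{u} S, Q.MeshLE K →
    (Q.long (3 / 4 * K)).ncard ≤ n → ∃ Q' : Refinement.{u} S, Q'.MeshLE (3 / 4 * K) := by
  induction n with
  | zero =>
    intro Q _ h0
    refine ⟨Q, fun a b c h => ?_⟩
    by_contra hlt
    have hmem : (a, b) ∈ Q.long (3 / 4 * K) := ⟨⟨c, h⟩, not_le.1 hlt⟩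
    have := (Set.ncard_pos (Set.toFinite _)).2 ⟨_, hmem⟩
    omega
  | succ n ih =>
    intro Q hK hn
    rcases Set.eq_empty_or_nonempty (Q.long (3 / 4 * K)) with h0 | hne
    · exact ih Q hK (by rw [h0]; simp)
    obtain ⟨⟨a, b⟩, ⟨⟨c, hc⟩, hlong⟩, hmax⟩ := Set.exists_max_image _
      (fun e : Q.T.V × Q.T.V => sqDist (Q.h (pt e.1)) (Q.h (pt e.2))) (Set.toFinite _) hne
    obtain ⟨d, hd⟩ := Q.T.orient.opp hc
    dsimp only at hc hlong hmax
    have hab := hK _ _ _ hc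
    have hmax' : ∀ x y z, Q.T.orient.R x y z →
        sqDist (Q.h (pt x)) (Q.h (pt y)) ≤ sqDist (Q.h (pt a)) (Q.h (pt b)) := by
      intro x y z h
      by_cases hl : 3 / 4 * K < sqDist (Q.h (pt x)) (Q.h (pt y))
      · exact hmax (x, y) ⟨⟨z, h⟩, hl⟩
      · linarith
    have h0 := sqDist_nonneg (Q.h (pt a)) (Q.h (pt b))
    refine ih (Q.bisect hc hd) ?_ ?_
    · intro p q r h
      replace h := (OrTri.orient_toSurface (Q.T.orient.bisect a b c d hc hd) p q r).1 h
      rcases Q.bisect_edge hc hd hmax' h with h1 | ⟨x, y, rfl, rfl, ⟨z, hz⟩, -⟩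
      · exact h1.trans (by linarith)
      · have := hK _ _ _ hz
        rw [← bisect_h_coe Q hc hd, ← bisect_h_coe Q hc hd] at this
        exact this
    · have hsub : (Q.bisect hc hd).long (3 / 4 * K) ⊆
          (Prod.map WithBot.some WithBot.some : Q.T.V × Q.T.V → WithBot Q.T.V × WithBot Q.T.V) ''
            (Q.long (3 / 4 * K) \ {(a, b)}) := by
        rintro ⟨p, q⟩ ⟨⟨r, h⟩, hl⟩
        replace h := (OrTri.orient_toSurface (Q.T.orient.bisect a b c d hc hd) p q r).1 h
        rcases Q.bisect_edge hc hd hmax' h with h1 | ⟨x, y, rfl, rfl, ⟨z, hz⟩, hne⟩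
        · have h2 := lt_of_lt_of_le hl h1
          linarith
        · refine ⟨(x, y), ⟨⟨⟨z, hz⟩, ?_⟩, hne⟩, rfl⟩
          have h2 := hl
          dsimp only at h2
          erw [bisect_h_coe, bisect_h_coe] at h2
          exact h2
      have h1 := (Set.ncard_le_ncard hsub (Set.toFinite _)).trans (Set.ncard_image_le (Set.toFinite _))
      have h2 := Set.ncard_sdiff_singleton_lt_of_mem (s := Q.long (3 / 4 * K)) (a := (a, b))
        ⟨⟨c, hc⟩, hlong⟩ (Set.toFinite _)
      exact Nat.le_of_lt_succ (lt_of_le_of_lt h1 (lt_of_lt_of_le h2 hn))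

lemma exists_meshLE (S : ClosedOrientedSurface) {ε : ℝ} (hε : 0 < ε) :
    ∃ Q : Refinement.{u} S, Q.MeshLE ε := by
  have key : ∀ n : ℕ, ∃ Q : Refinement.{u} S, Q.MeshLE ((3 / 4) ^ n * 2) := by
    intro n
    induction n with
    | zero =>
      refine ⟨refl S, fun a b c _ => ?_⟩
      -- Barycentric coordinates are nonnegative with sum 1, so 2 bounds all squared distances and
      -- can start the iteration.
      have : ∀ p q : S.Carrier, sqDist p q ≤ 2 := by
        intro p q
        have : sqDist p q ≤ ∑ w, (p.1 w + q.1 w) := by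
          refine Finset.sum_le_sum fun w _ => ?_
          nlinarith [p.nonneg w, q.nonneg w, p.le_one w, q.le_one w,
            mul_nonneg (p.nonneg w) (q.nonneg w)]
        rw [Finset.sum_add_distrib, p.sum_eq, q.sum_eq] at this
        linarith
      simpa using this _ _
    | succ n ih =>
      obtain ⟨Q, hQ⟩ := ih
      obtain ⟨Q', hQ'⟩ := exists_meshLE_three_fourths _ Q hQ le_rfl
      refine ⟨Q', ?_⟩
      rw [pow_succ']
      rwa [mul_assoc]
  obtain ⟨n, hn⟩ := exists_pow_lt_of_lt_one (half_pos hε) (by norm_num : (3 / 4 : ℝ) < 1)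
  obtain ⟨Q, hQ⟩ := key n
  exact ⟨Q, fun a b c h => (hQ a b c h).trans (by linarith)⟩

/-- Points in the star of a vertex are close to it in a fine refinement. -/
lemma abs_sub_lt {ε : ℝ} (hε : 0 < ε) (h : Q.MeshLE (ε ^ 2)) {v : Q.T.V} {y : Q.T.Carrier}
    (hy : 0 < y.1 v) (w : S.V) : |(Q.h y).1 w - (Q.h (pt v)).1 w| ≤ ε := by
  have hle : ∀ u, y.1 u ≠ 0 → |(Q.h (pt u)).1 w - (Q.h (pt v)).1 w| ≤ ε := by
    intro u hu
    by_cases huv : u = v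
    · rw [huv, sub_self, abs_zero]; exact hε.le
    obtain ⟨t, ht, hz⟩ := y.2
    obtain ⟨x, hx⟩ := R_of_edge ht (by_contra fun h => hu (hz u h))
      (by_contra fun h => hy.ne' (hz v h)) huv
    refine abs_le_of_sq_le_sq ?_ hε.le
    refine le_trans ?_ (h _ _ _ hx)
    exact Finset.single_le_sum (f := fun w => ((Q.h (pt u)).1 w - (Q.h (pt v)).1 w) ^ 2)
      (fun _ _ => sq_nonneg _) (Finset.mem_univ w)
  have e : (Q.h y).1 w - (Q.h (pt v)).1 w =
      ∑ u, y.1 u * ((Q.h (pt u)).1 w - (Q.h (pt v)).1 w) := by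
    simp only [mul_sub, Finset.sum_sub_distrib, ← Finset.sum_mul, y.sum_eq, one_mul]
    rw [← Q.affine]
  rw [e]
  refine (Finset.abs_sum_le_sum_abs _ _).trans ?_
  calc _ ≤ ∑ u, y.1 u * ε := by
        refine Finset.sum_le_sum fun u _ => ?_
        rw [abs_mul, abs_of_nonneg (y.nonneg u)]
        by_cases hu : y.1 u = 0
        · rw [hu, zero_mul, zero_mul]
        · exact mul_le_mul_of_nonneg_left (hle u hu) (y.nonneg u)
    _ = ε := by rw [← Finset.sum_mul, y.sum_eq, one_mul]

end Refinement

end ClosedOrientedSurface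

/-! ### Holonomy of labelled graphs and shortest essential cycles -/

section Holonomy

variable {V : Type*} {E : SimpleGraph V} {G : Type*} [Group G] (l : V → V → G)

/-- The product of the labels along a walk. -/
def SimpleGraph.Walk.holonomy {u v : V} : E.Walk u v → G
| .nil => 1
| .cons (v := w) _ p => l u w * p.holonomy

@[simp] lemma SimpleGraph.Walk.holonomy_nil (u : V) : (.nil : E.Walk u u).holonomy l = 1 := rfl

@[simp] lemma SimpleGraph.Walk.holonomy_cons {u v w : V} (h : E.Adj u w) (p : E.Walk w v) :
    (SimpleGraph.Walk.cons h p).holonomy l = l u w * p.holonomy l := rfl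

lemma SimpleGraph.Walk.holonomy_append {u v w : V} (p : E.Walk u v) (q : E.Walk v w) :
    (p.append q).holonomy l = p.holonomy l * q.holonomy l := by
  induction p with
  | nil => simp
  | cons h p ih => simp [ih, mul_assoc]

variable {l}

/-- Passing to a path only deletes closed subwalks; these are shorter than `n`, hence have trivial
holonomy. -/
lemma SimpleGraph.Walk.holonomy_bypass [DecidableEq V] {n : ℕ}
    (hn : ∀ (u : V) (w : E.Walk u u), w.length < n → w.holonomy l = 1)
    {u v : V} (p : E.Walk u v) (hp : p.length < n) : p.bypass.holonomy l = p.holonomy l := by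
  induction p with
  | nil => rfl
  | @cons u v w h p ih =>
    have h1 : p.length + 1 < n := hp
    have ih' := ih (by omega)
    rw [SimpleGraph.Walk.bypass]
    split_ifs with hs
    · rw [holonomy_cons, ← ih']
      conv_rhs => rw [← p.bypass.take_spec hs, holonomy_append, ← mul_assoc, ← holonomy_cons l h]
      rw [hn, one_mul]
      have h2 := congrArg SimpleGraph.Walk.length (p.bypass.take_spec hs)
      rw [SimpleGraph.Walk.length_append] at h2
      have h3 := p.length_bypass_le_length
      rw [SimpleGraph.Walk.length_cons]
      omega
    · rw [holonomy_cons, holonomy_cons, ih']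

lemma SimpleGraph.Walk.holonomy_of_isChain {k : V → G} {u v : V} (p : E.Walk u v)
    (hp : p.support.IsChain fun x y => k x * l x y = k y) : k u * p.holonomy l = k v := by
  induction p with
  | nil => simp
  | @cons u v w h p ih =>
    rw [SimpleGraph.Walk.support_cons, ← p.cons_tail_support, List.isChain_cons_cons,
      p.cons_tail_support] at hp
    rw [holonomy_cons, ← mul_assoc, hp.1, ih hp.2]

/-- A labelled graph with nontrivial holonomy contains a simple cycle on which the labels are not
a coboundary. -/
lemma exists_cycle_of_holonomy [Fintype V] [DecidableEq V]
    (hl : ∀ u v, E.Adj u v → l v u = (l u v)⁻¹)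
    (h : ∃ (u : V) (w : E.Walk u u), w.holonomy l ≠ 1) :
    ∃ ν : Equiv.Perm V, ν.IsCycle ∧ (∀ v ∈ ν.support, E.Adj v (ν v)) ∧
      (∀ v ∈ ν.support, ν (ν v) ≠ v) ∧
      ¬ ∃ k : V → G, ∀ v ∈ ν.support, k v * l v (ν v) = k (ν v) := by
  have hex : ∃ n, ∃ (u : V) (w : E.Walk u u), w.length = n ∧ w.holonomy l ≠ 1 := by
    obtain ⟨u, w, h⟩ := h
    exact ⟨_, u, w, rfl, h⟩
  classical
  -- A closed walk of least length with nontrivial holonomy. All but its first edge can be replaced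
  -- by a path without changing the holonomy.
  obtain ⟨v, w, hwn, hw⟩ := Nat.find_spec hex
  have hmin : ∀ (u : V) (w : E.Walk u u), w.length < Nat.find hex → w.holonomy l = 1 := by
    intro u w h
    by_contra hne
    exact Nat.find_min hex h ⟨u, w, rfl, hne⟩
  cases w with
  | nil => exact absurd rfl hw
  | @cons _ u _ hadj p =>
    have hp := SimpleGraph.Walk.holonomy_bypass hmin p (by
      rw [← hwn, SimpleGraph.Walk.length_cons]; omega)
    have hpath := p.bypass_isPath
    rw [SimpleGraph.Walk.holonomy_cons, ← hp] at hw
    generalize p.bypass = q at hw hpath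
    -- A path with one edge would close up to a backtrack, whose holonomy is trivial. So the cycle
    -- has at least three vertices, whence `ν (ν v) ≠ v`.
    have hlen : 2 ≤ q.length := by
      by_contra hlt
      match q, hw, hlt with
| .nil, _, _ => exact hadj.ne rfl
| .cons h .nil, hw, _ => exact hw (by simp [hl _ _ h])
| .cons _ (.cons _ _), _, hlt => simp at hlt
    have hnd : q.support.Nodup := hpath.support_nodup
    have hlen' : q.support.length = q.length + 1 := q.length_support
    have hne : ∀ x : V, q.support ≠ [x] := by
      intro x hx
      rw [hx, List.length_singleton] at hlen'
      omega
    have hsupp : ∀ x, x ∈ q.support.formPerm.support ↔ x ∈ q.support := by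
      intro x
      rw [List.support_formPerm_of_nodup _ hnd hne, List.mem_toFinset]
    have hget : ∀ i (hi : i < q.support.length), q.support.formPerm q.support[i] =
        q.support[(i + 1) % q.support.length]'(Nat.mod_lt _ (by omega)) := fun i hi =>
      List.formPerm_apply_getElem _ hnd i hi
    have hnext : ∀ i (hi : i + 1 < q.support.length),
        q.support.formPerm q.support[i] = q.support[i + 1] := by
      intro i hi
      rw [hget]
      congr 1
      exact Nat.mod_eq_of_lt hi
    have hfirst : q.support[0]'(by omega) = u := by
      simp
    have hlast : q.support[q.length]'(by omega) = v := by
      simp [SimpleGraph.Walk.support_getElem_length]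
    have hclose : q.support.formPerm v = u := by
      have := hget q.length (by omega)
      rw [hlast] at this
      rw [this]
      conv_rhs => rw [← hfirst]
      congr 1
      rw [hlen', Nat.mod_self]
    refine ⟨q.support.formPerm, List.isCycle_formPerm hnd (by omega), fun x hx => ?_, fun x hx => ?_,
      ?_⟩
    · obtain ⟨i, hi, rfl⟩ := List.getElem_of_mem ((hsupp x).1 hx)
      by_cases hi' : i + 1 < q.support.length
      · rw [hnext i hi']
        exact q.isChain_adj_support.getElem i hi'
      · obtain rfl : i = q.length := by omega
        rw [hlast, hclose]
        exact hadj
    · obtain ⟨i, hi, rfl⟩ := List.getElem_of_mem ((hsupp x).1 hx)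
      rw [hget, hget, Ne, hnd.getElem_inj_iff, hlen']
      rw [hlen'] at hi
      intro h
      by_cases h1 : i + 1 < q.length + 1
      · rw [Nat.mod_eq_of_lt h1] at h
        by_cases h2 : i + 1 + 1 < q.length + 1
        · rw [Nat.mod_eq_of_lt h2] at h; omega
        · have : i + 1 + 1 = q.length + 1 := by omega
          rw [this, Nat.mod_self] at h; omega
      · have : i + 1 = q.length + 1 := by omega
        rw [this, Nat.mod_self, Nat.mod_eq_of_lt (by omega)] at h; omega
    -- A coboundary telescopes around the cycle and would make the holonomy trivial.
    · rintro ⟨k, hk⟩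
      apply hw
      have h1 : k u * q.holonomy l = k v := by
        refine q.holonomy_of_isChain (List.isChain_iff_getElem.2 fun i hi => ?_)
        have := hk _ ((hsupp _).2 (List.getElem_mem (by omega : i < q.support.length)))
        rwa [hnext i hi] at this
      have h2 : k v * l v u = k u := by
        have := hk v ((hsupp v).2 q.end_mem_support)
        rwa [hclose] at this
      rw [← h2, mul_assoc] at h1
      exact mul_eq_left.1 h1

end Holonomy

/-! ### Subpaths, and a groupoid mapped to a group -/

section Paths

variable {X : Type u} [TopologicalSpace X]

lemma cls_eq_of_map {Y : Type*} [TopologicalSpace Y] (h : X ≃ₜ Y) {x y : X} {p q : Path x y}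
    (e : cls (p.map h.continuous) = cls (q.map h.continuous)) : cls p = cls q := by
  have h1 := congrArg (FundamentalGroupoid.map (h.symm : C(Y, X))).map e
  have h2 : ∀ g : C(X, X), g = ContinuousMap.id X →
      cls (p.map g.continuous) = cls (q.map g.continuous) → cls p = cls q := by
    rintro _ rfl h; exact h
  exact h2 ((h.symm : C(Y, X)).comp (h : C(X, Y))) (by ext; simp) h1

/-- The initial part of a path. -/
noncomputable def Path.head {x y : X} (γ : Path x y) (s : I) : Path x (γ s) :=
  (γ.subpath 0 s).cast γ.source.symm rfl

/-- The final part of a path. -/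
noncomputable def Path.tail {x y : X} (γ : Path x y) (s : I) : Path (γ s) y :=
  (γ.subpath s 1).cast rfl γ.target.symm

lemma cls_cast_left {x a b c : X} (hx : x = a) {p : Path a b} {q : Path b c} {r : Path a c}
    (h : cls p ≫ cls q = cls r) : cls (p.cast hx rfl) ≫ cls q = cls (r.cast hx rfl) := by
  subst hx; exact h

lemma cls_cast_both {x a b c z : X} (hx : x = a) (hz : z = c) {p : Path a b} {q : Path b c}
    {r : Path a c} (h : cls p ≫ cls q = cls r) :
    cls (p.cast hx rfl) ≫ cls (q.cast rfl hz) = cls (r.cast hx hz) := by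
  subst hx hz; exact h

lemma cls_head {x y : X} (γ : Path x y) (s t : I) :
    cls (γ.head s) ≫ cls (γ.subpath s t) = cls (γ.head t) :=
  cls_cast_left _ (cls_subpath γ 0 s t)

lemma cls_head_tail {x y : X} (γ : Path x y) (s : I) :
    cls (γ.head s) ≫ cls (γ.tail s) = cls γ := by
  have := cls_cast_both γ.source.symm γ.target.symm (cls_subpath γ 0 s 1)
  rw [γ.subpath_zero_one] at this
  exact this

lemma subpath_mem {x y : X} (γ : Path x y) {s t : I} (hst : s ≤ t) {P : X → Prop}
    (h : ∀ r, s ≤ r → r ≤ t → P (γ r)) (r : I) : P (γ.subpath s t r) := by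
  have : γ.subpath s t r ∈ Set.range (γ.subpath s t) := ⟨r, rfl⟩
  rw [Path.range_subpath_of_le _ _ _ hst] at this
  obtain ⟨r', hr', e⟩ := this
  rw [← e]
  exact h r' hr'.1 hr'.2

lemma trans_mem {x y z : X} (p : Path x y) (q : Path y z) {P : X → Prop} (hp : ∀ r, P (p r))
    (hq : ∀ r, P (q r)) (r : I) : P (p.trans q r) := by
  rw [Path.trans_apply]
  split_ifs
  · exact hp _
  · exact hq _

/-- A groupoid maps to a group, injectively on a vertex group. -/
lemma exists_hom_to_group {C : Type u} [Groupoid.{u} C] (x : C) :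
    ∃ (G : Type u) (_ : Group G) (Φ : ∀ {a b : C}, (a ⟶ b) → G),
      (∀ {a b c : C} (m : a ⟶ b) (n : b ⟶ c), Φ (m ≫ n) = Φ m * Φ n) ∧
      ∀ m : x ⟶ x, Φ m = 1 → m = 𝟙 x := by
  classical
  -- A chosen arrow from `x` to every object of its component turns each arrow there into a loop at
  -- `x`; arrows in other components are sent to the identity.
  let e : ∀ a : C, Option (x ⟶ a) := fun a => if h : Nonempty (x ⟶ a) then some h.some else none
  have he : ∀ a b (m : a ⟶ b), (∃ p q, e a = some p ∧ e b = some q) ∨ (e a = none ∧ e b = none) := by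
    intro a b m
    by_cases ha : Nonempty (x ⟶ a)
    · have hb : Nonempty (x ⟶ b) := ⟨ha.some ≫ m⟩
      exact .inl ⟨_, _, dif_pos ha, dif_pos hb⟩
    · have hb : ¬ Nonempty (x ⟶ b) := fun h => ha ⟨h.some ≫ inv m⟩
      exact .inr ⟨dif_neg ha, dif_neg hb⟩
  let Ψ : ∀ {a b : C}, (a ⟶ b) → (x ⟶ x) := fun {a b} m =>
    match e a, e b with
| some p, some q => p ≫ m ≫ inv q
| _, _ => 𝟙 x
  have hΨ : ∀ {a b : C} (m : a ⟶ b) p q, e a = some p → e b = some q →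
      Ψ m = p ≫ m ≫ inv q := by
    intro a b m p q ha hb
    simp only [Ψ, ha, hb]
  have hΨ' : ∀ {a b : C} (m : a ⟶ b), e a = none → Ψ m = 𝟙 x := by
    intro a b m ha
    simp only [Ψ, ha]
  -- Multiplication in `Aut x` reverses composition, hence the opposite group.
  refine ⟨(Aut x)ᵐᵒᵖ, inferInstance, fun {a b} m => .op (Groupoid.isoEquivHom x x |>.symm (Ψ m)),
    ?_, ?_⟩
  · intro a b c m n
    apply MulOpposite.unop_injective
    apply Iso.ext
    change Ψ (m ≫ n) = Ψ m ≫ Ψ n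
    rcases he _ _ m with ⟨p, q, ha, hb⟩ | ⟨ha, hb⟩
    · rcases he _ _ n with ⟨q', r, hb', hc⟩ | ⟨hb', hc⟩
      · rw [hΨ _ _ _ ha hb, hΨ _ _ _ hb hc, hΨ _ _ _ ha hc]
        simp
      · rw [hb] at hb'; exact absurd hb' (by simp)
    · rw [hΨ' _ ha, hΨ' _ ha, hΨ' _ hb, Category.comp_id]
  · intro m hm
    have h1 : Ψ m = 𝟙 x := congrArg (fun i : (Aut x)ᵐᵒᵖ => i.unop.hom) hm
    have hx : Nonempty (x ⟶ x) := ⟨𝟙 x⟩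
    rw [hΨ m _ _ (dif_pos hx) (dif_pos hx)] at h1
    have h2 := congrArg (fun k => inv hx.some ≫ k ≫ hx.some) h1
    simpa using h2

end Paths

/-! ### Simple closed curves: closeness in space forces closeness on the circle -/

namespace ClosedOrientedSurface

variable {S : ClosedOrientedSurface}

lemma exists_large_coord (x : S.Carrier) : ∃ u, 1 / (Fintype.card S.V : ℝ) ≤ x.1 u := by
  by_contra h
  push Not at h
  have hne : (Finset.univ : Finset S.V).Nonempty := by
    rw [Finset.nonempty_iff_ne_empty]
    intro h0
    have := x.sum_eq
    rw [h0] at this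
    simp at this
  have := Finset.sum_lt_sum_of_nonempty hne fun u _ => h u
  rw [x.sum_eq, Finset.sum_const, Finset.card_univ, nsmul_eq_mul] at this
  have hN : (0 : ℝ) < Fintype.card S.V := by
    rw [← Finset.card_univ]; exact_mod_cast hne.card_pos
  rw [mul_one_div_cancel hN.ne'] at this
  exact lt_irrefl _ this

lemma eq_of_sqDist_eq_zero {x y : S.Carrier} (h : sqDist x y = 0) : x = y := by
  refine Carrier.ext fun v => ?_
  rw [sqDist, Finset.sum_eq_zero_iff_of_nonneg fun _ _ => sq_nonneg _] at h
  have := h v (Finset.mem_univ v)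
  rw [sq_eq_zero_iff, sub_eq_zero] at this
  exact this

/-- For a simple closed curve, points that are close in space are close on the curve. -/
lemma exists_tolerance (c : C(I, S.Carrier)) (hinj : Set.InjOn c (Set.Ico 0 1))
    (hclosed : c 0 = c 1) : ∃ ε : ℝ, 0 < ε ∧ ∀ s t : I, s ≤ t →
      (∀ w, |(c s).1 w - (c t).1 w| ≤ 2 * ε) →
      ∃ u, ε < (c s).1 u ∧ ε < (c t).1 u ∧
        ((∀ r, s ≤ r → r ≤ t → 0 < (c r).1 u) ∨ (∀ r, r ≤ s ∨ t ≤ r → 0 < (c r).1 u)) := by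
  set N : ℝ := ((Fintype.card S.V : ℕ) : ℝ) with hN
  have hN1 : 1 ≤ N := by
    obtain ⟨u, -⟩ := exists_large_coord (c 0)
    rw [hN]
    exact_mod_cast Fintype.card_pos_iff.2 ⟨u⟩
  have hN0 : 0 < 1 / N := by positivity
  have hcont : Continuous fun r : I => fun u => (c r).1 u :=
    continuous_pi fun u => (continuous_coord u).comp c.continuous
  -- Parameters within `δ` change every coordinate by less than 1/(4N), while each point has a
  -- coordinate of size at least 1/N. So a short arc stays in one open star.
  obtain ⟨δ, hδ, hδc⟩ := Metric.uniformContinuous_iff.1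
    (CompactSpace.uniformContinuous_of_continuous hcont) (1 / (4 * N)) (by positivity)
  have hvar : ∀ r r' : I, |(r : ℝ) - r'| < δ → ∀ u, |(c r).1 u - (c r').1 u| < 1 / (4 * N) := by
    intro r r' h u
    have h1 := hδc (a := r) (b := r') (by rw [Subtype.dist_eq, Real.dist_eq]; exact h)
    exact (Real.dist_eq _ _ ▸ (dist_pi_lt_iff (by positivity)).1 h1 u)
  -- Parameters at distance at least `δ` on the circle have uniformly separated images, by
  -- injectivity and compactness.
  have hfar : ∃ η : ℝ, 0 < η ∧ ∀ s t : I, δ ≤ (t : ℝ) - s → (t : ℝ) - s ≤ 1 - δ →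
      η ≤ sqDist (c s) (c t) := by
    let K : Set (I × I) := {z | δ ≤ (z.2 : ℝ) - z.1 ∧ (z.2 : ℝ) - z.1 ≤ 1 - δ}
    have hK : IsCompact K := by
      apply IsClosed.isCompact
      have h1 : Continuous fun z : I × I => (z.2 : ℝ) - z.1 := by fun_prop
      exact (isClosed_le continuous_const h1).inter (isClosed_le h1 continuous_const)
    have hD : Continuous fun z : I × I => sqDist (c z.1) (c z.2) := by
      unfold sqDist
      refine continuous_finsetSum _ fun u _ => ?_
      exact (((continuous_coord u).comp (c.continuous.comp continuous_fst)).sub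
        ((continuous_coord u).comp (c.continuous.comp continuous_snd))).pow 2
    rcases K.eq_empty_or_nonempty with h0 | hne
    · refine ⟨1, one_pos, fun s t h1 h2 => ?_⟩
      have : (s, t) ∈ K := ⟨h1, h2⟩
      rw [h0] at this
      exact absurd this (Set.notMem_empty _)
    · obtain ⟨⟨s, t⟩, ⟨h1, h2⟩, hmin⟩ := hK.exists_isMinOn hne hD.continuousOn
      refine ⟨sqDist (c s) (c t), ?_, fun s' t' h1' h2' => hmin (show (s', t') ∈ K from ⟨h1', h2'⟩)⟩
      refine lt_of_le_of_ne (Refinement.sqDist_nonneg _ _) fun h => ?_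
      have heq := eq_of_sqDist_eq_zero h.symm
      dsimp only at h1 h2
      have hs0 := s.2.1
      have hs1 := s.2.2
      have ht0 := t.2.1
      have ht1 := t.2.2
      have hs : s ∈ Set.Ico (0 : I) 1 := ⟨hs0, by
        rw [← Subtype.coe_lt_coe]; change (s : ℝ) < 1; linarith⟩
      by_cases ht : t = 1
      · rw [ht, ← hclosed] at heq
        have := hinj hs ⟨le_rfl, zero_lt_one⟩ heq
        rw [this, ht] at h2
        simp at h2
        linarith
      · have := hinj hs ⟨ht0, lt_of_le_of_ne ht1 ht⟩ heq
        rw [this] at h1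
        simp at h1
        linarith
  obtain ⟨η, hη, hfar⟩ := hfar
  -- The first bound gives 1/N - 2ε > ε, so a large coordinate of `c s` exceeds `ε` at `c t` too. By
  -- the second, coordinates within 2ε of each other give squared distance at most N(2ε)² ≤ 4Nε < η,
  -- which rules out parameters far apart on the circle.
  set ε := min (1 / (8 * N)) (η / (8 * N)) with hε
  have hε0 : 0 < ε := lt_min (by positivity) (by positivity)
  have hε1 : ε ≤ 1 / N / 8 := (min_le_left _ _).trans_eq (by field_simp)
  have hε2 : ε * (8 * N) ≤ η := by
    have := min_le_right (1 / (8 * N)) (η / (8 * N))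
    rwa [le_div_iff₀ (by positivity)] at this
  have hε3 : ε ≤ 1 := hε1.trans (by rw [div_div, div_le_one (by positivity)]; linarith)
  have h4 : 1 / (4 * N) = 1 / N / 4 := by field_simp
  rw [h4] at hvar
  refine ⟨ε, hε0, fun s t hst hclose => ?_⟩
  obtain ⟨u, hu⟩ := exists_large_coord (c s)
  have hu' := abs_le.1 (hclose u)
  refine ⟨u, by linarith, by linarith [hu'.2], ?_⟩
  have hst' : (s : ℝ) ≤ t := hst
  by_cases h1 : (t : ℝ) - s < δ
  · left
    intro r hr1 hr2
    have hr1' : (s : ℝ) ≤ r := hr1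
    have hr2' : (r : ℝ) ≤ t := hr2
    have := abs_lt.1 (hvar r s (by rw [abs_of_nonneg] <;> linarith) u)
    linarith
  -- Parameters near opposite ends of the interval are close across the base point; the short arc is
  -- then the complement of [s, t].
  by_cases h2 : 1 - δ < (t : ℝ) - s
  · right
    have ht1 := t.2.2
    have hs0 := s.2.1
    rintro r (hr | hr)
    · have hr' : (r : ℝ) ≤ s := hr
      have hr0 := r.2.1
      have := abs_lt.1 (hvar s r (by rw [abs_of_nonneg] <;> linarith) u)
      linarith
    · have hr' : (t : ℝ) ≤ r := hr
      have hr1 := r.2.2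
      have := abs_lt.1 (hvar r t (by rw [abs_of_nonneg] <;> linarith) u)
      linarith
  · exfalso
    have h5 := hfar s t (not_lt.1 h1) (not_lt.1 h2)
    have h6 : sqDist (c s) (c t) ≤ ∑ _w : S.V, (2 * ε) ^ 2 :=
      Finset.sum_le_sum fun w _ => sq_le_sq' (abs_le.1 (hclose w)).1 (abs_le.1 (hclose w)).2
    rw [Finset.sum_const, Finset.card_univ, nsmul_eq_mul, ← hN] at h6
    have h7 : N * (2 * ε) ^ 2 ≤ N * (4 * ε) := by
      refine mul_le_mul_of_nonneg_left ?_ (by linarith)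
      nlinarith
    have h8 : 0 < ε * N := by positivity
    linarith

end ClosedOrientedSurface

/-! ### From the simple loop to a simple edge cycle of a refinement -/

namespace ClosedOrientedSurface

section Arm

variable {T : ClosedOrientedSurface} {x y : T.Carrier} (γ : Path x y)

/-- The path along `γ` and then straight to a vertex. -/
noncomputable def arm (s : I) (v : T.V) (hv : 0 < (γ s).1 v) :
    FundamentalGroupoid.mk x ⟶ FundamentalGroupoid.mk (pt v : T.Carrier) :=
  cls (γ.head s) ≫ cls (seg (γ s) (pt v) (sameFace_pt hv))

lemma exists_R_of_pos {z : T.Carrier} {u v : T.V} (hu : 0 < z.1 u) (hv : 0 < z.1 v)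
    (huv : u ≠ v) : ∃ w, T.orient.R u v w := by
  obtain ⟨t, ht, hz⟩ := z.2
  exact R_of_edge ht (by_contra fun h => hu.ne' (hz u h)) (by_contra fun h => hv.ne' (hz v h)) huv

lemma sameFace_of_R {u v w : T.V} (h : T.orient.R u v w) : SameFace (pt u : T.Carrier) (pt v) :=
  sameFace_pt_pt (mem_triangles.2 ⟨_, _, _, h, rfl⟩) (by simp) (by simp)

lemma arm_edge (s : I) {u v : T.V} (hu : 0 < (γ s).1 u) (hv : 0 < (γ s).1 v)
    (hf : SameFace (pt u : T.Carrier) (pt v)) :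
    arm γ s u hu ≫ cls (seg (pt u) (pt v) hf) = arm γ s v hv := by
  rw [arm, arm, Category.assoc, cls_seg_trans]
  obtain ⟨t, ht, hz⟩ := (γ s).2
  refine ⟨t, ht, fun w hw => ⟨hz w hw, ?_, ?_⟩⟩
  · rw [pt_apply, if_neg]; rintro rfl; exact hu.ne' (hz w hw)
  · rw [pt_apply, if_neg]; rintro rfl; exact hv.ne' (hz w hw)

lemma arm_star {s t : I} (hst : s ≤ t) {v : T.V} (h : ∀ r, s ≤ r → r ≤ t → 0 < (γ r).1 v) :
    arm γ s v (h s le_rfl hst) = arm γ t v (h t hst le_rfl) := by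
  rw [arm, arm, ← cls_head γ s t, Category.assoc,
    cls_star (γ.subpath s t) v (subpath_mem γ (P := fun z => 0 < z.1 v) hst h) (h s le_rfl hst)
      (h t hst le_rfl)]

lemma head_mem {s : I} {P : T.Carrier → Prop} (h : ∀ r, r ≤ s → P (γ r)) (r : I) :
    P (γ.head s r) :=
  subpath_mem γ (s := 0) (t := s) s.2.1 (fun r _ hr => h r hr) r

lemma tail_mem {s : I} {P : T.Carrier → Prop} (h : ∀ r, s ≤ r → P (γ r)) (r : I) :
    P (γ.tail s r) :=
  subpath_mem γ (s := s) (t := 1) s.2.2 (fun r hr _ => h r hr) r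

lemma arm_zero {v : T.V} (hx : 0 < x.1 v) (h0 : 0 < (γ 0).1 v) :
    arm γ 0 v h0 = cls (seg x (pt v) (sameFace_pt hx)) := by
  refine cls_star (γ.head 0) v (head_mem γ (P := fun z => 0 < z.1 v) fun r hr => ?_) hx h0
  rwa [le_antisymm hr r.2.1]

lemma arm_one {v : T.V} (hy : 0 < y.1 v) (h1 : 0 < (γ 1).1 v) :
    arm γ 1 v h1 = cls γ ≫ cls (seg y (pt v) (sameFace_pt hy)) := by
  rw [← cls_head_tail γ 1, Category.assoc, arm]
  congr 1
  refine (cls_star (γ.tail 1) v (tail_mem γ (P := fun z => 0 < z.1 v) fun r hr => ?_) h1 hy).symm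
  rwa [(le_antisymm r.2.2 hr : r = 1)]

end Arm

namespace Refinement

variable {S : ClosedOrientedSurface} (Q : Refinement.{u} S)

/-- Paths with common ends in an open star of `S` are homotopic, and the homeomorphism transports
this to the refinement. The star is one of the coarse surface: arms to the same vertex are
controlled at the scale of `S`. -/
lemma cls_eq_of_pos {a b : Q.T.Carrier} (p q : Path a b) (u : S.V)
    (hp : ∀ r, 0 < (Q.h (p r)).1 u) (hq : ∀ r, 0 < (Q.h (q r)).1 u) : cls p = cls q :=
  cls_eq_of_map Q.h (cls_star_eq (p.map Q.h.continuous) (q.map Q.h.continuous) u hp hq)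

lemma h_seg_pos {a b : Q.T.Carrier} (hf : SameFace a b) {u : S.V} (ha : 0 < (Q.h a).1 u)
    (hb : 0 < (Q.h b).1 u) (r : I) : 0 < (Q.h (seg a b hf r)).1 u := by
  have e : (Q.h (seg a b hf r)).1 u = (1 - r) * (Q.h a).1 u + r * (Q.h b).1 u := by
    rw [Q.affine, Q.affine a, Q.affine b, Finset.mul_sum, Finset.mul_sum, ← Finset.sum_add_distrib]
    refine Finset.sum_congr rfl fun v _ => ?_
    rw [seg_apply]; ring
  rw [e]
  have h0 := r.2.1
  have h1 := r.2.2
  rcases h0.eq_or_lt with h | h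
  · rw [← h]; simpa using ha
  · exact add_pos_of_nonneg_of_pos (mul_nonneg (by linarith) ha.le) (mul_pos h hb)

/-- In a fine refinement, the arms of a simple closed curve to a vertex agree in the target. -/
lemma map_arm_eq {X : Type u} [TopologicalSpace X] (g : C(Q.T.Carrier, X)) {x : Q.T.Carrier}
    (γ : Path x x) {ε : ℝ} (hε : 0 < ε) (hmesh : Q.MeshLE (ε ^ 2))
    (htol : ∀ s t : I, s ≤ t → (∀ w, |(Q.h (γ s)).1 w - (Q.h (γ t)).1 w| ≤ 2 * ε) →
      ∃ u, ε < (Q.h (γ s)).1 u ∧ ε < (Q.h (γ t)).1 u ∧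
        ((∀ r, s ≤ r → r ≤ t → 0 < (Q.h (γ r)).1 u) ∨
          (∀ r, r ≤ s ∨ t ≤ r → 0 < (Q.h (γ r)).1 u)))
    (htriv : (FundamentalGroupoid.map g).map (cls γ) = 𝟙 _) {s t : I} {v : Q.T.V}
    (hs : 0 < (γ s).1 v) (ht : 0 < (γ t).1 v) :
    (FundamentalGroupoid.map g).map (arm γ s v hs) =
      (FundamentalGroupoid.map g).map (arm γ t v ht) := by
  wlog hst : s ≤ t generalizing s t
  · exact (this ht hs (le_of_not_ge hst)).symm
  have hvs := Q.abs_sub_lt hε hmesh hs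
  have hvt := Q.abs_sub_lt hε hmesh ht
  obtain ⟨u, hus, hut, hor⟩ := htol s t hst fun w => by
    have h1 := abs_le.1 (hvs w)
    have h2 := abs_le.1 (hvt w)
    rw [abs_le]
    constructor <;> linarith
  have hu : 0 < (Q.h (pt v)).1 u := by
    have := (abs_le.1 (hvs u)).2
    linarith
  have hsegs := Q.h_seg_pos (sameFace_pt hs) (hε.trans hus) hu
  have hsegt := Q.h_seg_pos (sameFace_pt ht) (hε.trans hut) hu
  rcases hor with h | h
  -- The arc of `γ` from `s` to `t` stays in the star of `u`, so the arms agree already in the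
  -- surface.
  · congr 1
    rw [arm, arm, ← cls_head γ s t, Category.assoc]
    congr 1
    rw [← cls_trans]
    exact Q.cls_eq_of_pos _ _ u hsegs
      (trans_mem _ _ (P := fun z => 0 < (Q.h z).1 u)
        (subpath_mem γ (P := fun z => 0 < (Q.h z).1 u) hst h) hsegt)
  -- The complementary arc stays in the star of `u`, so the arms differ by the full loop, which dies
  -- in the target.
  · have e : arm γ t v ht = cls γ ≫ arm γ s v hs := by
      rw [arm, arm, ← cls_head_tail γ t, Category.assoc]
      congr 1
      rw [← cls_trans, ← cls_trans]
      exact Q.cls_eq_of_pos _ _ u hsegt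
        (trans_mem _ _ (P := fun z => 0 < (Q.h z).1 u)
          (tail_mem γ (P := fun z => 0 < (Q.h z).1 u) fun r hr => h r (.inr hr))
          (trans_mem _ _ (P := fun z => 0 < (Q.h z).1 u)
            (head_mem γ (P := fun z => 0 < (Q.h z).1 u) fun r hr => h r (.inl hr)) hsegs))
    rw [e, Functor.map_comp, htriv, Category.id_comp]

end Refinement

section Walk

variable {T : ClosedOrientedSurface} {x : T.Carrier} (γ : Path x x)

/-- The vertices whose open stars meet at a point of `γ`. -/
def traceGraph : SimpleGraph T.V where
  Adj u v := u ≠ v ∧ ∃ s, 0 < (γ s).1 u ∧ 0 < (γ s).1 v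
  symm := ⟨fun _ _ ⟨h, s, h1, h2⟩ => ⟨h.symm, s, h2, h1⟩⟩
  loopless := ⟨fun _ h => h.1 rfl⟩

open Classical in
/-- The label of an edge. -/
noncomputable def edgeLabel {G : Type} [Group G]
    (Φ : ∀ {a b : FundamentalGroupoid T.Carrier}, (a ⟶ b) → G) (u v : T.V) : G :=
  if h : SameFace (pt u : T.Carrier) (pt v) then Φ (cls (seg _ _ h)) else 1

variable {G : Type} [Group G] {Φ : ∀ {a b : FundamentalGroupoid T.Carrier}, (a ⟶ b) → G}
  (hΦ : ∀ {a b c : FundamentalGroupoid T.Carrier} (m : a ⟶ b) (n : b ⟶ c), Φ (m ≫ n) = Φ m * Φ n)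

include hΦ

lemma hom_id (a : FundamentalGroupoid T.Carrier) : Φ (𝟙 a) = 1 := by
  have := hΦ (𝟙 a) (𝟙 a)
  rw [Category.comp_id] at this
  exact mul_eq_left.1 this.symm

lemma edgeLabel_swap {u v w : T.V} (h : T.orient.R u v w) :
    edgeLabel Φ v u = (edgeLabel Φ u v)⁻¹ := by
  have h1 := sameFace_of_R h
  rw [edgeLabel, edgeLabel, dif_pos h1, dif_pos h1.symm, eq_inv_iff_mul_eq_one, cls_seg_symm h1,
    ← hΦ, IsIso.inv_hom_id, hom_id hΦ]

lemma edgeLabel_cocycle {u v w : T.V} (h : T.orient.R u v w) :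
    edgeLabel Φ u v * edgeLabel Φ v w * edgeLabel Φ w u = 1 := by
  have h1 := sameFace_of_R h
  have h2 := sameFace_of_R (T.orient.cyc h)
  have h3 := sameFace_of_R (T.orient.cyc (T.orient.cyc h))
  rw [edgeLabel, edgeLabel, edgeLabel, dif_pos h1, dif_pos h2, dif_pos h3, ← hΦ, ← hΦ,
    cls_seg_trans _ h1 h2 h3.symm, cls_seg_symm h3, IsIso.inv_hom_id, hom_id hΦ]
  refine ⟨_, mem_triangles.2 ⟨_, _, _, h, rfl⟩, fun a ha => ?_⟩
  simp only [Finset.mem_insert, Finset.mem_singleton, not_or] at ha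
  simp [ha.1, ha.2.1, ha.2.2]

/-- At a fixed time, changing the vertex at the end of an arm appends one edge of the trace graph to
the walk. -/
lemma exists_walk_step {v₀ u v : T.V} {k : G} {s : I} (hu : 0 < (γ s).1 u) (hv : 0 < (γ s).1 v)
    (h : ∃ w : (traceGraph γ).Walk v₀ u, Φ (arm γ s u hu) = k * w.holonomy (edgeLabel Φ)) :
    ∃ w : (traceGraph γ).Walk v₀ v, Φ (arm γ s v hv) = k * w.holonomy (edgeLabel Φ) := by
  obtain ⟨w, hw⟩ := h
  by_cases huv : u = v
  · subst huv
    exact ⟨w, hw⟩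
  · obtain ⟨z, hz⟩ := exists_R_of_pos hu hv huv
    have hadj : (traceGraph γ).Adj u v := ⟨huv, s, hu, hv⟩
    refine ⟨w.append (.cons hadj .nil), ?_⟩
    rw [SimpleGraph.Walk.holonomy_append, ← mul_assoc, ← hw, ← arm_edge γ s hu hv (sameFace_of_R hz),
      hΦ, SimpleGraph.Walk.holonomy_cons, SimpleGraph.Walk.holonomy_nil, mul_one, edgeLabel,
      dif_pos (sameFace_of_R hz)]

/-- A loop is freely homotopic to an edge loop in its trace. -/
lemma exists_walk_holonomy (hne : Φ (cls γ) ≠ 1) :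
    ∃ (v : T.V) (w : (traceGraph γ).Walk v v), w.holonomy (edgeLabel Φ) ≠ 1 := by
  have hpos : ∀ z : T.Carrier, ∃ v, 0 < z.1 v := by
    intro z
    by_contra h
    push Not at h
    have h1 := Finset.sum_nonpos fun v (_ : v ∈ Finset.univ) => h v
    rw [z.sum_eq] at h1
    linarith
  -- Lebesgue subdivision by open stars: along each piece the arm to one vertex keeps its class, and
  -- at the subdivision points the vertex changes along an edge.
  obtain ⟨t, ht0, htm, ⟨n, hn⟩, hcov⟩ := exists_monotone_Icc_subset_open_cover_unitInterval
    (c := fun v : T.V => {s | 0 < (γ s).1 v})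
    (fun v => isOpen_lt continuous_const ((continuous_coord v).comp γ.continuous))
    (fun s _ => by
      obtain ⟨v, hv⟩ := hpos (γ s)
      exact Set.mem_iUnion.2 ⟨v, hv⟩)
  obtain ⟨v₀, hv₀⟩ := hpos x
  have h0 : 0 < (γ 0).1 v₀ := by rwa [γ.source]
  have h1 : 0 < (γ 1).1 v₀ := by rwa [γ.target]
  set k := Φ (cls (seg x (pt v₀) (sameFace_pt hv₀))) with hk
  have key : ∀ i : ℕ, ∃ v, ∃ hv : 0 < (γ (t i)).1 v,
      ∃ w : (traceGraph γ).Walk v₀ v, Φ (arm γ (t i) v hv) = k * w.holonomy (edgeLabel Φ) := by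
    intro i
    induction i with
    | zero =>
      have h0' : 0 < (γ (t 0)).1 v₀ := by rwa [ht0]
      refine ⟨v₀, h0', .nil, ?_⟩
      have : ∀ s (hs : s = 0) (h : 0 < (γ s).1 v₀), Φ (arm γ s v₀ h) = k := by
        rintro s rfl h
        rw [arm_zero γ hv₀]
      rw [this _ ht0, SimpleGraph.Walk.holonomy_nil, mul_one]
    | succ i ih =>
      obtain ⟨u, hu, hw⟩ := ih
      obtain ⟨v, hv⟩ := hcov i
      have hle := htm (Nat.le_succ i)
      have hst : ∀ r, t i ≤ r → r ≤ t (i + 1) → 0 < (γ r).1 v := fun r h1 h2 => hv ⟨h1, h2⟩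
      refine ⟨v, hst _ hle le_rfl, ?_⟩
      rw [← arm_star γ hle hst]
      exact exists_walk_step γ hΦ hu _ hw
  obtain ⟨v, hv, hw⟩ := key n
  have h1' : 0 < (γ (t n)).1 v₀ := by rwa [hn n le_rfl]
  obtain ⟨w, hw⟩ := exists_walk_step γ hΦ hv h1' hw
  refine ⟨v₀, w, fun h => hne ?_⟩
  -- At time 1 the arm to `v₀` is `γ` followed by the initial segment, so the holonomy of the walk
  -- is a conjugate of `Φ (cls γ)`.
  have : ∀ s (hs : s = 1) (h : 0 < (γ s).1 v₀), Φ (arm γ s v₀ h) = Φ (cls γ) * k := by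
    rintro s rfl h
    rw [arm_one γ hv₀, hΦ]
  rw [this _ (hn n le_rfl), h, mul_one] at hw
  exact mul_eq_right.1 hw

end Walk

/-- A simple loop in the kernel gives a simple edge cycle of a refinement in the kernel, on which
the fundamental groupoid of the surface is not trivial. -/
theorem exists_edge_cycle {X : Type u} [TopologicalSpace X] [PathConnectedSpace X]
    {S : ClosedOrientedSurface} (f : C(S.Carrier, X)) {x : S.Carrier} (γ : Path x x)
    (hinj : Set.InjOn γ (Set.Ico 0 1))
    (htriv : (FundamentalGroupoid.map f).map (cls γ) = 𝟙 _) (hne : cls γ ≠ 𝟙 _) :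
    ∃ (Q : Refinement.{u} S) (ν : Equiv.Perm Q.T.V), ν.IsCycle ∧
      (∀ v ∈ ν.support, ∃ c, Q.T.orient.R v (ν v) c) ∧
      (∀ v ∈ ν.support, ν (ν v) ≠ v) ∧
      (∃ (x₀ : X) (φ : ∀ v, FundamentalGroupoid.mk x₀ ⟶ FundamentalGroupoid.mk (f (Q.h (pt v)))),
        ∀ v ∈ ν.support, ∀ hf : SameFace (pt v : Q.T.Carrier) (pt (ν v)),
          φ v ≫ cls ((seg _ _ hf).map (f.continuous.comp Q.h.continuous)) = φ (ν v)) ∧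
      ∃ (G : Type) (_ : Group G) (l : Q.T.V → Q.T.V → G),
        (∀ a b c, Q.T.orient.R a b c → l b a = (l a b)⁻¹) ∧
        (∀ a b c, Q.T.orient.R a b c → l a b * l b c * l c a = 1) ∧
        ¬ ∃ k : Q.T.V → G, ∀ v ∈ ν.support, k v * l v (ν v) = k (ν v) := by
  obtain ⟨ε, hε, htol⟩ := exists_tolerance (γ : C(I, S.Carrier)) hinj (by simp)
  obtain ⟨Q, hQ⟩ := Refinement.exists_meshLE.{u} S (pow_pos hε 2)
  obtain ⟨x, rfl⟩ := Q.h.surjective x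
  let δ : Path x x :=
    { toFun := fun t => Q.h.symm (γ t)
      continuous_toFun := Q.h.symm.continuous.comp γ.continuous
      source' := by simp
      target' := by simp }
  have hδ : ∀ s, Q.h (δ s) = γ s := fun s => Q.h.apply_symm_apply _
  have hmap : δ.map Q.h.continuous = γ := by ext s; exact hδ s
  let g : C(Q.T.Carrier, X) := f.comp (Q.h : C(Q.T.Carrier, S.Carrier))
  have htriv' : (FundamentalGroupoid.map g).map (cls δ) = 𝟙 _ := by
    rw [← hmap] at htriv
    exact htriv
  have hne' : cls δ ≠ 𝟙 _ := by
    intro h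
    apply hne
    have h2 := congrArg (FundamentalGroupoid.map (Q.h : C(Q.T.Carrier, S.Carrier))).map h
    rw [CategoryTheory.Functor.map_id] at h2
    rw [← hmap]
    exact h2
  have harm := fun {s t : I} {v : Q.T.V} => Q.map_arm_eq (s := s) (t := t) (v := v) g δ hε hQ
    (by simp only [hδ]; exact htol) htriv'
  obtain ⟨G, _, Φ, hΦ, hΦ1⟩ := exists_hom_to_group (FundamentalGroupoid.mk x)
  obtain ⟨ν, hν1, hν2, hν3, hν4⟩ := exists_cycle_of_holonomy (E := traceGraph δ) (l := edgeLabel Φ)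
    (fun u v ⟨huv, s, hu, hv⟩ => by
      obtain ⟨w, hw⟩ := exists_R_of_pos hu hv huv
      exact edgeLabel_swap hΦ hw)
    (exists_walk_holonomy δ hΦ (fun h => hne' (hΦ1 _ h)))
  refine ⟨Q, ν, hν1, ?_, hν3, ?_, G, _, edgeLabel Φ, fun a b c h => edgeLabel_swap hΦ h,
    fun a b c h => edgeLabel_cocycle hΦ h, hν4⟩
  · intro v hv
    obtain ⟨huv, s, hu, hv⟩ := hν2 v hv
    exact exists_R_of_pos hu hv huv
  -- In `X` the class of the arm to `v` does not depend on the time, so it serves as a path from the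
  -- base point to the image of `v`. Vertices whose open star misses the loop get an arbitrary path.
  · have hφ : ∀ v, ∃ m : FundamentalGroupoid.mk (g x) ⟶ FundamentalGroupoid.mk (g (pt v)),
        ∀ s (hs : 0 < (δ s).1 v), (FundamentalGroupoid.map g).map (arm δ s v hs) = m := by
      intro v
      by_cases h : ∃ s, 0 < (δ s).1 v
      · obtain ⟨s, hs⟩ := h
        exact ⟨_, fun t ht => harm ht hs⟩
      · exact ⟨cls (PathConnectedSpace.somePath _ _), fun s hs => absurd ⟨s, hs⟩ h⟩
    choose φ hφ using hφ
    refine ⟨g x, φ, fun v hv hf => ?_⟩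
    obtain ⟨huv, s, hu, hv⟩ := hν2 v hv
    rw [← hφ v s hu, ← hφ (ν v) s hv, ← arm_edge δ s hu hv hf, Functor.map_comp]
    rfl

end ClosedOrientedSurface

/-! ### Links as directed cycles, and the two sides of an edge cycle -/

namespace OrTri

variable {V : Type} (O : OrTri V)

lemma pred_unique {v x x' y : V} (h : O.R v x y) (h' : O.R v x' y) : x = x' :=
  O.uniq (O.cyc (O.cyc h)) (O.cyc (O.cyc h'))

lemma exists_pred {v x y : V} (h : O.R v x y) : ∃ w, O.R v w x := by
  obtain ⟨w, hw⟩ := O.opp h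
  exact ⟨w, O.cyc hw⟩

/-- Every link is a directed cycle. -/
lemma link_reach [Finite V] {v x x' y y' : V} (hx : O.R v x x') (hy : O.R v y y') :
    Relation.ReflTransGen (O.R v) x y := by
  have hsucc : ∀ z, Relation.ReflTransGen (O.R v) x z → ∃ z', O.R v z z' := by
    intro z hz
    rcases Relation.ReflTransGen.cases_tail hz with rfl | ⟨w, -, hw⟩
    · exact ⟨_, hx⟩
    · obtain ⟨d, hd⟩ := O.opp (O.cyc (O.cyc hw))
      exact ⟨d, hd⟩
  choose! s hs using hsucc
  let A : Set V := {z | Relation.ReflTransGen (O.R v) x z}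
  have hmaps : Set.MapsTo s A A := fun z hz => hz.tail (hs z hz)
  have hinj : Set.InjOn s A := fun z hz w hw h => O.pred_unique (h ▸ hs z hz) (hs w hw)
  -- An injective self-map of a finite set is onto, so the forward orbit of `x` is closed under
  -- predecessors too and, by connectedness, is the whole link.
  have hsurj : Set.SurjOn s A A := by
    have := (Set.toFinite A).injOn_iff_bijOn_of_mapsTo hmaps
    exact (this.1 hinj).surjOn
  have hback : ∀ z w, O.R v w z → z ∈ A → w ∈ A := by
    intro z w hwz hz
    obtain ⟨w', hw', rfl⟩ := hsurj hz
    rwa [O.pred_unique hwz (hs w' hw')]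
  exact O.link v (· ∈ A) (fun a b hab => ⟨fun h => Relation.ReflTransGen.tail h hab,
    hback _ _ hab⟩) _ _ _ _ hx hy Relation.ReflTransGen.refl

variable (ν : Equiv.Perm V)

/-- The arc of the link of `v` from `p` on, before `q`. -/
def Arc (v p q x : V) : Prop := Relation.ReflTransGen (fun x y => O.R v x y ∧ y ≠ q) p x

variable {O}

lemma Arc.not_end {v p q : V} (hpq : p ≠ q) : ¬ O.Arc v p q q := by
  intro h
  rcases Relation.ReflTransGen.cases_tail h with h | ⟨_, _, h⟩
  · exact hpq h.symm
  · exact h.2 rfl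

/-- Membership in an arc can change only at its ends: elsewhere a step forward stays inside, and
predecessors in the link are unique. -/
lemma Arc.congr {v p q x y : V} (h : O.R v x y) (hp : y ≠ p) (hq : y ≠ q) :
    O.Arc v p q x ↔ O.Arc v p q y := by
  constructor
  · exact fun h' => h'.tail ⟨h, hq⟩
  · intro h'
    rcases Relation.ReflTransGen.cases_tail h' with h' | ⟨w, hw, h'⟩
    · exact absurd h' hp
    · rwa [O.pred_unique h h'.1]

/-- A walk around the link from `p` to `q` stays in the arc until it meets `q`, and it can enter `q`
only from the unique predecessor `x`. -/
lemma Arc.last [Finite V] {v p p' q x : V} (hp : O.R v p p') (h : O.R v x q) : O.Arc v p q x := by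
  have : ∀ y, Relation.ReflTransGen (O.R v) p y → O.Arc v p q y ∨ O.Arc v p q x := by
    intro y hy
    induction hy with
    | refl => exact .inl .refl
    | @tail y z _ hyz ih =>
      rcases ih with ih | ih
      · by_cases hz : z = q
        · subst hz
          right
          rwa [O.pred_unique h hyz]
        · exact .inl (ih.tail ⟨hyz, hz⟩)
      · exact .inr ih
  exact (or_self_iff.1 (this x (O.link_reach hp h)))

/-- If the predecessor of `p` lay in the arc, tracing the link backwards from it would never leave
the arc and would reach `q`, which the arc excludes. -/
lemma Arc.not_before [Finite V] {v p q q' x : V} (hpq : p ≠ q) (hq : O.R v q q')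
    (h : O.R v x p) : ¬ O.Arc v p q x := by
  intro hx
  have : ∀ y, Relation.ReflTransGen (O.R v) y x → O.Arc v p q y := by
    intro y hy
    induction hy using Relation.ReflTransGen.head_induction_on with
    | refl => exact hx
    | @head y z hyz _ ih =>
      by_cases hz : z = p
      · subst hz
        rwa [O.pred_unique hyz h]
      · rcases Relation.ReflTransGen.cases_tail ih with h' | ⟨w, hw, h'⟩
        · exact absurd h' hz
        · rwa [O.pred_unique hyz h'.1]
  exact Arc.not_end hpq (this q (O.link_reach hq h))

/-- Going round the link from `q`, one is always in the arc last entered, at `p` or at `q`. -/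
lemma Arc.or [Finite V] {v p q q' x x' : V} (hq : O.R v q q') (hx : O.R v x x') :
    O.Arc v p q x ∨ O.Arc v q p x := by
  have := O.link_reach hq hx
  clear hx
  induction this with
  | refl => exact .inr .refl
  | @tail y z _ hyz ih =>
    rcases ih with h | h
    · by_cases hz : z = q
      · subst hz; exact .inr .refl
      · exact .inl (h.tail ⟨hyz, hz⟩)
    · by_cases hz : z = p
      · subst hz; exact .inl .refl
      · exact .inr (h.tail ⟨hyz, hz⟩)

/-- A simple edge cycle of an oriented triangulation. -/
structure IsEdgeCycle (O : OrTri V) (ν : Equiv.Perm V) : Prop where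
  sameCycle : ∀ x y, ν x ≠ x → ν y ≠ y → ν.SameCycle x y
  ne_id : ∃ x, ν x ≠ x
  adj : ∀ v, ν v ≠ v → ∃ c, O.R v (ν v) c
  ne_symm : ∀ v, ν v ≠ v → ν (ν v) ≠ v

variable (O) in
open Classical in
/-- The side of the corner of `v` that starts at `x`: `true` if it lies to the right of the
cycle `ν`. -/
noncomputable def side (v x : V) : Bool := decide (ν v ≠ v ∧ ¬ O.Arc v (ν v) (ν.symm v) x)

variable {ν}

lemma side_eq_false_of_fixed {v x : V} (h : ν v = v) : O.side ν v x = false := by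
  simp [side, h]

lemma symm_ne {v : V} (h : ν v ≠ v) : ν.symm v ≠ v := fun h' =>
  h (by rw [← h', Equiv.apply_symm_apply, h'])

/-- Crossing an edge at `v` that is not on the cycle does not change sides; crossing a cycle edge
does, by `side_next` and `side_prev`. -/
lemma side_congr {v x y : V} (h : O.R v x y) (h1 : y ≠ ν v) (h2 : ν y ≠ v) :
    O.side ν v x = O.side ν v y := by
  have h2' : y ≠ ν.symm v := by rintro rfl; exact h2 (ν.apply_symm_apply v)
  simp [side, Arc.congr h h1 h2']

namespace IsEdgeCycle

variable (hν : O.IsEdgeCycle ν)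
include hν

lemma next_ne_prev {v : V} (h : ν v ≠ v) : ν v ≠ ν.symm v := by
  intro h'
  apply hν.ne_symm v h
  rw [h', Equiv.apply_symm_apply]

lemma adj_prev {v : V} (h : ν v ≠ v) : ∃ c, O.R v (ν.symm v) c := by
  obtain ⟨c, hc⟩ := hν.adj (ν.symm v) (by rw [Equiv.apply_symm_apply]; exact (symm_ne h).symm)
  rw [Equiv.apply_symm_apply] at hc
  exact O.opp hc

variable [Finite V]

lemma side_next {v x y : V} (h : O.R v x y) (hy : y = ν v) :
    O.side ν v x = true ∧ O.side ν v y = false := by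
  subst hy
  have hv : ν v ≠ v := (O.ne' h).2.2.symm
  obtain ⟨c, hc⟩ := hν.adj_prev hv
  have h1 := Arc.not_before (hν.next_ne_prev hv) hc h
  have h2 : O.Arc v (ν v) (ν.symm v) (ν v) := .refl
  simp [side, hv, h1, h2]

lemma side_prev {v x y : V} (h : O.R v x y) (hy : ν y = v) :
    O.side ν v x = false ∧ O.side ν v y = true := by
  have hy' : y = ν.symm v := by rw [← hy, Equiv.symm_apply_apply]
  have hv : ν v ≠ v := by
    intro hf
    have : ν y = ν v := by rw [hy, hf]
    exact (O.ne' h).2.2.symm (ν.injective this)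
  subst hy'
  obtain ⟨c, hc⟩ := hν.adj v hv
  have h1 := Arc.last hc h
  have h2 : ¬ O.Arc v (ν v) (ν.symm v) (ν.symm v) := Arc.not_end (hν.next_ne_prev hv)
  simp [side, hv, h1, h2]

/-- The corners on one side of the cycle are consecutive. -/
lemma side_arc {v x x' : V} (hv : ν v ≠ v) (hx : O.R v x x') :
    (O.side ν v x = false → O.Arc v (ν v) (ν.symm v) x) ∧
    (O.side ν v x = true → O.Arc v (ν.symm v) (ν v) x) := by
  obtain ⟨c, hc⟩ := hν.adj_prev hv
  have := Arc.or (p := ν v) hc hx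
  simp only [side, hv, ne_eq, not_false_eq_true, true_and, decide_eq_false_iff_not, not_not,
    decide_eq_true_eq]
  exact ⟨id, fun h => this.resolve_left h⟩

end IsEdgeCycle

end OrTri

/-! ### Cutting along an edge cycle and coning off -/

/-- The vertices of the surface cut along a cycle, with two cones attached: two copies of every
vertex, one for each side, and two cone points. -/
inductive CutVertex (V : Type) : Type
| old (v : V) (s : Bool)
| cone (s : Bool)

namespace CutVertex

variable {V : Type}

/-- The order key: old vertices come first, in the given order. -/
def key : CutVertex V → WithTop V ×ₗ Bool
| old v s => toLex (v, s)
| cone s => toLex (⊤, s)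

lemma key_injective : Function.Injective (key : CutVertex V → _) := by
  rintro (⟨v, s⟩ | s) (⟨w, t⟩ | t) h <;> simp_all [key]

instance [Finite V] : Finite (CutVertex V) :=
  Finite.of_injective (fun p => (ofLex (key p) : Option V × Bool)) fun _ _ h =>
    key_injective h

noncomputable instance [LinearOrder V] : LinearOrder (CutVertex V) :=
  LinearOrder.lift' key key_injective

lemma old_lt_old [LinearOrder V] {v w : V} (h : v < w) (s t : Bool) : old v s < old w t := by
  change key (old v s) < key (old w t)
  rw [key, key, Prod.Lex.toLex_lt_toLex]
  exact .inl (WithTop.coe_lt_coe.2 h)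

lemma old_lt_cone [LinearOrder V] (v : V) (s t : Bool) : old v s < cone t := by
  change key (old v s) < key (cone t)
  rw [key, key, Prod.Lex.toLex_lt_toLex]
  exact .inl (WithTop.coe_lt_top v)

/-- The vertices that occur: the second copy exists only along the cycle. -/
def Used (ν : Equiv.Perm V) : CutVertex V → Prop
| old v s => s = true → ν v ≠ v
| cone _ => True

end CutVertex

namespace OrTri

open CutVertex

variable {V : Type} {O : OrTri V} {ν : Equiv.Perm V}

/-- The boundary edges on the side `s`, oriented as in the cone. -/
def coneEdge (ν : Equiv.Perm V) (s : Bool) (b c : V) : Prop :=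
  -- Lifted triangles left of the cycle (`false`) traverse the edge from `v` to `ν v`, so the cap on
  -- that side must traverse it backwards; on the right it is the other way round.
  b ≠ c ∧ (s = false → b = ν c) ∧ (s = true → c = ν b)

variable (O ν) in
/-- The oriented triangles of the surface cut along `ν` and capped off. -/
def cutR : CutVertex V → CutVertex V → CutVertex V → Prop
| old a i, old b j, old c k => O.R a b c ∧ i = O.side ν a b ∧ j = O.side ν b c ∧ k = O.side ν c a
| cone s, old b j, old c k => coneEdge ν s b c ∧ j = s ∧ k = s
| old a i, cone s, old c k => coneEdge ν s c a ∧ k = s ∧ i = s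
| old a i, old b j, cone s => coneEdge ν s a b ∧ i = s ∧ j = s
| _, _, _ => False

lemma cutR_cyc {p q r : CutVertex V} (h : O.cutR ν p q r) : O.cutR ν q r p := by
  rcases p with ⟨a, i⟩ | i <;> rcases q with ⟨b, j⟩ | j <;> rcases r with ⟨c, k⟩ | k <;>
    first
    | exact h
    | exact h.elim
    | exact ⟨O.cyc h.1, h.2.2.1, h.2.2.2, h.2.1⟩

lemma cutR_ne {p q r : CutVertex V} (h : O.cutR ν p q r) : p ≠ q := by
  rcases p with ⟨a, i⟩ | i <;> rcases q with ⟨b, j⟩ | j <;> rcases r with ⟨c, k⟩ | k <;>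
    first
    | exact h.elim
    | exact fun h' => O.ne h.1 (CutVertex.old.inj h').1
    | exact fun h' => h.1.1 (CutVertex.old.inj h').1
    | exact fun h' => by injection h'

lemma coneEdge.ne_left {s : Bool} {b c : V} (h : coneEdge ν s b c) : ν b ≠ b := by
  obtain ⟨h1, h2, h3⟩ := h
  cases s
  · intro hb
    have := h2 rfl
    rw [this] at hb
    exact h1 (this.trans (ν.injective hb))
  · rw [← h3 rfl]; exact h1.symm

lemma coneEdge.ne_right {s : Bool} {b c : V} (h : coneEdge ν s b c) : ν c ≠ c := by
  obtain ⟨h1, h2, h3⟩ := h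
  cases s
  · rw [← h2 rfl]; exact h1
  · intro hb
    have := h3 rfl
    rw [this] at hb
    exact h1 ((ν.injective hb).symm.trans this.symm)

lemma coneEdge.left_unique {s : Bool} {b b' c : V} (h : coneEdge ν s b c)
    (h' : coneEdge ν s b' c) : b = b' := by
  cases s
  · rw [h.2.1 rfl, h'.2.1 rfl]
  · exact ν.injective ((h.2.2 rfl).symm.trans (h'.2.2 rfl))

lemma coneEdge.right_unique {s : Bool} {b c c' : V} (h : coneEdge ν s b c)
    (h' : coneEdge ν s b c') : c = c' := by
  cases s
  · exact ν.injective ((h.2.1 rfl).symm.trans (h'.2.1 rfl))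
  · rw [h.2.2 rfl, h'.2.2 rfl]

lemma coneEdge.exists_left {c : V} (hc : ν c ≠ c) (s : Bool) : ∃ b, coneEdge ν s b c := by
  cases s
  · exact ⟨ν c, hc, fun _ => rfl, by simp⟩
  · exact ⟨ν.symm c, symm_ne hc, by simp, fun _ => by simp⟩

lemma coneEdge.exists_right {b : V} (hb : ν b ≠ b) (s : Bool) : ∃ c, coneEdge ν s b c := by
  cases s
  · exact ⟨ν.symm b, (symm_ne hb).symm, fun _ => by simp, by simp⟩
  · exact ⟨ν b, hb.symm, by simp, fun _ => rfl⟩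

lemma cutR_used {p q r : CutVertex V} (h : O.cutR ν p q r) : p.Used ν := by
  have hside : ∀ {a b : V}, O.side ν a b = true → ν a ≠ a := by
    intro a b h hf
    rw [side_eq_false_of_fixed hf] at h
    exact Bool.false_ne_true h
  rcases p with ⟨a, i⟩ | i <;> rcases q with ⟨b, j⟩ | j <;> rcases r with ⟨c, k⟩ | k <;>
    first
    | exact h.elim
    | trivial
    | exact fun hi => hside (h.2.1.symm.trans hi)
    | exact fun _ => h.1.ne_left
    | exact fun _ => h.1.ne_right

/-- At an edge off the cycle both adjacent triangles use the same copies of its ends, so their lifts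
still share that edge. -/
lemma side_eq_side {a b c : V} (h : O.R a b c) (h1 : b ≠ ν a) (h2 : a ≠ ν b) :
    O.side ν b a = O.side ν b c :=
  (side_congr (O.cyc h) h2 h1.symm).symm

lemma eq_of_coneEdge {s : Bool} {v p q x : V} (hp : coneEdge ν s p v) (hq : coneEdge ν s v q) :
    (x = ν v → x = p ∨ x = q) ∧ (v = ν x → x = p ∨ x = q) := by
  cases s
  · have h1 := hp.2.1 rfl
    have h2 := hq.2.1 rfl
    exact ⟨fun h => .inl (h.trans h1.symm), fun h => .inr (ν.injective (h.symm.trans h2))⟩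
  · have h1 := hp.2.2 rfl
    have h2 := hq.2.2 rfl
    exact ⟨fun h => .inr (h.trans h2.symm), fun h => .inl (ν.injective (h.symm.trans h1))⟩

/-- A vertex off the cycle has a single copy and meets no cap. Its link is the old one, with each
vertex replaced by the copy that faces `a`. -/
lemma cutR_link_fixed {a : V} (ha : ν a = a) {i : Bool} (A : CutVertex V → Prop)
    (hA : ∀ x y, O.cutR ν (old a i) x y → (A x ↔ A y)) :
    ∃ P : Prop, ∀ x y, O.cutR ν (old a i) x y → (A x ↔ P) := by
  by_cases hi : i = true
  · exact ⟨True, fun x y h => absurd ha (cutR_used h hi)⟩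
  have hi : i = false := by simpa using hi
  subst hi
  have hne : ∀ {b c}, O.R a b c → b ≠ ν a ∧ a ≠ ν b := by
    intro b c h
    refine ⟨fun h' => O.ne h (h'.trans ha).symm, fun h' => O.ne h (ν.injective (ha.trans h'))⟩
  have hB : ∀ x y, O.R a x y → (A (old x (O.side ν x a)) ↔ A (old y (O.side ν y a))) := by
    intro x y h
    obtain ⟨h1, h2⟩ := hne h
    rw [side_eq_side h h1 h2]
    exact hA _ _ ⟨h, (side_eq_false_of_fixed ha).symm, rfl, rfl⟩
  obtain ⟨b₀, c₀, h₀⟩ := O.cover a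
  refine ⟨A (old b₀ (O.side ν b₀ a)), fun x y h => ?_⟩
  rcases x with ⟨b, j⟩ | j <;> rcases y with ⟨c, k⟩ | k
  · obtain ⟨h1, h2, h3, h4⟩ := h
    rw [h3, ← side_eq_side h1 (hne h1).1 (hne h1).2]
    exact ⟨O.link a (fun x => A (old x (O.side ν x a))) hB _ _ _ _ h1 h₀,
      O.link a (fun x => A (old x (O.side ν x a))) hB _ _ _ _ h₀ h1⟩
  · exact absurd ha h.1.ne_left
  · exact absurd ha h.1.ne_right
  · exact h.elim

namespace IsEdgeCycle

section

variable (hν : O.IsEdgeCycle ν)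
include hν

/-- This is where cycles of length two must be excluded: their cap would traverse the same edge both
ways. -/
lemma not_coneEdge_swap {s : Bool} {b c : V} (h : coneEdge ν s b c) : ¬ coneEdge ν s c b := by
  intro h'
  have hb := h.ne_left
  cases s
  · exact hν.ne_symm b hb ((congrArg ν (h'.2.1 rfl).symm).trans (h.2.1 rfl).symm)
  · exact hν.ne_symm b hb ((congrArg ν (h.2.2 rfl).symm).trans (h'.2.2 rfl).symm)

lemma coneEdge_R {s : Bool} {a b : V} (he : coneEdge ν s b a) :
    ∃ c d, O.R a b c ∧ O.R b a d := by
  cases s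
  · obtain ⟨c, hc⟩ := hν.adj a he.ne_right
    rw [← he.2.1 rfl] at hc
    obtain ⟨d, hd⟩ := O.opp hc
    exact ⟨c, d, hc, hd⟩
  · obtain ⟨d, hd⟩ := hν.adj b he.ne_left
    rw [← he.2.2 rfl] at hd
    obtain ⟨c, hc⟩ := O.opp hd
    exact ⟨c, d, hc, hd⟩

lemma cutR_not_swap {p q r : CutVertex V} (h : O.cutR ν p q r) : ¬ O.cutR ν q p r := by
  rcases p with ⟨a, i⟩ | i <;> rcases q with ⟨b, j⟩ | j <;> rcases r with ⟨c, k⟩ | k <;>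
    first
    | exact h.elim
    | exact fun h' => O.not_swap h.1 h'.1
    | exact fun h' => hν.not_coneEdge_swap h.1 h'.1

lemma cutR_cover {p : CutVertex V} (hp : p.Used ν) : ∃ q r, O.cutR ν p q r := by
  rcases p with ⟨v, s⟩ | s
  · by_cases hv : ν v = v
    · have hs : s = false := by
        cases s with
        | false => rfl
        | true => exact absurd hv (hp rfl)
      obtain ⟨b, c, h⟩ := O.cover v
      exact ⟨.old b _, .old c _, h, hs.trans (side_eq_false_of_fixed hv).symm, rfl, rfl⟩
    · obtain ⟨c, hc⟩ := coneEdge.exists_right hv s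
      exact ⟨.old c s, .cone s, hc, rfl, rfl⟩
  · obtain ⟨x, hx⟩ := hν.ne_id
    obtain ⟨c, hc⟩ := coneEdge.exists_right hx s
    exact ⟨.old x s, .old c s, hc, rfl, rfl⟩

end

variable [Finite V] (hν : O.IsEdgeCycle ν)
include hν

/-- A lifted edge is not a boundary edge of the same side in the same direction. -/
lemma not_coneEdge_of_R {a b c : V} (h : O.R a b c) :
    ¬ coneEdge ν (O.side ν a b) a b := by
  intro hc
  obtain ⟨d, hd⟩ := O.exists_pred h
  cases hs : O.side ν a b with
  | false =>
    rw [hs] at hc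
    have := (hν.side_prev hd (hc.2.1 rfl).symm).2
    rw [hs] at this
    exact Bool.false_ne_true this
  | true =>
    rw [hs] at hc
    have := (hν.side_next hd (hc.2.2 rfl)).2
    rw [hs] at this
    exact Bool.false_ne_true this.symm

lemma cutR_uniq {p q r r' : CutVertex V} (h : O.cutR ν p q r) (h' : O.cutR ν p q r') : r = r' := by
  rcases p with ⟨a, i⟩ | i <;> rcases q with ⟨b, j⟩ | j <;> rcases r with ⟨c, k⟩ | k <;>
    rcases r' with ⟨d, l⟩ | l <;>
    first
    | exact h.elim
    | exact h'.elim
    | skip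
  · obtain ⟨h1, h2, h3, h4⟩ := h
    obtain ⟨h1', h2', h3', h4'⟩ := h'
    obtain rfl := O.uniq h1 h1'
    rw [h4, h4']
  · obtain ⟨h1, h2, h3, h4⟩ := h
    obtain ⟨h1', h2', h3'⟩ := h'
    refine absurd h1' ?_
    rw [← h2', h2]
    exact hν.not_coneEdge_of_R h1
  · obtain ⟨h1, h2, h3, h4⟩ := h'
    obtain ⟨h1', h2', h3'⟩ := h
    refine absurd h1' ?_
    rw [← h2', h2]
    exact hν.not_coneEdge_of_R h1
  · rw [← h.2.1, ← h'.2.1]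
  · obtain ⟨h1, h2, h3⟩ := h
    obtain ⟨h1', h2', h3'⟩ := h'
    rw [h1.left_unique h1', h2, h2']
  · obtain ⟨h1, h2, h3⟩ := h
    obtain ⟨h1', h2', h3'⟩ := h'
    rw [h1.right_unique h1', h3, h3']

lemma side_of_coneEdge {s : Bool} {a b c d : V} (he : coneEdge ν s b a) (h : O.R a b c)
    (h' : O.R b a d) : O.side ν a b = s ∧ O.side ν b c = s := by
  have h1 := O.cyc h'
  have h2 := O.cyc h
  cases s
  · exact ⟨(hν.side_next h1 (he.2.1 rfl)).2, (hν.side_prev h2 (he.2.1 rfl).symm).1⟩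
  · exact ⟨(hν.side_prev h1 (he.2.2 rfl).symm).2, (hν.side_next h2 (he.2.2 rfl)).1⟩

/-- Across an edge off the cycle lies the lift of the old neighbour, across a lifted cycle edge a
cap triangle, across the base of a cap triangle a lifted one, and across a spoke the adjacent
triangle of the same cap. -/
lemma cutR_opp {p q r : CutVertex V} (h : O.cutR ν p q r) : ∃ r', O.cutR ν q p r' := by
  rcases p with ⟨a, i⟩ | i <;> rcases q with ⟨b, j⟩ | j <;> rcases r with ⟨c, k⟩ | k <;>
    first
    | exact h.elim
    | skip
  · obtain ⟨h1, rfl, rfl, rfl⟩ := h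
    obtain ⟨d, hd⟩ := O.opp h1
    by_cases hb : b = ν a
    · have he : coneEdge ν false b a := ⟨(O.ne h1).symm, fun _ => hb, by simp⟩
      obtain ⟨e1, e2⟩ := hν.side_of_coneEdge he h1 hd
      exact ⟨.cone false, he, e2, e1⟩
    by_cases ha : a = ν b
    · have he : coneEdge ν true b a := ⟨(O.ne h1).symm, by simp, fun _ => ha⟩
      obtain ⟨e1, e2⟩ := hν.side_of_coneEdge he h1 hd
      exact ⟨.cone true, he, e2, e1⟩
    exact ⟨.old d (O.side ν d b), hd, (side_eq_side h1 hb ha).symm,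
      side_eq_side hd ha hb, rfl⟩
  · obtain ⟨he, h2, h3⟩ := h
    obtain ⟨c, d, h4, h5⟩ := hν.coneEdge_R he
    obtain ⟨e1, e2⟩ := hν.side_of_coneEdge he h4 h5
    exact ⟨.old c (O.side ν c b), h4, h3.trans e1.symm, h2.trans e2.symm, rfl⟩
  · obtain ⟨he, h2, h3⟩ := h
    obtain ⟨d, hd⟩ := coneEdge.exists_right he.ne_right j
    exact ⟨.old d j, hd, h3, rfl⟩
  · obtain ⟨he, h2, h3⟩ := h
    obtain ⟨d, hd⟩ := coneEdge.exists_left he.ne_left i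
    exact ⟨.old d i, hd, rfl, h2⟩

lemma side_arc' {s : Bool} {v p q x x' : V} (hp : coneEdge ν s p v) (hq : coneEdge ν s v q)
    (hx : O.R v x x') (hs : O.side ν v x = s) : O.Arc v p q x := by
  have hv := hp.ne_right
  cases s
  · have h1 : q = ν.symm v := by rw [hq.2.1 rfl, Equiv.symm_apply_apply]
    rw [hp.2.1 rfl, h1]
    exact (hν.side_arc hv hx).1 hs
  · have h1 : p = ν.symm v := by rw [hp.2.2 rfl, Equiv.symm_apply_apply]
    rw [hq.2.2 rfl, h1]
    exact (hν.side_arc hv hx).2 hs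

/-- The link of a cone point is a copy of the cycle, connected because all moved vertices lie in one
orbit of `ν`. -/
lemma cutR_link_cone (s : Bool) (A : CutVertex V → Prop)
    (hA : ∀ x y, O.cutR ν (cone s) x y → (A x ↔ A y)) {x y : V} (hx : ν x ≠ x) (hy : ν y ≠ y) :
    A (old x s) ↔ A (old y s) := by
  have hstep : ∀ w, A (old w s) ↔ A (old (ν w) s) := by
    intro w
    by_cases hw : ν w = w
    · rw [hw]
    cases s
    · exact (hA (old (ν w) false) (old w false) ⟨⟨hw, fun _ => rfl, by simp⟩, rfl, rfl⟩).symm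
    · exact hA (old w true) (old (ν w) true) ⟨⟨fun h => hw h.symm, by simp, fun _ => rfl⟩, rfl, rfl⟩
  obtain ⟨n, -, hn⟩ := (hν.sameCycle x y hx hy).exists_pow_eq'
  have : ∀ n : ℕ, A (old x s) ↔ A (old ((ν ^ n) x) s) := by
    intro n
    induction n with
    | zero => simp
    | succ n ih => rw [ih, pow_succ', Equiv.Perm.mul_apply]; exact hstep _
  rw [← hn]
  exact this n

/-- The link of one copy of a cycle vertex runs through the corners on that side, from one cycle
neighbour to the other, and closes up through the cone point. Every vertex is compared with the cone
point by induction along the arc. -/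
lemma cutR_link_cycle {a : V} (ha : ν a ≠ a) {s : Bool} (A : CutVertex V → Prop)
    (hA : ∀ x y, O.cutR ν (old a s) x y → (A x ↔ A y)) {x y : CutVertex V}
    (h : O.cutR ν (old a s) x y) : A x ↔ A (cone s) := by
  obtain ⟨p, hp⟩ := coneEdge.exists_left ha s
  obtain ⟨q, hq⟩ := coneEdge.exists_right ha s
  have hbase : ∀ y, O.R a p y → O.side ν a p = s ∧ (A (old p (O.side ν p y)) ↔ A (cone s)) := by
    intro y hy
    obtain ⟨d, hd⟩ := O.opp hy
    obtain ⟨e1, e2⟩ := hν.side_of_coneEdge hp hy hd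
    rw [e2]
    exact ⟨e1, (hA (cone s) (old p s) ⟨hp, rfl, rfl⟩).symm⟩
  have key : ∀ x, O.Arc a p q x → ∀ y, O.R a x y →
      O.side ν a x = s ∧ (A (old x (O.side ν x y)) ↔ A (cone s)) := by
    intro x hx
    induction hx with
    | refl => exact hbase
    | @tail z x _ hzx ih =>
      intro y hy
      by_cases hxp : x = p
      · subst hxp; exact hbase y hy
      obtain ⟨h1, h2⟩ := ih x hzx.1
      obtain ⟨f1, f2⟩ := eq_of_coneEdge hp hq (x := x)
      have hx1 : x ≠ ν a := fun h => (f1 h).elim hxp hzx.2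
      have hx2 : a ≠ ν x := fun h => (f2 h).elim hxp hzx.2
      refine ⟨(side_congr hzx.1 hx1 hx2.symm).symm.trans h1, ?_⟩
      rw [← h2, ← side_eq_side hy hx1 hx2]
      exact (hA (old z (O.side ν z x)) (old x (O.side ν x a)) ⟨hzx.1, h1.symm, rfl, rfl⟩).symm
  rcases x with ⟨b, j⟩ | j <;> rcases y with ⟨c, k⟩ | k
  · obtain ⟨h1, h2, h3, h4⟩ := h
    rw [h3]
    exact (key b (hν.side_arc' hp hq h1 h2.symm) c h1).2
  · have := hA _ _ h
    rwa [← h.2.1] at this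
  · rw [h.2.2]
  · exact h.elim

lemma cutR_link (p : CutVertex V) (A : CutVertex V → Prop)
    (hA : ∀ x y, O.cutR ν p x y → (A x ↔ A y)) (x y x' y' : CutVertex V)
    (hx : O.cutR ν p x x') (hy : O.cutR ν p y y') (h : A x) : A y := by
  rcases p with ⟨a, i⟩ | s
  · by_cases ha : ν a = a
    · obtain ⟨P, hP⟩ := cutR_link_fixed ha A hA
      rwa [hP _ _ hy, ← hP _ _ hx]
    · rwa [hν.cutR_link_cycle ha A hA hy, ← hν.cutR_link_cycle ha A hA hx]
  · rcases x with ⟨x, i⟩ | i <;> rcases x' with ⟨x', i'⟩ | i' <;> rcases y with ⟨y, j⟩ | j <;>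
      rcases y' with ⟨y', j'⟩ | j' <;>
      first
      | exact hx.elim
      | exact hy.elim
      | skip
    obtain ⟨h1, rfl, -⟩ := hx
    obtain ⟨h2, rfl, -⟩ := hy
    exact (hν.cutR_link_cone _ A hA h1.ne_left h2.ne_left).1 h

end IsEdgeCycle

/-- An oriented triangulation on the vertices with the property `P`. -/
def ofRel {U : Type} (R : U → U → U → Prop) (P : U → Prop)
    (hP : ∀ {a b c}, R a b c → P a → P b) (cyc : ∀ {a b c}, R a b c → R b c a)
    (ne : ∀ {a b c}, R a b c → a ≠ b) (uniq : ∀ {a b c d}, R a b c → R a b d → c = d)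
    (opp : ∀ {a b c}, R a b c → ∃ d, R b a d) (not_swap : ∀ {a b c}, R a b c → ¬ R b a c)
    (cover : ∀ {a}, P a → ∃ b c, R a b c)
    (link : ∀ v (A : U → Prop), (∀ x y, R v x y → (A x ↔ A y)) →
      ∀ x y x' y', R v x x' → R v y y' → A x → A y) : OrTri {p // P p} where
  R a b c := R a.1 b.1 c.1
  cyc h := cyc h
  ne h h' := ne h (congrArg Subtype.val h')
  uniq h h' := Subtype.ext (uniq h h')
  opp {a b c} h := by
    obtain ⟨d, hd⟩ := opp h
    exact ⟨⟨d, hP (cyc hd) a.2⟩, hd⟩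
  not_swap h := not_swap h
  cover a := by
    obtain ⟨b, c, h⟩ := cover a.2
    exact ⟨⟨b, hP h a.2⟩, ⟨c, hP (cyc h) (hP h a.2)⟩, h⟩
  link v A hA x y x' y' hx hy h := by
    have := link v.1 (fun u => ∃ hu : P u, A ⟨u, hu⟩) (fun x y hxy => ?_) x.1 y.1 x'.1 y'.1 hx hy
      ⟨x.2, h⟩
    · exact this.2
    · have h1 := hP hxy v.2
      have h2 := hP (cyc hxy) h1
      have := hA ⟨x, h1⟩ ⟨y, h2⟩ hxy
      exact ⟨fun h => ⟨h2, this.1 h.2⟩, fun h => ⟨h1, this.2 h.2⟩⟩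

/-- The restriction to a union of components. -/
def restrict (O : OrTri V) (A : Set V) (hA : O.Closed A) : OrTri {p // p ∈ A} :=
  ofRel O.R (· ∈ A) (fun h ha => (hA _ _ _ h).1 ha) O.cyc O.ne O.uniq O.opp O.not_swap
    (fun _ => O.cover _) O.link

/-- The surface cut along the cycle `ν` with both boundary circles coned off. -/
def cut [Finite V] (hν : O.IsEdgeCycle ν) : OrTri {p : CutVertex V // p.Used ν} :=
  ofRel (O.cutR ν) (CutVertex.Used ν) (fun h _ => cutR_used (cutR_cyc h)) cutR_cyc cutR_ne
    hν.cutR_uniq hν.cutR_opp hν.cutR_not_swap hν.cutR_cover hν.cutR_link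

end OrTri

/-! ### Euler characteristic and components of the cut surface -/

/-- The set of three given elements of a linear order. -/
def triple {U : Type} [LinearOrder U] (p q r : U) : Finset U := {p, q, r}

lemma mem_triple {U : Type} [LinearOrder U] {p q r x : U} :
    x ∈ triple p q r ↔ x = p ∨ x = q ∨ x = r := by simp [triple]

lemma triple_subset {U : Type} [LinearOrder U] {p q r : U} {A : Set U} :
    (triple p q r : Set U) ⊆ A ↔ p ∈ A ∧ q ∈ A ∧ r ∈ A := by
  simp [triple, Set.insert_subset_iff]

lemma triple_rotate {U : Type} [LinearOrder U] (p q r : U) : triple p q r = triple q r p := by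
  ext; simp only [mem_triple]; tauto

namespace OrTri

open CutVertex

section Cut

variable {V : Type} {O : OrTri V} {ν : Equiv.Perm V}

/-- The vertices of the cut surface. -/
abbrev CutV (ν : Equiv.Perm V) : Type := {p : CutVertex V // p.Used ν}

noncomputable instance [Finite V] : Fintype (CutV ν) := Fintype.ofFinite _

open Classical in
/-- The copy of `v` on the side `s`; off the cycle there is only one. -/
noncomputable def ov (ν : Equiv.Perm V) (v : V) (s : Bool) : CutV ν :=
  ⟨old v (s && decide (ν v ≠ v)), fun h => by simpa using (Bool.and_eq_true_iff.1 h).2⟩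

/-- The cone points. -/
def cn (ν : Equiv.Perm V) (s : Bool) : CutV ν := ⟨cone s, trivial⟩

lemma ov_val {v : V} {s : Bool} (h : s = true → ν v ≠ v) : (ov ν v s).1 = old v s := by
  cases s
  · simp [ov]
  · simp [ov, h rfl]

lemma ov_val_false (v : V) : (ov ν v false).1 = old v false := ov_val (by simp)

lemma ov_val_cycle {v : V} (hv : ν v ≠ v) (s : Bool) : (ov ν v s).1 = old v s := ov_val fun _ => hv

lemma ov_val_side (a b : V) : (ov ν a (O.side ν a b)).1 = old a (O.side ν a b) := by
  refine ov_val fun h hf => ?_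
  rw [side_eq_false_of_fixed hf] at h
  exact Bool.false_ne_true h

lemma ov_of_fixed {v : V} (hv : ν v = v) (s : Bool) : ov ν v s = ov ν v false := by
  simp [ov, hv]

lemma ov_injective {v w : V} {s t : Bool} (h : ov ν v s = ov ν w t) : v = w :=
  (CutVertex.old.inj (congrArg Subtype.val h)).1

lemma ov_injective' {v w : V} {s t : Bool} (hv : ν v ≠ v) (h : ov ν v s = ov ν w t) : s = t := by
  obtain rfl := ov_injective h
  have := congrArg Subtype.val h
  rw [ov_val_cycle hv, ov_val_cycle hv] at this
  exact (CutVertex.old.inj this).2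

lemma ov_ne_cn (v : V) (s t : Bool) : ov ν v s ≠ cn ν t := fun h => by
  have := congrArg Subtype.val h
  simp [ov, cn] at this

lemma cn_injective {s t : Bool} (h : cn ν s = cn ν t) : s = t :=
  CutVertex.cone.inj (congrArg Subtype.val h)

lemma cutV_cases (p : CutV ν) :
    (∃ v, p = ov ν v false) ∨ (∃ v, ν v ≠ v ∧ p = ov ν v true) ∨ ∃ s, p = cn ν s := by
  obtain ⟨⟨v, _ | _⟩ | s, hp⟩ := p
  · exact .inl ⟨v, Subtype.ext (ov_val_false v).symm⟩
  · exact .inr (.inl ⟨v, hp rfl, Subtype.ext (ov_val_cycle (hp rfl) true).symm⟩)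
  · exact .inr (.inr ⟨s, rfl⟩)

lemma ov_lt_ov [LinearOrder V] {v w : V} (h : v < w) (s t : Bool) : ov ν v s < ov ν w t :=
  Subtype.mk_lt_mk.2 (old_lt_old h _ _)

lemma ov_lt_cn [LinearOrder V] (v : V) (s t : Bool) : ov ν v s < cn ν t :=
  Subtype.mk_lt_mk.2 (old_lt_cone v _ _)

section

variable (hν : O.IsEdgeCycle ν)

lemma cut_R_lift [Finite V] {a b c : V} (h : O.R a b c) :
    (cut hν).R (ov ν a (O.side ν a b)) (ov ν b (O.side ν b c)) (ov ν c (O.side ν c a)) := by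
  change O.cutR ν (ov ν a _).1 (ov ν b _).1 (ov ν c _).1
  rw [ov_val_side, ov_val_side, ov_val_side]
  exact ⟨h, rfl, rfl, rfl⟩

lemma cut_R_cone [Finite V] {s : Bool} {b c : V} (h : coneEdge ν s b c) :
    (cut hν).R (cn ν s) (ov ν b s) (ov ν c s) := by
  change O.cutR ν (cn ν s).1 (ov ν b s).1 (ov ν c s).1
  rw [ov_val_cycle h.ne_left, ov_val_cycle h.ne_right]
  exact ⟨h, rfl, rfl⟩

lemma cut_R_cases [Finite V] {p q r : CutV ν} (h : (cut hν).R p q r) :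
    (∃ a b c, O.R a b c ∧ p = ov ν a (O.side ν a b) ∧ q = ov ν b (O.side ν b c) ∧
      r = ov ν c (O.side ν c a)) ∨
    ∃ s b c, coneEdge ν s b c ∧
      ((p = cn ν s ∧ q = ov ν b s ∧ r = ov ν c s) ∨ (p = ov ν b s ∧ q = ov ν c s ∧ r = cn ν s) ∨
        (p = ov ν c s ∧ q = cn ν s ∧ r = ov ν b s)) := by
  change O.cutR ν _ _ _ at h
  obtain ⟨p, hp⟩ := p
  obtain ⟨q, hq⟩ := q
  obtain ⟨r, hr⟩ := r
  simp only [Subtype.ext_iff]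
  rcases p with ⟨a, i⟩ | i <;> rcases q with ⟨b, j⟩ | j <;> rcases r with ⟨c, k⟩ | k <;>
    first
    | exact h.elim
    | skip
  · obtain ⟨h1, rfl, rfl, rfl⟩ := h
    exact .inl ⟨a, b, c, h1, (ov_val_side _ _).symm, (ov_val_side _ _).symm, (ov_val_side _ _).symm⟩
  · obtain ⟨h1, rfl, rfl⟩ := h
    exact .inr ⟨_, a, b, h1, .inr (.inl ⟨(ov_val_cycle h1.ne_left _).symm,
      (ov_val_cycle h1.ne_right _).symm, rfl⟩)⟩
  · obtain ⟨h1, rfl, rfl⟩ := h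
    exact .inr ⟨_, c, a, h1, .inr (.inr ⟨(ov_val_cycle h1.ne_right _).symm, rfl,
      (ov_val_cycle h1.ne_left _).symm⟩)⟩
  · obtain ⟨h1, rfl, rfl⟩ := h
    exact .inr ⟨_, b, c, h1, .inl ⟨rfl, (ov_val_cycle h1.ne_left _).symm,
      (ov_val_cycle h1.ne_right _).symm⟩⟩

lemma Closed.cn_iff [Finite V] {A' : Set (CutV ν)} (hA : (cut hν).Closed A') {v : V} (hv : ν v ≠ v)
    (s : Bool) : cn ν s ∈ A' ↔ ov ν v s ∈ A' := by
  obtain ⟨c, hc⟩ := coneEdge.exists_right hv s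
  exact hA _ _ _ (cut_R_cone hν hc)

lemma coneEdge_iff {s : Bool} {b c : V} : coneEdge ν s b c ↔
    (s = false ∧ ν c ≠ c ∧ b = ν c) ∨ (s = true ∧ ν b ≠ b ∧ c = ν b) := by
  constructor
  · intro h
    cases s
    · exact .inl ⟨rfl, h.ne_right, h.2.1 rfl⟩
    · exact .inr ⟨rfl, h.ne_left, h.2.2 rfl⟩
  · rintro (⟨rfl, h, rfl⟩ | ⟨rfl, h, rfl⟩)
    · exact ⟨h, fun _ => rfl, by simp⟩
    · exact ⟨h.symm, by simp, fun _ => rfl⟩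

variable [LinearOrder V]

variable (O ν) in
/-- The lift of the triangle `abc`. -/
noncomputable def liftTri (a b c : V) : Finset (CutV ν) :=
  triple (ov ν a (O.side ν a b)) (ov ν b (O.side ν b c)) (ov ν c (O.side ν c a))

variable (ν) in
/-- The triangle of the cone over the edge from `v` to `ν v`. -/
noncomputable def coneTri (v : V) (s : Bool) : Finset (CutV ν) :=
  triple (cn ν s) (ov ν v s) (ov ν (ν v) s)

lemma liftTri_rotate (a b c : V) : O.liftTri ν a b c = O.liftTri ν b c a := triple_rotate _ _ _

lemma triple_comm {U : Type} [LinearOrder U] (p q r : U) : triple p q r = triple p r q := by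
  ext; simp only [mem_triple]; tauto

lemma triple_eq_coneTri {s : Bool} {b c : V} (h : coneEdge ν s b c) :
    ∃ v, ν v ≠ v ∧ triple (cn ν s) (ov ν b s) (ov ν c s) = coneTri ν v s := by
  rcases coneEdge_iff.1 h with ⟨rfl, hc, rfl⟩ | ⟨rfl, hb, rfl⟩
  · exact ⟨c, hc, triple_comm _ _ _⟩
  · exact ⟨b, hb, rfl⟩

lemma mem_tris' [Fintype V] {t : Finset V} :
    t ∈ O.tris ↔ ∃ a b c, O.R a b c ∧ t = triple a b c := O.mem_tris

lemma mem_tris_cut [Fintype V] {t : Finset (CutV ν)} : t ∈ (cut hν).tris ↔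
    (∃ a b c, O.R a b c ∧ t = O.liftTri ν a b c) ∨ ∃ v s, ν v ≠ v ∧ t = coneTri ν v s := by
  rw [mem_tris']
  constructor
  · rintro ⟨p, q, r, h, rfl⟩
    rcases cut_R_cases hν h with ⟨a, b, c, habc, rfl, rfl, rfl⟩ | ⟨s, b, c, h, h'⟩
    · exact .inl ⟨a, b, c, habc, rfl⟩
    · obtain ⟨v, hv, e⟩ := triple_eq_coneTri h
      refine .inr ⟨v, s, hv, ?_⟩
      rw [← e]
      rcases h' with ⟨rfl, rfl, rfl⟩ | ⟨rfl, rfl, rfl⟩ | ⟨rfl, rfl, rfl⟩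
      · rfl
      · rw [triple_rotate, triple_rotate]
      · rw [triple_rotate]
  · rintro (⟨a, b, c, h, rfl⟩ | ⟨v, s, hv, rfl⟩)
    · exact ⟨_, _, _, cut_R_lift hν h, rfl⟩
    · cases s
      · exact ⟨_, _, _, cut_R_cone hν (coneEdge_iff.2 (.inl ⟨rfl, hv, rfl⟩)), triple_comm _ _ _⟩
      · exact ⟨_, _, _, cut_R_cone hν (coneEdge_iff.2 (.inr ⟨rfl, hv, rfl⟩)), rfl⟩

lemma cn_mem_coneTri {v : V} {s t : Bool} : cn ν t ∈ coneTri ν v s ↔ t = s := by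
  rw [coneTri, mem_triple]
  constructor
  · rintro (h | h | h)
    · exact cn_injective h
    · exact absurd h.symm (ov_ne_cn _ _ _)
    · exact absurd h.symm (ov_ne_cn _ _ _)
  · rintro rfl; exact .inl rfl

lemma cn_notMem_liftTri {a b c : V} {t : Bool} : cn ν t ∉ O.liftTri ν a b c := by
  rw [liftTri, mem_triple]
  rintro (h | h | h) <;> exact absurd h.symm (ov_ne_cn _ _ _)

end

lemma rotation_of_triple_eq [LinearOrder V] {a b c a' b' c' : V} (h : O.R a b c) (h' : O.R a' b' c')
    (he : triple a b c = triple a' b' c') :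
    (a' = a ∧ b' = b ∧ c' = c) ∨ (a' = b ∧ b' = c ∧ c' = a) ∨ (a' = c ∧ b' = a ∧ c' = b) := by
  have key : ∀ {a b c b' c' : V}, O.R a b c → O.R a b' c' → triple a b c = triple a b' c' →
      b' = b ∧ c' = c := by
    intro a b c b' c' h h' he
    obtain ⟨n1, n2, n3⟩ := O.ne' h'
    have hb : b' ∈ triple a b c := by rw [he, mem_triple]; tauto
    have hc : c' ∈ triple a b c := by rw [he, mem_triple]; tauto
    rw [mem_triple] at hb hc
    rcases hb with rfl | rfl | rfl
    · exact absurd rfl n1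
    · exact ⟨rfl, O.uniq h' h⟩
    · rcases hc with rfl | rfl | rfl
      · exact absurd rfl n3
      · exact absurd h' (O.not_swap (O.cyc (O.cyc h)))
      · exact absurd rfl n2
  have ha : a' ∈ triple a b c := by rw [he, mem_triple]; tauto
  rw [mem_triple] at ha
  rcases ha with rfl | rfl | rfl
  · exact .inl ⟨rfl, key h h' he⟩
  · rw [triple_rotate] at he
    exact .inr (.inl ⟨rfl, key (O.cyc h) h' he⟩)
  · rw [triple_rotate, triple_rotate] at he
    exact .inr (.inr ⟨rfl, key (O.cyc (O.cyc h)) h' he⟩)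

variable [LinearOrder V] (hν : O.IsEdgeCycle ν)

include hν in
lemma coneTri_injective {v w : V} {s t : Bool} (hw : ν w ≠ w)
    (h : coneTri ν v s = coneTri ν w t) : v = w ∧ s = t := by
  have hs : s = t := by
    have : cn ν s ∈ coneTri ν w t := h ▸ cn_mem_coneTri.2 rfl
    exact cn_mem_coneTri.1 this
  subst hs
  have h1 : ∀ {v w : V}, coneTri ν v s = coneTri ν w s → ∀ x, x = v ∨ x = ν v → x = w ∨ x = ν w := by
    intro v w h x hx
    have : ov ν x s ∈ coneTri ν w s := by
      rw [← h, coneTri, mem_triple]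
      rcases hx with rfl | rfl
      · exact .inr (.inl rfl)
      · exact .inr (.inr rfl)
    rw [coneTri, mem_triple] at this
    rcases this with h | h | h
    · exact absurd h (ov_ne_cn _ _ _)
    · exact .inl (ov_injective h)
    · exact .inr (ov_injective h)
  refine ⟨?_, rfl⟩
  rcases h1 h v (.inl rfl) with e | e
  · exact e
  · rcases h1 h (ν v) (.inr rfl) with e' | e'
    · rw [e] at e'
      exact absurd e' (hν.ne_symm w hw)
    · exact ν.injective e'

variable [Fintype V]

open Classical in
/-- The vertices below a set of vertices of the cut surface. -/
noncomputable def shadow (t : Finset (CutV ν)) : Finset V :=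
  Finset.univ.filter fun v => ∃ s, ov ν v s ∈ t

lemma shadow_liftTri (a b c : V) : shadow (O.liftTri ν a b c) = triple a b c := by
  ext v
  simp only [shadow, Finset.mem_filter, Finset.mem_univ, true_and, liftTri, mem_triple]
  constructor
  · rintro ⟨s, h | h | h⟩
    · exact .inl (ov_injective h)
    · exact .inr (.inl (ov_injective h))
    · exact .inr (.inr (ov_injective h))
  · rintro (rfl | rfl | rfl)
    · exact ⟨_, .inl rfl⟩
    · exact ⟨_, .inr (.inl rfl)⟩
    · exact ⟨_, .inr (.inr rfl)⟩

/-- The counterpart of `sum_tris_bisect` for the surgery. Triangles without a cone point correspond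
to old triangles through `shadow`, and each cycle edge carries two cap triangles. -/
lemma sum_tris_cut {M : Type*} [AddCommMonoid M] (G : Finset (CutV ν) → M) (H : Finset V → M)
    (h : ∀ a b c, O.R a b c → G (O.liftTri ν a b c) = H (triple a b c)) :
    ∑ t ∈ (cut hν).tris, G t =
      ∑ t ∈ O.tris, H t + ∑ v ∈ ν.support, (G (coneTri ν v true) + G (coneTri ν v false)) := by
  classical
  rw [← Finset.sum_filter_add_sum_filter_not _ (fun t => ∀ s, cn ν s ∉ t)]
  have m1 : ∀ t, t ∈ (cut hν).tris.filter (fun t => ∀ s, cn ν s ∉ t) ↔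
      ∃ a b c, O.R a b c ∧ t = O.liftTri ν a b c := by
    intro t
    rw [Finset.mem_filter, mem_tris_cut]
    constructor
    · rintro ⟨h | ⟨v, s, -, rfl⟩, h'⟩
      · exact h
      · exact absurd (cn_mem_coneTri.2 rfl) (h' s)
    · rintro ⟨a, b, c, h, rfl⟩
      exact ⟨.inl ⟨a, b, c, h, rfl⟩, fun s => cn_notMem_liftTri⟩
  congr 1
  · refine Finset.sum_nbij shadow ?_ ?_ ?_ ?_
    · intro t ht
      obtain ⟨a, b, c, h, rfl⟩ := (m1 t).1 ht
      rw [shadow_liftTri]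
      exact mem_tris'.2 ⟨a, b, c, h, rfl⟩
    · intro t ht t' ht' e
      obtain ⟨a, b, c, h, rfl⟩ := (m1 t).1 ht
      obtain ⟨a', b', c', h', rfl⟩ := (m1 t').1 ht'
      rw [shadow_liftTri, shadow_liftTri] at e
      rcases rotation_of_triple_eq h h' e with ⟨rfl, rfl, rfl⟩ | ⟨rfl, rfl, rfl⟩ | ⟨rfl, rfl, rfl⟩
      · rfl
      · rw [liftTri_rotate]
      · rw [← liftTri_rotate]
    · intro t ht
      obtain ⟨a, b, c, h, rfl⟩ := mem_tris'.1 ht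
      exact ⟨_, (m1 _).2 ⟨a, b, c, h, rfl⟩, shadow_liftTri a b c⟩
    · intro t ht
      obtain ⟨a, b, c, h', rfl⟩ := (m1 t).1 ht
      rw [shadow_liftTri, h a b c h']
  · have e : (cut hν).tris.filter (fun t => ¬ ∀ s, cn ν s ∉ t) =
        (ν.support ×ˢ Finset.univ).image fun p => coneTri ν p.1 p.2 := by
      ext t
      rw [Finset.mem_filter, mem_tris_cut, Finset.mem_image]
      constructor
      · rintro ⟨⟨a, b, c, h, rfl⟩ | ⟨v, s, hv, rfl⟩, h'⟩
        · exact absurd (fun s => cn_notMem_liftTri) h'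
        · exact ⟨(v, s), by simpa using hv, rfl⟩
      · rintro ⟨⟨v, s⟩, hv, rfl⟩
        refine ⟨.inr ⟨v, s, by simpa using hv, rfl⟩, fun h' => h' s (cn_mem_coneTri.2 rfl)⟩
    rw [e, Finset.sum_image, Finset.sum_product]
    · exact Finset.sum_congr rfl fun v _ => Fintype.sum_bool _
    · rintro ⟨v, s⟩ hv ⟨w, t⟩ hw e
      have := coneTri_injective hν (by simpa using hw) e
      exact Prod.ext this.1 this.2

/-- `P` says that the cycle and both cone points belong to the set; then each cycle vertex
contributes a second copy, and the cone points add two. -/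
lemma ncard_cut {A : Set V} {A' : Set (CutV ν)} {P : Prop} [Decidable P]
    (h1 : ∀ v s, ov ν v s ∈ A' ↔ v ∈ A) (h2 : ∀ s, cn ν s ∈ A' ↔ P)
    (h3 : ∀ v, ν v ≠ v → (v ∈ A ↔ P)) :
    A'.ncard = A.ncard + if P then ν.support.card + 2 else 0 := by
  classical
  have e : A' = (fun v => ov ν v false) '' A ∪
      if P then (fun v => ov ν v true) '' (ν.support : Set V) ∪ {cn ν false, cn ν true} else ∅ := by
    ext p
    rw [Set.mem_union]
    rcases cutV_cases p with ⟨v, rfl⟩ | ⟨v, hv, rfl⟩ | ⟨s, rfl⟩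
    · rw [h1]
      constructor
      · exact fun h => .inl ⟨v, h, rfl⟩
      · rintro (⟨w, hw, e⟩ | h)
        · rwa [← ov_injective e]
        · split_ifs at h with hP
          · rcases h with ⟨w, hw, e⟩ | h | h
            · obtain rfl := ov_injective e
              rw [SetLike.mem_coe, Equiv.Perm.mem_support] at hw
              exact (h3 _ hw).2 hP
            · exact absurd h (ov_ne_cn _ _ _)
            · exact absurd h (ov_ne_cn _ _ _)
          · exact h.elim
    · rw [h1, h3 v hv]
      constructor
      · intro h
        rw [if_pos h]
        exact .inr (.inl ⟨v, by simpa using hv, rfl⟩)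
      · rintro (⟨w, hw, e⟩ | h)
        · obtain rfl := ov_injective e
          exact (h3 _ hv).1 hw
        · split_ifs at h with hP
          · exact hP
          · exact h.elim
    · rw [h2]
      constructor
      · intro h
        rw [if_pos h]
        cases s
        · exact .inr (.inr (.inl rfl))
        · exact .inr (.inr (.inr rfl))
      · rintro (⟨w, hw, e⟩ | h)
        · exact absurd e (ov_ne_cn _ _ _)
        · split_ifs at h with hP
          · exact hP
          · exact h.elim
  rw [e, Set.ncard_union_eq]
  · rw [Set.ncard_image_of_injective _ fun v w h => ov_injective h]
    split_ifs
    · rw [Set.ncard_union_eq, Set.ncard_image_of_injective _ fun v w h => ov_injective h,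
        Set.ncard_coe_finset, Set.ncard_pair]
      · exact fun h => Bool.false_ne_true (cn_injective h)
      · rw [Set.disjoint_left]
        rintro _ ⟨v, -, rfl⟩ (h | h) <;> exact absurd h (ov_ne_cn _ _ _)
    · simp
  · rw [Set.disjoint_left]
    rintro _ ⟨v, -, rfl⟩ h
    split_ifs at h
    · rcases h with ⟨w, hw, e⟩ | h | h
      · rw [SetLike.mem_coe, Equiv.Perm.mem_support] at hw
        exact Bool.false_ne_true (ov_injective' hw e).symm
      · exact absurd h (ov_ne_cn _ _ _)
      · exact absurd h (ov_ne_cn _ _ _)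
    · exact h

/-- For a cycle of length n contained in the set, cutting adds n + 2 vertices and 2n triangles, so
2V - F grows by 2(n + 2) - 2n = 4. -/
lemma chi2_cut {A : Set V} {A' : Set (CutV ν)} {P : Prop} [Decidable P]
    (h1 : ∀ v s, ov ν v s ∈ A' ↔ v ∈ A) (h2 : ∀ s, cn ν s ∈ A' ↔ P)
    (h3 : ∀ v, ν v ≠ v → (v ∈ A ↔ P)) :
    (cut hν).chi2 A' = O.chi2 A + if P then 4 else 0 := by
  classical
  have h4 := sum_tris_cut hν (fun t => if (t : Set (CutV ν)) ⊆ A' then (1 : ℤ) else 0)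
    (fun t => if (t : Set V) ⊆ A then (1 : ℤ) else 0) (by
      intro a b c _
      simp only [liftTri, triple_subset, h1])
  have h5 : ∀ v ∈ ν.support, ((if (coneTri ν v true : Set (CutV ν)) ⊆ A' then (1 : ℤ) else 0) +
      if (coneTri ν v false : Set (CutV ν)) ⊆ A' then (1 : ℤ) else 0) = if P then 2 else 0 := by
    intro v hv
    rw [Equiv.Perm.mem_support] at hv
    have hv' : ν (ν v) ≠ ν v := fun h => hv (ν.injective h)
    simp only [coneTri, triple_subset, h1, h2, h3 v hv, h3 _ hv', and_self]
    split_ifs <;> rfl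
  rw [Finset.sum_congr rfl h5, Finset.sum_const] at h4
  have h6 := ncard_cut h1 h2 h3
  rw [OrTri.chi2, OrTri.chi2, h6, Finset.card_filter, Finset.card_filter]
  push_cast
  have h7 : (∑ t ∈ (cut hν).tris, if (t : Set (CutV ν)) ⊆ A' then (1 : ℤ) else 0) = _ := h4
  rw [h7]
  split_ifs
  · simp; ring
  · simp

lemma card_cut : 2 * (Fintype.card (CutV ν) : ℤ) - (cut hν).tris.card =
    2 * Fintype.card V - O.tris.card + 4 := by
  classical
  have := chi2_cut hν (A := Set.univ) (A' := Set.univ) (P := True) (by simp) (by simp) (by simp)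
  simpa [OrTri.chi2, Set.ncard_univ, Nat.card_eq_fintype_card] using this

include hν in
lemma IsEdgeCycle.mem_iff {B : Set V} (hB : O.Closed B) {x y : V} (hx : ν x ≠ x) (hy : ν y ≠ y) :
    x ∈ B ↔ y ∈ B := by
  have hstep : ∀ w, w ∈ B ↔ ν w ∈ B := by
    intro w
    by_cases hw : ν w = w
    · rw [hw]
    · obtain ⟨c, hc⟩ := hν.adj w hw
      exact hB _ _ _ hc
  obtain ⟨n, -, hn⟩ := (hν.sameCycle x y hx hy).exists_pow_eq'
  have : ∀ n : ℕ, x ∈ B ↔ (ν ^ n) x ∈ B := by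
    intro n
    induction n with
    | zero => simp
    | succ n ih => rw [ih, pow_succ', Equiv.Perm.mul_apply]; exact hstep _
  rw [← hn]
  exact this n

/-- A component of the cut surface contains exactly one of the cones or comes from a component
of the original surface. -/
lemma exists_isComp_cut {A' : Set (CutV ν)} (hA : (cut hν).IsComp A') :
    (∃ s s', cn ν s ∈ A' ∧ cn ν s' ∉ A') ∨ ∃ A, O.IsComp A ∧
      ((cut hν).chi2 A' = O.chi2 A ∨ (cut hν).chi2 A' = O.chi2 A + 4) := by
  classical
  by_cases hex : ∃ s s', cn ν s ∈ A' ∧ cn ν s' ∉ A'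
  · exact .inl hex
  push Not at hex
  have h2 : ∀ s, cn ν s ∈ A' ↔ cn ν false ∈ A' := fun s => ⟨hex _ _, hex _ _⟩
  obtain ⟨A, hAA⟩ : ∃ A : Set V, ∀ v, ov ν v false ∈ A' ↔ v ∈ A :=
    ⟨{v | ov ν v false ∈ A'}, fun v => Iff.rfl⟩
  have h1 : ∀ v s, ov ν v s ∈ A' ↔ v ∈ A := by
    intro v s
    rw [← hAA]
    by_cases hv : ν v = v
    · rw [ov_of_fixed hv]
    · rw [← Closed.cn_iff hν hA.2.1 hv, ← Closed.cn_iff hν hA.2.1 hv, h2]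
  have h3 : ∀ v, ν v ≠ v → (v ∈ A ↔ cn ν false ∈ A') := fun v hv => by
    rw [Closed.cn_iff hν hA.2.1 hv, hAA]
  refine .inr ⟨A, ⟨?_, ?_, ?_⟩, ?_⟩
  · obtain ⟨p, hp⟩ := hA.1
    rcases cutV_cases p with ⟨v, rfl⟩ | ⟨v, hv, rfl⟩ | ⟨s, rfl⟩
    · exact ⟨v, (h1 _ _).1 hp⟩
    · exact ⟨v, (h1 _ _).1 hp⟩
    · obtain ⟨v, hv⟩ := hν.ne_id
      exact ⟨v, (h3 v hv).2 ((h2 s).1 hp)⟩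
  · intro a b c h
    have := hA.2.1 _ _ _ (cut_R_lift hν h)
    rwa [h1, h1] at this
  · intro B hB ⟨x, hxA, hxB⟩
    obtain ⟨w, hw⟩ := hν.ne_id
    -- The preimage of `B`, with both cone points following the cycle vertex `w`.
    let B' : Set (CutV ν) := {p | ∀ v, (∀ s, p = ov ν v s → v ∈ B) ∧ (∀ s, p = cn ν s → w ∈ B)}
    have k1 : ∀ v s, ov ν v s ∈ B' ↔ v ∈ B := by
      refine fun v s => ⟨fun h => (h v).1 s rfl, fun h v' => ⟨fun s' e => ?_, fun s' e => ?_⟩⟩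
      · rwa [← ov_injective e]
      · exact absurd e (ov_ne_cn _ _ _)
    have k2 : ∀ s, cn ν s ∈ B' ↔ w ∈ B := by
      refine fun s => ⟨fun h => (h w).2 s rfl, fun h v' => ⟨fun s' e => ?_, fun s' e => h⟩⟩
      exact absurd e.symm (ov_ne_cn _ _ _)
    have hB' : (cut hν).Closed B' := by
      intro p q r h
      rcases cut_R_cases hν h with ⟨a, b, c, habc, rfl, rfl, rfl⟩ | ⟨s, b, c, h, h'⟩
      · rw [k1, k1]; exact hB _ _ _ habc
      · have e1 := hν.mem_iff hB hw h.ne_left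
        have e2 := hν.mem_iff hB hw h.ne_right
        rcases h' with ⟨rfl, rfl, rfl⟩ | ⟨rfl, rfl, rfl⟩ | ⟨rfl, rfl, rfl⟩
        · rw [k1, k2, e1]
        · rw [k1, k1, ← e1, e2]
        · rw [k1, k2, e2]
    have := hA.2.2 B' hB' ⟨ov ν x false, (h1 _ _).2 hxA, (k1 _ _).2 hxB⟩
    intro v hv
    exact (k1 v false).1 (this ((h1 _ _).2 hv))
  · have := chi2_cut hν h1 h2 h3
    split_ifs at this
    · exact .inr this
    · exact .inl (by rw [this, add_zero])

end Cut

end OrTri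

/-! ### Components with exactly one cone are not spheres -/

namespace OrTri

open CutVertex

variable {V : Type}

lemma isComp_restrict {O : OrTri V} {A : Set V} (hA : O.IsComp A) :
    (O.restrict A hA.2.1).IsComp Set.univ := by
  obtain ⟨x, hx⟩ := hA.1
  refine ⟨⟨⟨x, hx⟩, trivial⟩, fun _ _ _ _ => by simp, fun B hB hne p _ => ?_⟩
  have hcl : O.Closed {v | ∃ hv : v ∈ A, (⟨v, hv⟩ : {p // p ∈ A}) ∈ B} := by
    refine closed_of_imp ?_
    rintro a b c h ⟨ha, haB⟩
    have hb := hA.2.1.mem_all h ha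
    exact ⟨hb.1, (hB ⟨a, ha⟩ ⟨b, hb.1⟩ ⟨c, hb.2⟩ h).1 haB⟩
  obtain ⟨y, -, hyB⟩ := hne
  exact (hA.2.2 _ hcl ⟨y.1, y.2, y.2, hyB⟩ p.2).2

lemma chi2_restrict [LinearOrder V] [Fintype V] {O : OrTri V} {A : Set V} (hA : O.Closed A)
    [Fintype {p // p ∈ A}] : (O.restrict A hA).chi2 Set.univ = O.chi2 A := by
  classical
  rw [chi2, chi2]
  have h1 : (Set.univ : Set {p // p ∈ A}).ncard = A.ncard := by
    rw [Set.ncard_univ]; rfl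
  have h2 : ((O.restrict A hA).tris.filter fun t : Finset {p // p ∈ A} =>
        (t : Set {p // p ∈ A}) ⊆ Set.univ).card =
      (O.tris.filter fun t : Finset V => (t : Set V) ⊆ A).card := by
    refine Finset.card_bij (fun t _ => t.map (Function.Embedding.subtype _)) ?_ ?_ ?_
    · intro t ht
      rw [Finset.mem_filter] at ht
      obtain ⟨a, b, c, h, rfl⟩ := mem_tris'.1 ht.1
      rw [Finset.mem_filter, mem_tris']
      refine ⟨⟨a.1, b.1, c.1, h, ?_⟩, ?_⟩
      · simp [triple]
      · intro x hx
        simp only [Finset.mem_coe, Finset.mem_map, Function.Embedding.subtype_apply] at hx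
        obtain ⟨y, -, rfl⟩ := hx
        exact y.2
    · exact fun t _ t' _ h => Finset.map_injective _ h
    · intro t ht
      rw [Finset.mem_filter] at ht
      obtain ⟨⟨a, b, c, h, rfl⟩, hA'⟩ := And.imp_left mem_tris'.1 ht
      rw [triple_subset] at hA'
      refine ⟨triple ⟨a, hA'.1⟩ ⟨b, hA'.2.1⟩ ⟨c, hA'.2.2⟩, ?_, ?_⟩
      · rw [Finset.mem_filter, mem_tris']
        exact ⟨⟨⟨a, hA'.1⟩, ⟨b, hA'.2.1⟩, ⟨c, hA'.2.2⟩, h, rfl⟩, Set.subset_univ _⟩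
      · simp [triple]
  rw [h1, h2]

/-- The values of a cochain on lifted edges; edges at the cone points get the value one. -/
def liftCochain {G : Type*} [One G] (l : V → V → G) : CutVertex V → CutVertex V → G
| old a _, old b _ => l a b
| _, _ => 1

/-- If a cocycle is not a coboundary along the cycle, no component of the cut surface which
contains exactly one cone is a sphere. -/
theorem chi2_cut_ne [LinearOrder V] [Fintype V] {O : OrTri V} {ν : Equiv.Perm V}
    (hν : O.IsEdgeCycle ν) {G : Type*} [Group G] (l : V → V → G)
    (hsymm : ∀ a b c, O.R a b c → l b a = (l a b)⁻¹)
    (hcoc : ∀ a b c, O.R a b c → l a b * l b c * l c a = 1)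
    (hne : ¬ ∃ k : V → G, ∀ v, ν v ≠ v → k v * l v (ν v) = k (ν v))
    {A' : Set (CutV ν)} (hA : (cut hν).IsComp A') {s s' : Bool} (hs : cn ν s ∈ A')
    (hs' : cn ν s' ∉ A') : (cut hν).chi2 A' ≠ 4 := by
  classical
  intro hchi
  apply hne
  let D := (cut hν).restrict A' hA.2.1
  let T := D.toSurface
  have hcone : ∀ t, cn ν t ∈ A' → t = s := by
    intro t ht
    have h1 : t ≠ s' := by rintro rfl; exact hs' ht
    have h2 : s ≠ s' := by rintro rfl; exact hs' hs
    cases t <;> cases s <;> cases s' <;> simp_all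
  have hconn : T.orient.IsComp (Set.univ : Set {p // p ∈ A'}) :=
    (ClosedOrientedSurface.isComp_orient_toSurface D).2 (isComp_restrict hA)
  have hchi' : T.chi2 (Set.univ : Set {p // p ∈ A'}) = 4 :=
    (ClosedOrientedSurface.chi2_toSurface D _).trans ((chi2_restrict hA.2.1).trans hchi)
  have hsymm' : ∀ p q r : CutVertex V, O.cutR ν p q r →
      liftCochain l q p = (liftCochain l p q)⁻¹ := by
    intro p q r h
    rcases p with ⟨a, i⟩ | i <;> rcases q with ⟨b, j⟩ | j <;> rcases r with ⟨c, k⟩ | k <;>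
      first
      | exact h.elim
      | exact hsymm a b c h.1
      | exact inv_one.symm
      | skip
    obtain ⟨c, d, h1, h2⟩ := hν.coneEdge_R h.1
    exact hsymm _ _ _ h2
  -- Off its only cone point the component consists of lifted triangles, where the labels form a
  -- cocycle. On a sphere they come from a potential, whose values at the copies of the cycle
  -- vertices give the forbidden coboundary.
  obtain ⟨h, hh⟩ := ClosedOrientedSurface.exists_potential (S := T) hconn hchi'
    (⟨cn ν s, hs⟩ : {p // p ∈ A'})
    (fun (p q : {p // p ∈ A'}) => liftCochain l p.1.1 q.1.1)
    (fun p q r hR => hsymm' _ _ _ ((OrTri.orient_toSurface D p q r).1 hR))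
    (fun p q r hR hp hq hr => by
      have hR' := (OrTri.orient_toSurface D p q r).1 hR
      have hc : ∀ p : {p // p ∈ A'}, p ≠ ⟨cn ν s, hs⟩ → ∃ v i, p.1.1 = old v i := by
        rintro ⟨⟨⟨v, i⟩ | t, h⟩, hA⟩ hp
        · exact ⟨v, i, rfl⟩
        · refine absurd ?_ hp
          have := hcone t hA
          subst this
          rfl
      obtain ⟨a, i, ha⟩ := hc p hp
      obtain ⟨b, j, hb⟩ := hc q hq
      obtain ⟨c, k, hc⟩ := hc r hr
      have hR2 : O.cutR ν p.1.1 q.1.1 r.1.1 := hR'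
      change liftCochain l p.1.1 q.1.1 * liftCochain l q.1.1 r.1.1 * liftCochain l r.1.1 p.1.1 = 1
      rw [ha, hb, hc] at hR2 ⊢
      exact hcoc _ _ _ hR2.1)
  have hmem : ∀ v, ν v ≠ v → ov ν v s ∈ A' := fun v hv => (Closed.cn_iff hν hA.2.1 hv s).1 hs
  have hh' : ∀ b c (hb : ν b ≠ b) (hc : ν c ≠ c), coneEdge ν s b c →
      h ⟨ov ν b s, hmem b hb⟩ * l b c = h ⟨ov ν c s, hmem c hc⟩ := by
    intro b c hb hc he
    have := hh (⟨ov ν b s, hmem b hb⟩ : {p // p ∈ A'}) (⟨ov ν c s, hmem c hc⟩ : {p // p ∈ A'})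
      (⟨cn ν s, hs⟩ : {p // p ∈ A'})
      ((OrTri.orient_toSurface D _ _ _).2 ((cut hν).cyc (cut_R_cone hν he)))
      (fun e => ov_ne_cn _ _ _ (congrArg Subtype.val e))
      (fun e => ov_ne_cn _ _ _ (congrArg Subtype.val e))
    rw [ov_val_cycle hb, ov_val_cycle hc] at this
    exact this
  refine ⟨fun v => if hv : ν v ≠ v then h ⟨ov ν v s, hmem v hv⟩ else 1, fun v hv => ?_⟩
  have hv' : ν (ν v) ≠ ν v := fun h => hv (ν.injective h)
  simp only [dif_pos hv, dif_pos hv']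
  -- The left cap traverses the cycle backwards, so there the relation comes from the inverse label.
  cases s
  · rw [← hh' (ν v) v hv' hv (coneEdge_iff.2 (.inl ⟨rfl, hv, rfl⟩))]
    obtain ⟨c, hc⟩ := hν.adj v hv
    rw [hsymm _ _ _ hc, inv_mul_cancel_right]
  · exact hh' v (ν v) hv hv' (coneEdge_iff.2 (.inr ⟨rfl, hv, rfl⟩))

end OrTri

namespace ClosedOrientedSurface

variable {S : ClosedOrientedSurface} {ν : Equiv.Perm S.V}

/-- The surface cut along a cycle of edges and capped off with two discs. -/
noncomputable def cutSurface (hν : S.orient.IsEdgeCycle ν) : ClosedOrientedSurface :=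
  (OrTri.cut hν).toSurface

lemma eulerChar_cutSurface (hν : S.orient.IsEdgeCycle ν) :
    (cutSurface hν).eulerChar = S.eulerChar + 2 := by
  have h1 := two_mul_eulerChar (S := S)
  have h2 := two_mul_eulerChar (S := cutSurface hν)
  have h3 := OrTri.card_cut hν
  have h5 : 2 * (cutSurface hν).eulerChar =
      2 * (Fintype.card (OrTri.CutV ν) : ℤ) - (OrTri.cut hν).tris.card := h2
  rw [tris_orient] at h3
  omega

/-- A component with exactly one cone is excluded by `chi2_cut_ne`. Any other has the `chi2` of an
old component, or that plus 4, so the value 4 would require an old sphere or torus. -/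
theorem not_isSphere_cutSurface (hν : S.orient.IsEdgeCycle ν) (hS : S.NoSphereTorus)
    {G : Type*} [Group G] (l : S.V → S.V → G)
    (hsymm : ∀ a b c, S.orient.R a b c → l b a = (l a b)⁻¹)
    (hcoc : ∀ a b c, S.orient.R a b c → l a b * l b c * l c a = 1)
    (hne : ¬ ∃ k : S.V → G, ∀ v, ν v ≠ v → k v * l v (ν v) = k (ν v)) (c) :
    ¬ (cutSurface hν).IsSphere c := by
  refine not_isSphere (fun A' hA' => ?_) c
  have hA := (isComp_orient_toSurface (OrTri.cut hν)).1 hA'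
  change (OrTri.cut hν).chi2 A' ≠ 4
  rcases OrTri.exists_isComp_cut hν hA with ⟨s, s', hs, hs'⟩ | ⟨A, hA1, hA2⟩
  · exact OrTri.chi2_cut_ne hν l hsymm hcoc hne hA hs hs'
  · have := hS A hA1
    rw [chi2_eq] at this
    omega

end ClosedOrientedSurface

/-! ### Extending the map over the caps -/

/-- A null-homotopic triangle of paths can be filled. The two sides at the first vertex are
traversed in the middle third of the parameter. -/
theorem exists_filling {X : Type u} [TopologicalSpace X] {x a b : X} (r : Path x a) (r' : Path x b)
    (e : Path a b) (h : cls r ≫ cls e = cls r') :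
    ∃ Θ : C(ℝ × ℝ, X), (∀ t, 0 ≤ t → Θ (0, t) = e.extend t) ∧
      (∀ z, Θ (z, 0) = r.extend (3 * (1 - z) - 1)) ∧
      ∀ z w, z + w = 1 → Θ (z, w) = r'.extend (3 * w - 1) := by
  obtain ⟨F⟩ := Path.Homotopic.Quotient.eq.1 ((cls_trans r e).trans h)
  let pr : ℝ → I := Set.projIcc 0 1 zero_le_one
  have hpr : Continuous pr := continuous_projIcc
  have hpr1 : ∀ t, 1 ≤ t → pr t = 1 := fun t ht => Set.projIcc_of_right_le _ ht
  have hpr0 : ∀ t, t ≤ 0 → pr t = 0 := fun t ht => Set.projIcc_of_le_left _ ht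
  -- Here `z` is the weight of the apex and `w` that of the second base vertex, so w/(1 - z) is the
  -- position on the base seen from the apex. The maximum with 1/3 keeps the quotient continuous;
  -- for z ≥ 2/3 the filling will not depend on it.
  let t : ℝ × ℝ → ℝ := fun p => p.2 / max (1 - p.1) (1 / 3)
  have ht : Continuous t := by
    refine Continuous.div (by fun_prop) (by fun_prop) fun p => ?_
    have : (1 / 3 : ℝ) ≤ max (1 - p.1) (1 / 3) := le_max_right _ _
    positivity
  let c : ℝ × ℝ → I := fun p => pr (3 * (1 - p.1) - 1)
  have hc : Continuous c := hpr.comp (by fun_prop)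
  -- At `z = 0` the homotopy time is 0 and the parameter (1 + t)/2 runs over `e`. By z = 1/3 the
  -- time has grown to `t`. Beyond that `c` falls from 1 to 0 and pulls the parameter back to 0,
  -- where `F` is constantly `x`.
  let Θ : C(ℝ × ℝ, X) :=
    ⟨fun p => F (pr (t p * min 1 (3 * p.1)), pr ((c p : ℝ) * (1 + t p) / 2)),
      F.continuous.comp (.prodMk (hpr.comp (by fun_prop)) (hpr.comp (by fun_prop)))⟩
  have hΘ : ∀ p, Θ p = F (pr (t p * min 1 (3 * p.1)), pr ((c p : ℝ) * (1 + t p) / 2)) :=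
    fun p => rfl
  refine ⟨Θ, fun w hw => ?_, fun z => ?_, fun z w hzw => ?_⟩
  · have h1 : t (0, w) = w := by simp only [t]; norm_num
    have h2 : c (0, w) = 1 := hpr1 _ (by norm_num)
    rw [hΘ, h1, h2]
    have h3 : pr (w * min 1 (3 * ((0, w) : ℝ × ℝ).1)) = 0 := hpr0 _ (by simp)
    rw [h3, F.apply_zero]
    change (r.trans e).extend _ = _
    rw [Path.extend_trans_of_half_le _ _ (by simp; linarith)]
    congr 1
    simp
    ring
  · have h1 : t (z, 0) = 0 := by simp [t]
    rw [hΘ, h1, zero_mul, hpr0 0 le_rfl, F.apply_zero]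
    change (r.trans e).extend _ = _
    have := (c (z, 0)).2.2
    rw [Path.extend_trans_of_le_half _ _ (by linarith)]
    have : 2 * ((c (z, 0) : ℝ) * (1 + 0) / 2) = c (z, 0) := by ring
    rw [this, Path.extend_apply _ (c (z, 0)).2]
    rfl
  · obtain rfl : z = 1 - w := by linarith
    rcases le_total w (1 / 3) with h1 | h1
    · have h2 : c (1 - w, w) = 0 := hpr0 _ (by simp; linarith)
      rw [hΘ, h2]
      have h3 : pr (((0 : I) : ℝ) * (1 + t (1 - w, w)) / 2) = 0 := hpr0 _ (by simp)
      rw [h3, F.source, Path.extend_of_le_zero _ (by linarith)]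
    · have h2 : t (1 - w, w) = 1 := by
        simp only [t]
        rw [sub_sub_cancel, max_eq_left h1, div_self (by linarith)]
      have h3 : c (1 - w, w) = pr (3 * w - 1) := by simp only [c]; rw [sub_sub_cancel]
      rw [hΘ, h2, h3]
      have h4 : pr ((pr (3 * w - 1) : ℝ) * (1 + 1) / 2) = pr (3 * w - 1) := by
        rw [show (pr (3 * w - 1) : ℝ) * (1 + 1) / 2 = (pr (3 * w - 1) : ℝ) by ring]
        exact Set.projIcc_val _ _
      rw [h4]
      rcases le_total w (2 / 3) with h5 | h5
      · have h6 : pr (1 * min 1 (3 * ((1 - w, w) : ℝ × ℝ).1)) = 1 := by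
          refine hpr1 _ ?_
          rw [one_mul, min_eq_left]
          simp; linarith
        rw [h6, F.apply_one]
        rfl
      · have h6 : pr (3 * w - 1) = 1 := hpr1 _ (by linarith)
        rw [h6, F.target, Path.extend_of_one_le _ (by linarith)]

namespace ClosedOrientedSurface

/-- Maps given on the closed triangles can be glued. -/
lemma exists_glue {T : ClosedOrientedSurface} {X : Type*} [TopologicalSpace X]
    (Γ : T.Carrier → X → Prop) (huniq : ∀ y x x', Γ y x → Γ y x' → x = x')
    (hex : ∀ t ∈ T.triangles, ∃ G : C({y : T.Carrier // ∀ v, v ∉ t → y.1 v = 0}, X),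
      ∀ y, Γ y.1 (G y)) : ∃ g : C(T.Carrier, X), ∀ y, Γ y (g y) := by
  have h : ∀ y, ∃ x, Γ y x := by
    intro y
    obtain ⟨t, ht, hy⟩ := y.2
    obtain ⟨G, hG⟩ := hex t ht
    exact ⟨_, hG ⟨y, hy⟩⟩
  choose g hg using h
  refine ⟨⟨g, continuous_of_faces fun t ht => ?_⟩, hg⟩
  obtain ⟨G, hG⟩ := hex t ht
  rw [continuousOn_iff_continuous_domRestrict]
  exact G.continuous.congr fun y => huniq _ _ _ (hG y) (hg _)

/-- The surface `T` arises from `S` by cutting along the cycle `ν` and capping off. -/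
structure Capping (S T : ClosedOrientedSurface) (ν : Equiv.Perm S.V) where
  /-- The copy of a vertex on one of the sides. -/
  ov : S.V → Bool → T.V
  /-- The cone points. -/
  cn : Bool → T.V
  /-- The side of the beginning of an edge. -/
  side : S.V → S.V → Bool
  cases : ∀ p, (∃ v s, p = ov v s) ∨ ∃ s, p = cn s
  ov_inj : ∀ {v w s t}, ov v s = ov w t → v = w
  side_inj : ∀ {v w s t}, ν v ≠ v → ov v s = ov w t → s = t
  ov_ne_cn : ∀ {v s t}, ov v s ≠ cn t
  cn_inj : ∀ {s t}, cn s = cn t → s = t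
  tri : ∀ t ∈ T.triangles,
    (∃ a b c, S.orient.R a b c ∧ t = triple (ov a (side a b)) (ov b (side b c)) (ov c (side c a))) ∨
    ∃ v s, ν v ≠ v ∧ t = triple (cn s) (ov v s) (ov (ν v) s)
  ov_lt : ∀ {v w} s t, v < w → ov v s < ov w t
  ov_lt_cn : ∀ {v} s t, ov v s < cn t
  R_lift : ∀ {a b c}, S.orient.R a b c →
    T.orient.R (ov a (side a b)) (ov b (side b c)) (ov c (side c a))
  R_true : ∀ {v}, ν v ≠ v → T.orient.R (cn true) (ov v true) (ov (ν v) true)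
  R_false : ∀ {v}, ν v ≠ v → T.orient.R (cn false) (ov (ν v) false) (ov v false)
  ne_symm : ∀ {v}, ν v ≠ v → ν (ν v) ≠ v

namespace Capping

variable {S T : ClosedOrientedSurface} {ν : Equiv.Perm S.V} (C : Capping S T ν)

open Classical in
/-- The image of a point of `T` off the cones in barycentric coordinates of `S`. -/
noncomputable def proj (y : T.V → ℝ) (u : S.V) : ℝ := ∑ p, if ∃ s, p = C.ov u s then y p else 0

open Classical in
lemma sum_proj (y : T.V → ℝ) :
    ∑ u, C.proj y u = ∑ p, if ∃ s, p = C.cn s then 0 else y p := by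
  simp only [proj]
  rw [Finset.sum_comm]
  refine Finset.sum_congr rfl fun p _ => ?_
  rcases C.cases p with ⟨v, s, rfl⟩ | ⟨s, rfl⟩
  · have h1 : ∀ u, (∃ t, C.ov v s = C.ov u t) ↔ v = u :=
      fun u => ⟨fun ⟨_, h⟩ => C.ov_inj h, fun h => ⟨s, h ▸ rfl⟩⟩
    have h2 : ¬ ∃ t, C.ov v s = C.cn t := fun ⟨t, h⟩ => C.ov_ne_cn h
    simp only [h1, h2, if_false]
    simp
  · have h1 : ∀ u, ¬ ∃ t, C.cn s = C.ov u t := fun u ⟨t, h⟩ => C.ov_ne_cn h.symm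
    simp [h1]

/-- The projection forgets exactly the weight at the cone points; if its total weight is still 1,
there was none. -/
lemma eq_zero_of_proj {y : T.Carrier} {q : S.Carrier} (h : ∀ u, q.1 u = C.proj (fun p => y.1 p) u)
    (s : Bool) : y.1 (C.cn s) = 0 := by
  classical
  have h1 := C.sum_proj fun p => y.1 p
  rw [← Finset.sum_congr rfl fun u _ => h u, q.sum_eq, ← y.sum_eq] at h1
  have h2 : ∑ p, (y.1 p - if ∃ s, p = C.cn s then 0 else y.1 p) = 0 := by
    rw [Finset.sum_sub_distrib, h1, sub_self]
  rw [Finset.sum_eq_zero_iff_of_nonneg] at h2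
  · have := h2 (C.cn s) (Finset.mem_univ _)
    rwa [if_pos ⟨s, rfl⟩, sub_zero] at this
  · intro p _
    have := y.nonneg p
    split_ifs <;> simp [this]

end Capping

lemma sum_eq_triple {U : Type} [Fintype U] [LinearOrder U] {M : Type*} [AddCommMonoid M] {p q r : U}
    (hpq : p ≠ q) (hpr : p ≠ r) (hqr : q ≠ r) {F : U → M} (hF : ∀ x, x ∉ triple p q r → F x = 0) :
    ∑ x, F x = F p + (F q + F r) := by
  rw [← Finset.sum_subset (Finset.subset_univ (triple p q r)) fun x _ hx => hF x hx, triple,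
    Finset.sum_insert (by simp [hpq, hpr]), Finset.sum_pair hqr]

namespace Capping

variable {S T : ClosedOrientedSurface} {ν : Equiv.Perm S.V} (C : Capping S T ν)

lemma sum_cone {v : S.V} (hv : ν v ≠ v) {s : Bool} {M : Type*} [AddCommMonoid M] {F : T.V → M}
    (hF : ∀ p, p ∉ triple (C.cn s) (C.ov v s) (C.ov (ν v) s) → F p = 0) :
    ∑ p, F p = F (C.cn s) + (F (C.ov v s) + F (C.ov (ν v) s)) :=
  sum_eq_triple C.ov_ne_cn.symm C.ov_ne_cn.symm (fun h => hv (C.ov_inj h).symm) hF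

/-- The coordinates of the projection of a point on the edge from `v` to `ν v`. -/
lemma proj_cone {v : S.V} (hv : ν v ≠ v) {s : Bool} {y : T.V → ℝ}
    (hy : ∀ p, p ∉ triple (C.cn s) (C.ov v s) (C.ov (ν v) s) → y p = 0) (u : S.V) :
    C.proj y u = y (C.ov v s) * (pt v : S.Carrier).1 u +
      y (C.ov (ν v) s) * (pt (ν v) : S.Carrier).1 u := by
  classical
  have h1 : ∀ w, (∃ t, C.ov w s = C.ov u t) ↔ u = w :=
    fun w => ⟨fun ⟨_, h⟩ => (C.ov_inj h).symm, fun h => ⟨s, h ▸ rfl⟩⟩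
  have h2 : ¬ ∃ t, C.cn s = C.ov u t := fun ⟨t, h⟩ => C.ov_ne_cn h.symm
  rw [proj, C.sum_cone hv (s := s)]
  · simp only [h1, h2, if_false, pt_apply]
    simp
  · intro p hp
    rw [hy p hp, ite_self]

variable {X : Type u} [TopologicalSpace X] {f : C(S.Carrier, X)} {Θ : S.V → C(ℝ × ℝ, X)}

/-- The values of the extended map. -/
def Value (f : C(S.Carrier, X)) (Θ : S.V → C(ℝ × ℝ, X)) (y : T.Carrier) (x : X) : Prop :=
  (∃ q : S.Carrier, (∀ u, q.1 u = C.proj (fun p => y.1 p) u) ∧ x = f q) ∨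
  ∃ v s, ν v ≠ v ∧ (∀ p, p ∉ triple (C.cn s) (C.ov v s) (C.ov (ν v) s) → y.1 p = 0) ∧
    x = Θ v (y.1 (C.cn s), y.1 (C.ov (ν v) s))

variable {x₀ : X} {ρ : S.V → ℝ → X}
  (h0 : ∀ v, ν v ≠ v → ∀ t, 0 ≤ t → ∀ q : S.Carrier,
    (∀ u, q.1 u = (1 - t) * (pt v : S.Carrier).1 u + t * (pt (ν v) : S.Carrier).1 u) →
      Θ v (0, t) = f q)
  (h1 : ∀ v, ν v ≠ v → ∀ z, Θ v (z, 0) = ρ v (1 - z))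
  (h2 : ∀ v, ν v ≠ v → ∀ z w, z + w = 1 → Θ v (z, w) = ρ (ν v) w)
  (h3 : ∀ v, ρ v 0 = x₀)

include h0 h1 h2 h3

/-- Overlaps are of three kinds. A cap meets the lifted part in its base, governed by `h0`;
consecutive triangles of a cap meet in a spoke, where `h1` and `h2` prescribe the same path `ρ`;
other triangles of a cap meet only at the apex, with value `x₀` by `h3`. The two caps are disjoint.
-/
lemma value_unique {y : T.Carrier} {x x' : X} (h : C.Value f Θ y x) (h' : C.Value f Θ y x') :
    x = x' := by
  have key : ∀ v s (q : S.Carrier), ν v ≠ v → (∀ u, q.1 u = C.proj (fun p => y.1 p) u) →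
      (∀ p, p ∉ triple (C.cn s) (C.ov v s) (C.ov (ν v) s) → y.1 p = 0) →
      Θ v (y.1 (C.cn s), y.1 (C.ov (ν v) s)) = f q := by
    intro v s q hv hq hy
    have e1 := C.eq_zero_of_proj hq s
    have e2 := y.sum_eq
    rw [C.sum_cone hv hy, e1] at e2
    rw [e1]
    refine h0 v hv _ (y.nonneg _) q fun u => ?_
    rw [hq, C.proj_cone hv hy]
    congr 2
    linarith
  rcases h with ⟨q, hq, rfl⟩ | ⟨v, s, hv, hy, rfl⟩ <;>
    rcases h' with ⟨q', hq', rfl⟩ | ⟨w, t, hw, hy', rfl⟩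
  · rw [Carrier.ext fun u => (hq u).trans (hq' u).symm]
  · exact (key w t q hw hq hy').symm
  · exact key v s q' hv hq' hy
  · have hsum := y.sum_eq
    rw [C.sum_cone hv hy] at hsum
    have hsum' := y.sum_eq
    rw [C.sum_cone hw hy'] at hsum'
    have hνv : ν (ν v) ≠ ν v := fun h => hv (ν.injective h)
    have hνw : ν (ν w) ≠ ν w := fun h => hw (ν.injective h)
    by_cases hst : s = t
    · subst hst
      by_cases hvw : v = w
      · rw [hvw]
      have hz : ∀ u, u ≠ w → u ≠ ν w → y.1 (C.ov u s) = 0 := by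
        intro u k1 k2
        refine hy' _ ?_
        rw [mem_triple]
        rintro (k | k | k)
        · exact C.ov_ne_cn k
        · exact k1 (C.ov_inj k)
        · exact k2 (C.ov_inj k)
      have hz' : ∀ u, u ≠ v → u ≠ ν v → y.1 (C.ov u s) = 0 := by
        intro u k1 k2
        refine hy _ ?_
        rw [mem_triple]
        rintro (k | k | k)
        · exact C.ov_ne_cn k
        · exact k1 (C.ov_inj k)
        · exact k2 (C.ov_inj k)
      have hνvw : ν v ≠ ν w := fun h => hvw (ν.injective h)
      by_cases k1 : v = ν w
      · have k2 : ν v ≠ w := by rw [k1]; exact C.ne_symm hw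
        have e1 := hz (ν v) k2 hνvw
        have e2 := hz' w (Ne.symm hvw) k2.symm
        rw [e1] at hsum
        rw [e2] at hsum'
        rw [e1, h1 v hv, h2 w hw _ _ (by linarith), ← k1]
        congr 1
        linarith
      · have e1 := hz v hvw k1
        rw [e1] at hsum
        rw [h2 v hv _ _ (by linarith)]
        by_cases k2 : ν v = w
        · have e2 := hz' (ν w) (Ne.symm k1) (Ne.symm hνvw)
          rw [e2] at hsum'
          rw [e2, h1 w hw, k2]
          congr 1
          linarith
        · have e2 := hz (ν v) k2 hνvw
          have e3 := hz' (ν w) (Ne.symm k1) (Ne.symm hνvw)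
          have e4 := hz' w (Ne.symm hvw) (Ne.symm k2)
          rw [e3, e4] at hsum'
          rw [e2, h3, e3, h1 w hw, ← h3 w]
          congr 1
          linarith
    · exfalso
      have e1 : y.1 (C.cn s) = 0 := by
        refine hy' _ ?_
        rw [mem_triple]
        rintro (k | k | k)
        · exact hst (C.cn_inj k)
        · exact C.ov_ne_cn k.symm
        · exact C.ov_ne_cn k.symm
      have e2 : ∀ u, ν u ≠ u → y.1 (C.ov u s) = 0 := by
        intro u hu
        refine hy' _ ?_
        rw [mem_triple]
        rintro (k | k | k)
        · exact C.ov_ne_cn k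
        · exact hst (C.side_inj hu k)
        · exact hst (C.side_inj hu k)
      rw [e1, e2 v hv, e2 (ν v) hνv] at hsum
      norm_num at hsum

/-- The map extends over the caps. -/
theorem exists_map : ∃ g : C(T.Carrier, X), ∀ y, C.Value f Θ y (g y) := by
  classical
  refine exists_glue _ (fun y x x' => C.value_unique h0 h1 h2 h3) fun t ht => ?_
  rcases C.tri t ht with ⟨a, b, c, h, rfl⟩ | ⟨v, s, hv, rfl⟩
  · set t := triple (C.ov a (C.side a b)) (C.ov b (C.side b c)) (C.ov c (C.side c a)) with ht'
    have hcont : ∀ u, Continuous fun y : {y : T.Carrier // ∀ v, v ∉ t → y.1 v = 0} =>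
        C.proj (fun p => y.1.1 p) u := by
      intro u
      simp only [proj]
      refine continuous_finsetSum _ fun p _ => ?_
      split_ifs
      · exact (continuous_coord p).comp continuous_subtype_val
      · exact continuous_const
    let π : C({y : T.Carrier // ∀ v, v ∉ t → y.1 v = 0}, S.Carrier) :=
      ⟨fun y => mkPt (C.proj fun p => y.1.1 p)
        (fun u => Finset.sum_nonneg fun p _ => by
          have := y.1.nonneg p
          split_ifs
          · exact this
          · exact le_rfl)
        (by
          rw [C.sum_proj, ← y.1.sum_eq]
          refine Finset.sum_congr rfl fun p _ => ?_
          split_ifs with hp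
          · obtain ⟨s, rfl⟩ := hp
            refine (y.2 _ ?_).symm
            rw [ht', mem_triple]
            rintro (k | k | k) <;> exact C.ov_ne_cn k.symm
          · rfl)
        ⟨triple a b c, mem_triangles.2 ⟨a, b, c, h, rfl⟩, fun u hu => by
          refine Finset.sum_eq_zero fun p _ => ?_
          split_ifs with hp
          · obtain ⟨s, rfl⟩ := hp
            refine y.2 _ fun k => hu ?_
            rw [ht', mem_triple] at k
            rw [mem_triple]
            rcases k with k | k | k
            · exact .inl (C.ov_inj k)
            · exact .inr (.inl (C.ov_inj k))
            · exact .inr (.inr (C.ov_inj k))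
          · rfl⟩, continuous_carrier fun u => hcont u⟩
    exact ⟨f.comp π, fun y => .inl ⟨π y, fun u => rfl, rfl⟩⟩
  · refine ⟨(Θ v).comp ⟨fun y => (y.1.1 (C.cn s), y.1.1 (C.ov (ν v) s)), ?_⟩,
      fun y => .inr ⟨v, s, hv, y.2, rfl⟩⟩
    exact ((continuous_coord _).comp continuous_subtype_val).prodMk
      ((continuous_coord _).comp continuous_subtype_val)

end Capping

end ClosedOrientedSurface

/-! ### The fundamental chain is unchanged by the surgery -/

namespace ClosedOrientedSurface

variable {S T : ClosedOrientedSurface} {X : Type u} [TopologicalSpace X]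

lemma simp₃_congr {g : C(T.Carrier, X)} {f : C(S.Carrier, X)} {p q r : T.Carrier}
    {p' q' r' : S.Carrier} (h : CommonFace ![p, q, r]) (h' : CommonFace ![p', q', r'])
    (he : ∀ w, g (affMap _ h w) = f (affMap _ h' w)) : simp₃ g p q r = simp₃ f p' q' r' := by
  rw [simp₃, dif_pos h, simp₃, dif_pos h']
  congr 1
  ext w
  exact he w

lemma signedSimplex_of_R (f : C(S.Carrier, X)) {a b c x y z : S.V} (hR : S.orient.R a b c)
    (hset : triple a b c = triple x y z) (hxy : x < y) (hyz : y < z) {ε : ℤˣ}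
    (hε : triSign a b c = ε) :
    signedSimplex f (triple a b c) = (ε : ℤ) • simp₃ f (pt x) (pt y) (pt z) := by
  have ht : triple a b c ∈ S.triangles := mem_triangles.2 ⟨a, b, c, hR, rfl⟩
  have hs : S.sign (triple a b c) = ε := (sign_eq hR).trans hε
  rw [hset] at ht hs ⊢
  rw [← hs]
  exact signedSimplex_eq f hxy hyz ht

lemma commonFace_of_R {a b c x y z : S.V} (hR : S.orient.R a b c)
    (hset : triple a b c = triple x y z) :
    CommonFace ![(pt x : S.Carrier), pt y, pt z] := by
  have ht : triple a b c ∈ S.triangles := mem_triangles.2 ⟨a, b, c, hR, rfl⟩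
  rw [hset] at ht
  exact commonFace_pt ht

lemma triSign_of_lt_of_lt {V : Type} [LinearOrder V] {a b c : V} (h : a < c) (h' : c < b) :
    triSign a b c = -1 := by
  simp [triSign, pairSign, h, h.trans h', h'.not_gt]

namespace Capping

variable {ν : Equiv.Perm S.V} (C : Capping S T ν)

lemma proj_pt (v : S.V) (s : Bool) (u : S.V) :
    C.proj (fun p => (pt (C.ov v s) : T.Carrier).1 p) u = (pt v : S.Carrier).1 u := by
  classical
  have h1 : (∃ t, C.ov v s = C.ov u t) ↔ u = v :=
    ⟨fun ⟨_, h⟩ => (C.ov_inj h).symm, fun h => ⟨s, h ▸ rfl⟩⟩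
  rw [proj, Finset.sum_eq_single (C.ov v s)]
  · simp only [h1, pt_apply, if_true]
  · intro p _ hp
    rw [pt_apply, if_neg hp, ite_self]
  · simp

lemma proj_affMap {n : ℕ} (μ : Fin n → T.Carrier) (h : CommonFace μ) (w : stdSimplex ℝ (Fin n))
    (u : S.V) : C.proj (fun p => (affMap μ h w).1 p) u =
      ∑ i, w i * C.proj (fun p => (μ i).1 p) u := by
  classical
  simp only [proj, affMap_apply, Finset.mul_sum]
  rw [Finset.sum_comm]
  refine Finset.sum_congr rfl fun p _ => ?_
  split_ifs <;> simp

variable {f : C(S.Carrier, X)} {Θ : S.V → C(ℝ × ℝ, X)} {g : C(T.Carrier, X)}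
  (hu : ∀ (y : T.Carrier) x x', C.Value f Θ y x → C.Value f Θ y x' → x = x')
  (hg : ∀ y, C.Value f Θ y (g y))

include hu hg

lemma simp₃_lift {a b c : S.V} {i j k : Bool}
    (h : CommonFace ![(pt (C.ov a i) : T.Carrier), pt (C.ov b j), pt (C.ov c k)])
    (h' : CommonFace ![(pt a : S.Carrier), pt b, pt c]) :
    simp₃ g (pt (C.ov a i)) (pt (C.ov b j)) (pt (C.ov c k)) = simp₃ f (pt a) (pt b) (pt c) := by
  refine simp₃_congr h h' fun w => hu _ _ _ (hg _) (.inl ⟨_, fun u => ?_, rfl⟩)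
  rw [proj_affMap, affMap_apply]
  refine Finset.sum_congr rfl fun l _ => ?_
  congr 1
  fin_cases l
  · exact (C.proj_pt a i u).symm
  · exact (C.proj_pt b j u).symm
  · exact (C.proj_pt c k u).symm

/-- Copies of distinct vertices are ordered as the vertices are, so a lifted triangle has the sign
and the increasing parametrization of the original. Rotation reduces to the smallest vertex being
first. -/
lemma signedSimplex_lift {a b c : S.V} (h : S.orient.R a b c) :
    signedSimplex g (triple (C.ov a (C.side a b)) (C.ov b (C.side b c)) (C.ov c (C.side c a))) =
      signedSimplex f (triple a b c) := by
  have key : ∀ {a b c}, S.orient.R a b c → a < b → a < c →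
      signedSimplex g (triple (C.ov a (C.side a b)) (C.ov b (C.side b c)) (C.ov c (C.side c a))) =
        signedSimplex f (triple a b c) := by
    intro a b c h hab hac
    have hT := C.R_lift h
    rcases lt_or_gt_of_ne (S.orient.ne' h).2.1 with hbc | hbc
    · rw [signedSimplex_of_R f h rfl hab hbc (triSign_of_lt hab hbc),
        signedSimplex_of_R g hT rfl (C.ov_lt _ _ hab) (C.ov_lt _ _ hbc)
          (triSign_of_lt (C.ov_lt _ _ hab) (C.ov_lt _ _ hbc)),
        C.simp₃_lift hu hg (commonFace_of_R hT rfl) (commonFace_of_R h rfl)]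
    · have e1 : triple a b c = triple a c b := OrTri.triple_comm _ _ _
      have e2 := OrTri.triple_comm (C.ov a (C.side a b)) (C.ov b (C.side b c)) (C.ov c (C.side c a))
      rw [signedSimplex_of_R f h e1 hac hbc (triSign_of_lt_of_lt hac hbc),
        signedSimplex_of_R g hT e2 (C.ov_lt _ _ hac) (C.ov_lt _ _ hbc)
          (triSign_of_lt_of_lt (C.ov_lt _ _ hac) (C.ov_lt _ _ hbc)),
        C.simp₃_lift hu hg (commonFace_of_R hT e2) (commonFace_of_R h e1)]
  obtain ⟨n1, n2, n3⟩ := S.orient.ne' h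
  rcases lt_or_gt_of_ne n1 with h1 | h1
  · rcases lt_or_gt_of_ne n3 with h2 | h2
    · exact key h h1 h2
    · rw [triple_rotate, triple_rotate, triple_rotate a, triple_rotate b]
      exact key (S.orient.cyc (S.orient.cyc h)) h2 (h2.trans h1)
  · rcases lt_or_gt_of_ne n2 with h2 | h2
    · rw [triple_rotate, triple_rotate a]
      exact key (S.orient.cyc h) h2 h1
    · rw [triple_rotate, triple_rotate, triple_rotate a, triple_rotate b]
      exact key (S.orient.cyc (S.orient.cyc h)) (h2.trans h1) h2

lemma g_cone {v : S.V} (hv : ν v ≠ v) {s : Bool} {y : T.Carrier}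
    (hy : ∀ p, p ∉ triple (C.cn s) (C.ov v s) (C.ov (ν v) s) → y.1 p = 0) :
    g y = Θ v (y.1 (C.cn s), y.1 (C.ov (ν v) s)) :=
  hu _ _ _ (hg y) (.inr ⟨v, s, hv, hy, rfl⟩)

/-- The right-hand side does not mention the side: the triangles of both caps over an edge are
mapped by the same `Θ v`. The cone point comes last because it is the largest vertex. -/
lemma g_cone_affMap {v : S.V} (hv : ν v ≠ v) {s : Bool} {a b : S.V}
    (h : CommonFace ![(pt (C.ov a s) : T.Carrier), pt (C.ov b s), pt (C.cn s)])
    (hab : (a = v ∧ b = ν v) ∨ (a = ν v ∧ b = v)) (w : stdSimplex ℝ (Fin 3)) :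
    g (affMap _ h w) = Θ v (w 2, if a = v then w 1 else w 0) := by
  have hne : C.ov (ν v) s ≠ C.ov v s := fun h => hv (C.ov_inj h)
  rw [C.g_cone hu hg hv (s := s)]
  · congr 2
    · simp [Fin.sum_univ_three, C.ov_ne_cn.symm]
    · rcases hab with ⟨rfl, rfl⟩ | ⟨rfl, rfl⟩
      · simp [Fin.sum_univ_three, C.ov_ne_cn, hne]
      · simp [Fin.sum_univ_three, C.ov_ne_cn, hne, hv]
  · intro p hp
    rw [mem_triple] at hp
    push Not at hp
    obtain ⟨p1, p2, p3⟩ := hp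
    rcases hab with ⟨rfl, rfl⟩ | ⟨rfl, rfl⟩ <;> simp [Fin.sum_univ_three, p1, p2, p3]

/-- The two cap triangles over an edge carry the same singular simplex with opposite orientations,
so they cancel already as chains. -/
lemma signedSimplex_cone {v : S.V} (hv : ν v ≠ v) :
    signedSimplex g (triple (C.cn true) (C.ov v true) (C.ov (ν v) true)) +
      signedSimplex g (triple (C.cn false) (C.ov v false) (C.ov (ν v) false)) = 0 := by
  have hT := T.orient.cyc (C.R_true hv)
  have hF := T.orient.cyc (C.R_false hv)
  have key : ∀ a b, ((a = v ∧ b = ν v) ∨ (a = ν v ∧ b = v)) →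
      CommonFace ![(pt (C.ov a true) : T.Carrier), pt (C.ov b true), pt (C.cn true)] →
      CommonFace ![(pt (C.ov a false) : T.Carrier), pt (C.ov b false), pt (C.cn false)] →
      simp₃ g (pt (C.ov a true)) (pt (C.ov b true)) (pt (C.cn true)) =
        simp₃ g (pt (C.ov a false)) (pt (C.ov b false)) (pt (C.cn false)) := by
    intro a b hab h h'
    refine simp₃_congr h h' fun w => ?_
    rw [C.g_cone_affMap hu hg hv h hab, C.g_cone_affMap hu hg hv h' hab]
  have hcomm : ∀ p q r : T.V, triple p q r = triple q p r := by
    intro p q r; ext; simp only [mem_triple]; tauto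
  rw [triple_rotate, OrTri.triple_comm (C.cn false), triple_rotate (C.cn false)]
  rcases lt_or_gt_of_ne hv with h | h
  · have hsw : ∀ s, triSign (C.ov v s) (C.ov (ν v) s) (C.cn s) = -1 := fun s => by
      rw [triSign_swap (C.ov_lt s s h).ne, triSign_of_lt (C.ov_lt s s h) (C.ov_lt_cn s s)]
    rw [signedSimplex_of_R g hT (hcomm _ _ _) (C.ov_lt _ _ h) (C.ov_lt_cn _ _) (hsw _),
      signedSimplex_of_R g hF rfl (C.ov_lt _ _ h) (C.ov_lt_cn _ _)
        (triSign_of_lt (C.ov_lt _ _ h) (C.ov_lt_cn _ _)),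
      key _ _ (.inr ⟨rfl, rfl⟩) (commonFace_of_R hT (hcomm _ _ _)) (commonFace_of_R hF rfl)]
    simp
  · have hsw : ∀ s, triSign (C.ov (ν v) s) (C.ov v s) (C.cn s) = -1 := fun s => by
      rw [triSign_swap (C.ov_lt s s h).ne, triSign_of_lt (C.ov_lt s s h) (C.ov_lt_cn s s)]
    rw [signedSimplex_of_R g hF (hcomm _ _ _) (C.ov_lt _ _ h) (C.ov_lt_cn _ _) (hsw _),
      signedSimplex_of_R g hT rfl (C.ov_lt _ _ h) (C.ov_lt_cn _ _)
        (triSign_of_lt (C.ov_lt _ _ h) (C.ov_lt_cn _ _)),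
      key _ _ (.inl ⟨rfl, rfl⟩) (commonFace_of_R hT rfl) (commonFace_of_R hF (hcomm _ _ _))]
    simp

end Capping

section Surgery

variable {ν : Equiv.Perm S.V}

/-- The capped surface. -/
noncomputable def cutCapping (hν : S.orient.IsEdgeCycle ν) : Capping S (cutSurface hν) ν where
  ov := OrTri.ov ν
  cn := OrTri.cn ν
  side := S.orient.side ν
  cases p := by
    rcases OrTri.cutV_cases (ν := ν) p with ⟨v, h⟩ | ⟨v, -, h⟩ | ⟨s, h⟩
    · exact .inl ⟨v, _, h⟩
    · exact .inl ⟨v, _, h⟩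
    · exact .inr ⟨s, h⟩
  ov_inj := OrTri.ov_injective
  side_inj := OrTri.ov_injective'
  ov_ne_cn := OrTri.ov_ne_cn _ _ _
  cn_inj := OrTri.cn_injective
  tri t ht := (OrTri.mem_tris_cut hν).1 ht
  ov_lt s t h := OrTri.ov_lt_ov h s t
  ov_lt_cn s t := OrTri.ov_lt_cn _ s t
  R_lift h := (OrTri.orient_toSurface (OrTri.cut hν) _ _ _).2 (OrTri.cut_R_lift hν h)
  R_true hv := (OrTri.orient_toSurface (OrTri.cut hν) _ _ _).2
    (OrTri.cut_R_cone hν (OrTri.coneEdge_iff.2 (.inr ⟨rfl, hv, rfl⟩)))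
  R_false hv := (OrTri.orient_toSurface (OrTri.cut hν) _ _ _).2
    (OrTri.cut_R_cone hν (OrTri.coneEdge_iff.2 (.inl ⟨rfl, hv, rfl⟩)))
  ne_symm hv := hν.ne_symm _ hv

/-- If the loop along the cycle is null-homotopic in `X`, then the map extends over the caps and
still represents the same class. -/
theorem exists_map_cutSurface (hν : S.orient.IsEdgeCycle ν) (f : C(S.Carrier, X)) (x₀ : X)
    (φ : ∀ v, FundamentalGroupoid.mk x₀ ⟶ FundamentalGroupoid.mk (f (pt v)))
    (hφ : ∀ v, ν v ≠ v → ∀ hf : SameFace (pt v : S.Carrier) (pt (ν v)),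
      φ v ≫ cls ((seg _ _ hf).map f.continuous) = φ (ν v)) :
    ∃ g : C((cutSurface hν).Carrier, X), ∀ α, Represents f α → Represents g α := by
  classical
  have hr : ∀ v, ∃ r : Path x₀ (f (pt v)), cls r = φ v := fun v => cls_surj (φ v)
  choose r hr using hr
  have hface : ∀ v, ν v ≠ v → SameFace (pt v : S.Carrier) (pt (ν v)) := by
    intro v hv
    obtain ⟨c, hc⟩ := hν.adj v hv
    exact sameFace_of_R hc
  have hΘ : ∀ v, ∃ Θ : C(ℝ × ℝ, X), ν v ≠ v →
      (∀ t, 0 ≤ t → ∀ q : S.Carrier,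
        (∀ u, q.1 u = (1 - t) * (pt v : S.Carrier).1 u + t * (pt (ν v) : S.Carrier).1 u) →
          Θ (0, t) = f q) ∧
      (∀ z, Θ (z, 0) = (r v).extend (3 * (1 - z) - 1)) ∧
      ∀ z w, z + w = 1 → Θ (z, w) = (r (ν v)).extend (3 * w - 1) := by
    intro v
    by_cases hv : ν v = v
    · exact ⟨.const _ x₀, fun h => absurd hv h⟩
    obtain ⟨Θ, k1, k2, k3⟩ := exists_filling (r v) (r (ν v))
      ((seg _ _ (hface v hv)).map f.continuous) (by rw [hr, hr]; exact hφ v hv _)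
    refine ⟨Θ, fun _ => ⟨fun t ht q hq => ?_, k2, k3⟩⟩
    -- The coordinate of `q` at `v` is 1 - t, and coordinates are nonnegative.
    have ht1 : t ≤ 1 := by
      have := q.nonneg v
      rw [hq] at this
      simp only [pt_apply, if_true, if_neg (Ne.symm hv)] at this
      linarith
    rw [k1 t ht, Path.extend_apply _ ⟨ht, ht1⟩]
    exact congrArg f (Carrier.ext fun u => (hq u).symm)
  choose Θ hΘ using hΘ
  let C := cutCapping hν
  have h0 := fun v hv => (hΘ v hv).1
  let ρ : S.V → ℝ → X := fun v w => (r v).extend (3 * w - 1)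
  have h1 : ∀ v, ν v ≠ v → ∀ z, Θ v (z, 0) = ρ v (1 - z) :=
    fun v hv => (hΘ v hv).2.1
  have h2 : ∀ v, ν v ≠ v → ∀ z w, z + w = 1 →
      Θ v (z, w) = ρ (ν v) w :=
    fun v hv => (hΘ v hv).2.2
  have h3 : ∀ v, ρ v 0 = x₀ :=
    fun v => Path.extend_of_le_zero _ (by norm_num)
  obtain ⟨g, hg⟩ := C.exists_map h0 h1 h2 h3
  have hu := fun (y : (cutSurface hν).Carrier) x x' => C.value_unique (y := y) (x := x) (x' := x')
    h0 h1 h2 h3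
  refine ⟨g, fun α hα => ?_⟩
  have hchain : fundamentalChain g = fundamentalChain f := by
    rw [fundamentalChain_eq, fundamentalChain_eq]
    refine (OrTri.sum_tris_cut hν (signedSimplex g) (signedSimplex f) fun a b c h =>
      C.signedSimplex_lift hu hg h).trans ?_
    rw [tris_orient]
    refine (congrArg _ (Finset.sum_eq_zero fun v hv => ?_)).trans (add_zero _)
    rw [Equiv.Perm.mem_support] at hv
    exact C.signedSimplex_cone hu hg hv
  rw [Represents, hchain]
  exact hα

end Surgery

end ClosedOrientedSurface

/-! ### The norm inequality -/

theorem mainTheorem1 {X : Type u} [TopologicalSpace X] (hX : IsEilenbergMacLaneOne X)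
    (α : H2 X) (S : ClosedOrientedSurface) (f : C(S.Carrier, X))
    (hf : ClosedOrientedSurface.Represents f α)
    (hS : ∀ c, ¬ S.IsTorus c ∧ ¬ S.IsSphere c)
    (h : ((-(S.eulerChar : ℝ) - 2 : ℝ) : EReal) < gromovThurstonNorm α) :
    ClosedOrientedSurface.IsIncompressible f := by
  intro x p hinj htriv
  by_contra hne
  have := hX.1
  obtain ⟨Q, ν, hcyc, hadj, hsymm, ⟨x₀, φ, hφ⟩, G, _, l, hl1, hl2, hl3⟩ :=
    ClosedOrientedSurface.exists_edge_cycle f p hinj htriv hne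
  simp only [Equiv.Perm.mem_support] at hadj hsymm hφ hl3
  have hν : Q.T.orient.IsEdgeCycle ν :=
    ⟨fun _ _ => hcyc.sameCycle, hcyc.imp fun _ hx => hx.1, hadj, hsymm⟩
  obtain ⟨g, hg⟩ := ClosedOrientedSurface.exists_map_cutSurface hν
    (f.comp (Q.h : C(Q.T.Carrier, S.Carrier))) x₀ φ hφ
  have hsph := ClosedOrientedSurface.not_isSphere_cutSurface hν
    (Q.noSphereTorus (ClosedOrientedSurface.noSphereTorus hS)) l hl1 hl2 hl3
  -- The compressed surface is a competitor in the infimum with `n = 1`, and its Euler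
  -- characteristic is that of `S` plus 2.
  have hle : gromovThurstonNorm α ≤
      ((-((ClosedOrientedSurface.cutSurface hν).eulerChar : ℝ) / (1 : ℕ) : ℝ) : EReal) :=
    iInf_le_of_le _ <| iInf_le_of_le g <| iInf_le_of_le 1 <| iInf_le_of_le le_rfl <|
      iInf_le_of_le hsph <| iInf_le_of_le (by rw [one_smul]; exact hg α (Q.represents f hf)) le_rfl
  refine (h.trans_le hle).ne ?_
  rw [ClosedOrientedSurface.eulerChar_cutSurface, Q.euler]
  exact congrArg Real.toEReal (by push_cast; ring)
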